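/- Let $A$ be a connected Nakayama algebra; that is, $A$ is an Artin algebra (an algebra that is finitely generated as a module over a commutative artinian ring $R$), $A \neq 0$, the only central idempotents of $A$ are $0$ and $1$, and all finitely generated indecomposable projective and all finitely generated indecomposable injective (left) $A$-modules are uniserial. Assume that $A$ has infinite global dimension. For a simple $A$-module $S$, let $P(S)$ be its projective cover and $I(S)$ its injective envelope. Let $D = \operatorname{Hom}_R(-, J)$, where $J$ is the injective envelope of $R/\operatorname{rad} R$, be the usual duality, and let $\tau = D\operatorname{Tr}$ be the Auslander–Reiten translation. For a simple $A$-module $S$ put $\tilde\tau(S) = \tau(S)$ if $S$ is not projective and $\tilde\tau(S) = S_{\mathrm{inj}}$, the unique simple injective $A$-module, if $S$ is projective. On the set of isomorphism classes of simple $A$-modules, define the maps $$\gamma(S) = \tilde\tau(\operatorname{soc} P(S)), \qquad \psi(S) = \tilde\tau^{-1}(\operatorname{top} I(S)).$$ A simple module $S$ is called $\gamma$-cyclic (resp. $\psi$-cyclic) if $\gamma^m(S) = S$ (resp. $\psi^m(S) = S$) for some integer $m > 0$; it is called $\gamma$-black if $\operatorname{pd} S \neq 1$ and $\psi$-black if $\operatorname{id}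 S \neq 1$. The resolution quiver of $A$ has the isomorphism classes of simple $A$-modules as vertices and exactly one arrow $S \to \gamma(S)$ for each vertex $S$; a cycle in it is called black if every vertex on it is $\gamma$-black. The algebra $A$ is Gorenstein if both $\operatorname{id} A$ and $\operatorname{pd} DA$ are finite. Then the following statements are equivalent: 1. $A$ is a Gorenstein algebra. 2. Each $\gamma$-cyclic simple $A$-module is $\gamma$-black. 3. Each $\psi$-cyclic simple $A$-module is $\psi$-black. 4. The set of $\gamma$-cyclic simple $A$-modules is equal to the set of $\psi$-cyclic simple $A$-modules. 5. All cycles in the resolution quiver of $A$ are black. -/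

import Mathlib

open CategoryTheory

universe u

noncomputable section

namespace Nakayama

section Covers

variable (A : Type u) [Ring A]

/-- A projective cover: a surjection from a projective module with superfluous kernel. -/
structure IsProjectiveCover {A : Type u} [Ring A] {P M : Type u} [AddCommGroup P] [Module A P]
    [AddCommGroup M] [Module A M] (p : P →ₗ[A] M) : Prop where
  projective : Module.Projective A P
  surjective : Function.Surjective p
  superfluous : ∀ N : Submodule A P, N ⊔ LinearMap.ker p = ⊤ → N = ⊤

/-- An injective envelope: an injection into an injective module with essential image. -/
structure IsInjectiveEnvelope {A : Type u} [Ring A] {M I : Type u} [AddCommGroup M] [Module A M]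
    [AddCommGroup I] [Module A I] (i : M →ₗ[A] I) : Prop where
  injective : Module.Injective A I
  mono : Function.Injective i
  essential : ∀ N : Submodule A I, N ⊓ LinearMap.range i = ⊥ → N = ⊥

/-- The socle of a module: the sum of its simple submodules. -/
def socle (M : Type u) [AddCommGroup M] [Module A M] : Submodule A M :=
  sSup {N : Submodule A M | IsSimpleModule A N}

/-- The top of a module: the quotient by its radical. -/
abbrev top (M : Type u) [AddCommGroup M] [Module A M] : Type u :=
  M ⧸ Module.jacobson A M

/-- A chain of submodules each of which meets `L` trivially has union meeting `L` trivially,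
in the relative form used for both Zorn arguments below. -/
theorem sSup_inf_eq_bot {E : Type u} [AddCommGroup E] [Module A E] (L : Submodule A E)
    (c : Set (Submodule A E)) (hc : IsChain (· ≤ ·) c) (hne : c.Nonempty)
    (h : ∀ K ∈ c, K ⊓ L = ⊥) : sSup c ⊓ L = ⊥ := by
  rw [eq_bot_iff]
  rintro x ⟨hx, hxL⟩
  obtain ⟨K, hK, hxK⟩ := (Submodule.mem_sSup_of_directed hne hc.directedOn).1 hx
  rw [← h K hK]
  exact ⟨hxK, hxL⟩

theorem exists_injectiveEnvelope (M : Type u) [AddCommGroup M] [Module A M] :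
    ∃ (I : ModuleCat.{u} A) (i : M →ₗ[A] I), IsInjectiveEnvelope i := by
  obtain ⟨⟨E₀, hE, f, hf⟩⟩ := EnoughInjectives.presentation (ModuleCat.of A M)
  have hEinj : Module.Injective A E₀ := Module.injective_module_of_injective_object A E₀
  have hfi : Function.Injective f.hom := (ModuleCat.mono_iff_injective f).1 hf
  set N : Submodule A E₀ := LinearMap.range f.hom with hN
  -- a maximal essential extension `K` of `N` inside `E₀`
  obtain ⟨K, hNK, hK⟩ := zorn_le_nonempty₀
    {K : Submodule A E₀ | N ≤ K ∧ ∀ X ≤ K, X ⊓ N = ⊥ → X = ⊥} (by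
      rintro c hcs hc y hy
      refine ⟨sSup c, ⟨(hcs hy).1.trans (le_sSup hy), ?_⟩, fun z hz => le_sSup hz⟩
      intro X hX hXN
      rw [eq_bot_iff]
      intro x hx
      obtain ⟨Z, hZ, hxZ⟩ := (Submodule.mem_sSup_of_directed ⟨y, hy⟩ hc.directedOn).1 (hX hx)
      have h0 : X ⊓ Z = ⊥ := (hcs hZ).2 _ inf_le_right (by
        rw [eq_bot_iff, ← hXN]
        exact inf_le_inf_right _ inf_le_left)
      rw [← h0]
      exact ⟨hx, hxZ⟩) N ⟨le_rfl, fun X hX h => by rwa [inf_eq_left.2 hX] at h⟩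
  have hKess := hK.prop.2
  -- a maximal submodule `L` meeting `K` trivially
  obtain ⟨L, -, hL⟩ := zorn_le_nonempty₀ {L : Submodule A E₀ | L ⊓ K = ⊥} (by
      rintro c hcs hc y hy
      exact ⟨sSup c, sSup_inf_eq_bot A K c hc ⟨y, hy⟩ hcs, fun z hz => le_sSup hz⟩) ⊥
      (by simp)
  have hLK : L ⊓ K = ⊥ := hL.prop
  -- extend the inclusion of `K` along `K → E₀ ⧸ L`
  have hinj : Function.Injective (L.mkQ ∘ₗ K.subtype) := by
    rw [← LinearMap.ker_eq_bot, eq_bot_iff]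
    rintro ⟨x, hx⟩ h
    have hxL : x ∈ L := by simpa using h
    have : x ∈ L ⊓ K := ⟨hxL, hx⟩
    rw [hLK] at this
    simpa using this
  obtain ⟨g, hg⟩ := hEinj.out (L.mkQ ∘ₗ K.subtype) hinj K.subtype
  have hgK : ∀ x ∈ K, g (L.mkQ x) = x := fun x hx => hg ⟨x, hx⟩
  have hgL : ∀ x, g (L.mkQ x) = 0 → x ∈ L := by
    have hle : L ≤ LinearMap.ker (g ∘ₗ L.mkQ) := by
      intro x hx
      have : L.mkQ x = 0 := by simpa using hx
      simp [this]
    have hk : LinearMap.ker (g ∘ₗ L.mkQ) ⊓ K = ⊥ := by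
      rw [eq_bot_iff]
      rintro x ⟨h1, h2⟩
      have h3 : g (L.mkQ x) = 0 := h1
      rw [hgK x h2] at h3
      simpa using h3
    intro x hx
    exact hL.le_of_ge hk hle hx
  have hrange : LinearMap.range (g ∘ₗ L.mkQ) ≤ K := by
    have hKle : K ≤ LinearMap.range (g ∘ₗ L.mkQ) := fun x hx => ⟨x, hgK x hx⟩
    refine hK.le_of_ge ⟨hNK.trans hKle, ?_⟩ hKle
    intro X hX hXN
    have hXK : X ⊓ K = ⊥ := hKess _ inf_le_right (by
      rw [eq_bot_iff, ← hXN]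
      exact inf_le_inf_right _ inf_le_left)
    have hcomap : Submodule.comap (g ∘ₗ L.mkQ) X ⊓ K = ⊥ := by
      rw [eq_bot_iff, ← hXK]
      rintro x ⟨h1, h2⟩
      refine ⟨?_, h2⟩
      have h3 : g (L.mkQ x) ∈ X := h1
      rwa [hgK x h2] at h3
    have hle : L ≤ Submodule.comap (g ∘ₗ L.mkQ) X := by
      intro x hx
      have : L.mkQ x = 0 := by simpa using hx
      simp [this]
    have hXL := hL.le_of_ge hcomap hle
    rw [eq_bot_iff]
    intro x hx
    obtain ⟨y, rfl⟩ := hX hx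
    have hy : y ∈ L := hXL hx
    have : L.mkQ y = 0 := by simpa using hy
    simp [this]
  -- `K` is a retract of `E₀`
  let r : E₀ →ₗ[A] K := LinearMap.codRestrict K (g ∘ₗ L.mkQ) (fun x => hrange ⟨x, rfl⟩)
  have hr : ∀ x : K, r x = x := fun x => Subtype.ext (hgK x x.2)
  refine ⟨ModuleCat.of A K, LinearMap.codRestrict K f.hom (fun m => hNK ⟨m, rfl⟩), ⟨?_⟩, ?_, ?_⟩
  · intro X Y _ _ _ _ j hj k
    obtain ⟨h, hh⟩ := hEinj.out j hj (K.subtype ∘ₗ k)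
    exact ⟨r ∘ₗ h, fun x => by rw [LinearMap.comp_apply, hh]; exact hr (k x)⟩
  · intro x y hxy
    exact hfi (congrArg Subtype.val hxy)
  · intro X hX
    have h1 : X.map K.subtype = ⊥ := hKess _ (Submodule.map_subtype_le K X) (by
      rw [eq_bot_iff]
      rintro _ ⟨⟨x, hx, rfl⟩, ⟨m, hm⟩⟩
      have : x ∈ X ⊓ LinearMap.range (LinearMap.codRestrict K f.hom (fun m => hNK ⟨m, rfl⟩)) :=
        ⟨hx, m, Subtype.ext hm⟩
      rw [hX] at this
      have hx0 : x = 0 := by simpa using this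
      simp [hx0])
    exact Submodule.map_injective_of_injective K.injective_subtype (h1.trans (Submodule.map_bot _).symm)

end Covers

section Duality

/-- The injective envelope `J` of `R / rad R` over a commutative ring `R`. -/
def dualizingModule (R : Type u) [CommRing R] : ModuleCat.{u} R :=
  (exists_injectiveEnvelope R (R ⧸ Ring.jacobson R)).choose

/-- The dual `D N = Hom_R(N, J)`. -/
def Dual (R : Type u) [CommRing R] (N : Type u) [AddCommGroup N] [Module R N] : Type u :=
  N →ₗ[R] dualizingModule R

variable (R A : Type u) [CommRing R] [Ring A]

instance (N : Type u) [AddCommGroup N] [Module R N] : AddCommGroup (Dual R N) :=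
  inferInstanceAs (AddCommGroup (N →ₗ[R] dualizingModule R))

/-- For a right `A`-module `N` (a module over `Aᵐᵒᵖ`), the dual `D N` is a left `A`-module
through `(a f)(x) = f(x a)`. -/
instance (N : Type u) [AddCommGroup N] [Module R N] [Module Aᵐᵒᵖ N] [SMulCommClass Aᵐᵒᵖ R N] :
    Module A (Dual R N) where
  smul a f := LinearMap.comp (show N →ₗ[R] dualizingModule R from f)
    (DistribSMul.toLinearMap R N (MulOpposite.op a))
  one_smul f := LinearMap.ext fun x =>
    congrArg (show N →ₗ[R] dualizingModule R from f) (one_smul Aᵐᵒᵖ x)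
  mul_smul a b f := LinearMap.ext fun x =>
    congrArg (show N →ₗ[R] dualizingModule R from f)
      (mul_smul (MulOpposite.op b) (MulOpposite.op a) x)
  smul_zero _ := LinearMap.ext fun _ => rfl
  smul_add _ _ _ := LinearMap.ext fun _ => rfl
  add_smul a b f := LinearMap.ext fun x =>
    (congrArg (show N →ₗ[R] dualizingModule R from f)
      (add_smul (MulOpposite.op a) (MulOpposite.op b) x)).trans (map_add _ _ _)
  zero_smul f := LinearMap.ext fun x =>
    (congrArg (show N →ₗ[R] dualizingModule R from f) (zero_smul Aᵐᵒᵖ x)).trans (map_zero _)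

variable {A}

/-- The map of right `A`-modules `Hom_A(P₀, A) → Hom_A(P₁, A)`, `g ↦ g ∘ f`. -/
def precomp {P₁ P₀ : Type u} [AddCommGroup P₁] [Module A P₁] [AddCommGroup P₀] [Module A P₀]
    (f : P₁ →ₗ[A] P₀) : (P₀ →ₗ[A] A) →ₗ[Aᵐᵒᵖ] (P₁ →ₗ[A] A) where
  toFun g := g ∘ₗ f
  map_add' _ _ := rfl
  map_smul' _ _ := rfl

/-- The right module `Coker (Hom_A(P₀, A) → Hom_A(P₁, A))`; it is the transpose `Tr M` when
`P₁ → P₀ → M → 0` is a minimal projective presentation. -/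
abbrev Transpose {P₁ P₀ : Type u} [AddCommGroup P₁] [Module A P₁] [AddCommGroup P₀] [Module A P₀]
    (f : P₁ →ₗ[A] P₀) : Type u :=
  (P₁ →ₗ[A] A) ⧸ LinearMap.range (precomp f)

variable (A) [Algebra R A]

/-- `N` is isomorphic to the Auslander–Reiten translate `τ M = D Tr M`, computed from a minimal
projective presentation `P₁ → P₀ → M → 0`. -/
def IsARTranslate (M N : Type u) [AddCommGroup M] [Module A M] [AddCommGroup N] [Module A N] :
    Prop :=
  ∃ (P₀ P₁ : ModuleCat.{u} A) (p₀ : P₀ →ₗ[A] M) (p₁ : P₁ →ₗ[A] LinearMap.ker p₀),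
    IsProjectiveCover p₀ ∧ IsProjectiveCover p₁ ∧
      Nonempty (N ≃ₗ[A] Dual R (Transpose ((LinearMap.ker p₀).subtype ∘ₗ p₁)))

/-- `N ≅ τ̃ M` for simple modules `M`, `N`: the Auslander–Reiten translate of `M` if `M` is not
projective, and the simple injective module otherwise. -/
def IsTauTilde (M N : Type u) [AddCommGroup M] [Module A M] [AddCommGroup N] [Module A N] :
    Prop :=
  (¬ Module.Projective A M ∧ IsARTranslate R A M N) ∨
    (Module.Projective A M ∧ IsSimpleModule A N ∧ Module.Injective A N)

end Duality

section Simples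

variable (A : Type u) [Ring A]

/-- The simple left `A`-modules. -/
abbrev SimpleMod : Type (u + 1) := {M : ModuleCat.{u} A // IsSimpleModule A M}

/-- Isomorphism of simple modules. -/
def simpleSetoid : Setoid (SimpleMod A) where
  r S T := Nonempty (S.1 ≅ T.1)
  iseqv := ⟨fun _ => ⟨Iso.refl _⟩, fun ⟨e⟩ => ⟨e.symm⟩, fun ⟨e⟩ ⟨e'⟩ => ⟨e ≪≫ e'⟩⟩

/-- The isomorphism classes of simple `A`-modules. -/
def SimpleClass : Type (u + 1) := Quotient (simpleSetoid A)

variable {A}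

/-- The isomorphism class of a simple module. -/
def SimpleClass.mk (S : SimpleMod A) : SimpleClass A := Quotient.mk (simpleSetoid A) S

/-- The projective dimension of a simple module, as a function of its isomorphism class. -/
def SimpleClass.projDim (s : SimpleClass A) : WithBot ℕ∞ :=
  Quotient.lift (s := simpleSetoid A) (fun S : SimpleMod A => projectiveDimension S.1)
    (fun _ _ ⟨e⟩ => projectiveDimension_eq_of_iso e) s

/-- The injective dimension of a simple module, as a function of its isomorphism class. -/
def SimpleClass.injDim (s : SimpleClass A) : WithBot ℕ∞ :=
  Quotient.lift (s := simpleSetoid A) (fun S : SimpleMod A => injectiveDimension S.1)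
    (fun _ _ ⟨e⟩ => injectiveDimension_eq_of_iso e) s

variable (R : Type u) [CommRing R] [Algebra R A]

/-- `T ≅ τ̃ (soc P(S))`. -/
def IsGamma (s t : SimpleClass A) : Prop :=
  ∃ S T : SimpleMod A, SimpleClass.mk S = s ∧ SimpleClass.mk T = t ∧
    ∃ (P : ModuleCat.{u} A) (p : P →ₗ[A] S.1), IsProjectiveCover p ∧
      IsTauTilde R A (socle A P) T.1

/-- `T ≅ τ̃⁻¹ (top I(S))`, that is, `τ̃ T ≅ top I(S)`. -/
def IsPsi (s t : SimpleClass A) : Prop :=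
  ∃ S T : SimpleMod A, SimpleClass.mk S = s ∧ SimpleClass.mk T = t ∧
    ∃ (I : ModuleCat.{u} A) (i : S.1 →ₗ[A] I), IsInjectiveEnvelope i ∧
      IsTauTilde R A T.1 (top A I)

/-- The map `γ(S) = τ̃ (soc P(S))` on isomorphism classes of simple modules. -/
def gamma (s : SimpleClass A) : SimpleClass A :=
  @Classical.epsilon _ ⟨s⟩ (IsGamma R s)

/-- The map `ψ(S) = τ̃⁻¹ (top I(S))` on isomorphism classes of simple modules. -/
def psi (s : SimpleClass A) : SimpleClass A :=
  @Classical.epsilon _ ⟨s⟩ (IsPsi R s)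

/-- `S` is `γ`-cyclic: `γ^m(S) = S` for some `m > 0`. -/
def IsGammaCyclic (s : SimpleClass A) : Prop := ∃ m : ℕ, 0 < m ∧ (gamma R)^[m] s = s

/-- `S` is `ψ`-cyclic: `ψ^m(S) = S` for some `m > 0`. -/
def IsPsiCyclic (s : SimpleClass A) : Prop := ∃ m : ℕ, 0 < m ∧ (psi R)^[m] s = s

/-- `S` is `γ`-black: its projective dimension is not `1`. -/
def IsGammaBlack (s : SimpleClass A) : Prop := s.projDim ≠ 1

/-- `S` is `ψ`-black: its injective dimension is not `1`. -/
def IsPsiBlack (s : SimpleClass A) : Prop := s.injDim ≠ 1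

end Simples

/-- The resolution quiver: the vertices are the isomorphism classes of simple modules, and there
is a unique arrow from each `S` to `γ(S)`. -/
def resolutionQuiver (R A : Type u) [CommRing R] [Ring A] [Algebra R A] : Digraph (SimpleClass A) where
  Adj s t := gamma R s = t

/-- A cycle of length `m > 0` in a quiver without multiple arrows: pairwise distinct vertices
`c 0, …, c (m - 1)` with arrows `c i ⟶ c (i + 1)`, indices taken modulo `m`. -/
def IsCycle {V : Type*} (Q : Digraph V) (m : ℕ) (c : ZMod m → V) : Prop :=
  0 < m ∧ Function.Injective c ∧ ∀ i, Q.Adj (c i) (c (i + 1))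

section Algebras

variable (A : Type u) [Ring A]

/-- The global dimension of `A`. -/
def globalDimension : WithBot ℕ∞ := ⨆ M : ModuleCat.{u} A, projectiveDimension M

/-- `A` is connected: nonzero and without central idempotents other than `0` and `1`. -/
def IsConnected : Prop :=
  Nontrivial A ∧ ∀ e ∈ Set.center A, IsIdempotentElem e → e = 0 ∨ e = 1

/-- `M` is uniserial: its submodules are totally ordered by inclusion. -/
def IsUniserial (M : Type u) [AddCommGroup M] [Module A M] : Prop :=
  ∀ N₁ N₂ : Submodule A M, N₁ ≤ N₂ ∨ N₂ ≤ N₁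

/-- `M` is indecomposable: nonzero and not a direct sum of two nonzero submodules. -/
def IsIndecomposable (M : Type u) [AddCommGroup M] [Module A M] : Prop :=
  Nontrivial M ∧ ∀ N₁ N₂ : Submodule A M, IsCompl N₁ N₂ → N₁ = ⊥ ∨ N₂ = ⊥

/-- The Nakayama condition for an Artin algebra `A`: the finitely generated indecomposable
projective modules and the finitely generated indecomposable injective modules are uniserial. -/
def IsNakayama : Prop :=
  ∀ M : ModuleCat.{u} A, Module.Finite A M → IsIndecomposable A M →
    (Module.Projective A M ∨ Module.Injective A M) → IsUniserial A M

end Algebras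

/-- An Artin algebra `A` is Gorenstein if `id A` and `pd D A` are finite. -/
def IsGorenstein (R A : Type u) [CommRing R] [Ring A] [Algebra R A] : Prop :=
  injectiveDimension (ModuleCat.of A A) ≠ ⊤ ∧
    projectiveDimension (ModuleCat.of A (Dual R A)) ≠ ⊤

end Nakayama

end

/-! Over a connected Nakayama algebra of infinite global dimension no simple module is projective,
and `τ` permutes the simple modules in one cycle. Unroll this cycle along the integers (`label`),
with period n. A uniserial module becomes an interval [a, b) with composition factors a, …, b - 1,
read from the top. Let [i, f i) be the projective with top i and [k b, b) the injective with socle b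
- 1. For i < b, both `k b ≤ i` and `b ≤ f i` say that [i, b) is a module, so k is left adjoint to f
(`kupischPair`), and f has the right adjoint g j = k (j + 1) - 1. On labels, `γ` is f and `ψ` is g
(`gamma_label`, `psi_label`). The syzygies of [a, b) are [b, f a), [f a, f b), …, so finite
projective dimension means that a sequence of iterates terminates (`IsInterval.finitePd_iff`), and
dually for k. A simple i is `γ`-black when f i ≠ f (i + 1) and `ψ`-black when k i ≠ k (i + 1). The
theorem thus reduces to `KupischPair.tfae`, a statement about periodic monotone maps.

Modulo n some iterate of f is idempotent, and all its recurrent points have the same translation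
number. Up to a translation, f^N is therefore a monotone retraction ρ onto the cyclic elements, on
which f is bijective; [a, b) terminates iff ρ b is ρ a or f (ρ a). If all cyclic elements are black,
then x ≤ ρ x (`le_retraction`), and the injectives terminate. Conversely, infinite global dimension
puts a cyclic element strictly between c and f c for every cyclic c (`exists_cyclic_between`);
termination of the injectives then makes the largest element of each fibre of ρ cyclic, which is
blackness (`black_of_terminates`). Blackness is equivalent to equality of the cyclic sets through
the adjunction of f and g. The reflection i ↦ -i - 1 exchanges the roles of f and g, which handles
`ψ` and the injective dimension of the projectives.

On the algebra side, `nonempty_dual_transpose_equiv` identifies `D Tr` of a simple module with the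
top of its first syzygy, and `eq_univ_of_next_closed` turns connectedness into the single cycle. -/

namespace Nakayama

/-! ### Periodic monotone maps of the integers and their translation numbers. -/

/-- `i` is cyclic modulo `n` under `f`. -/
def IsCyclicMod (n : ℕ) (f : ℤ → ℤ) (i : ℤ) : Prop := ∃ m : ℕ, 0 < m ∧ ∃ t : ℤ, f^[m] i = i + t * n

/-- The syzygy sequence of the interval `[a, b)` with respect to `f` terminates. -/
def SyzygyTerminates (f : ℤ → ℤ) (a b : ℤ) : Prop :=
  ∃ m : ℕ, f^[m] a = f^[m] b ∨ f^[m] b = f^[m + 1] a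

/-- Monotone `n`-periodic maps of `ℤ` with `i + 1 < f i`, with lower adjoint `k`. -/
structure KupischPair (n : ℕ) (f k : ℤ → ℤ) : Prop where
  pos : 0 < n
  gc : ∀ b i, k b ≤ i ↔ b ≤ f i
  map_add : ∀ i, f (i + n) = f i + n
  lt_map : ∀ i, i + 1 < f i

theorem map_add_mul_of_periodic {n : ℕ} {f : ℤ → ℤ} (h : ∀ i, f (i + n) = f i + n) (i t : ℤ) :
    f (i + t * n) = f i + t * n := by
  induction t using Int.induction_on with
  | zero => simp
  | succ t ih =>
    rw [show i + ((t : ℤ) + 1) * n = (i + t * n) + n by ring, h, ih]; ring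
  | pred t ih =>
    have := h (i + (-(t : ℤ) - 1) * n)
    rw [show i + (-(t : ℤ) - 1) * n + n = i + (-(t : ℤ)) * n by ring, ih] at this
    linarith

theorem iterate_add_mul_of_periodic {n : ℕ} {f : ℤ → ℤ} (h : ∀ i, f (i + n) = f i + n)
    (m : ℕ) (i t : ℤ) : f^[m] (i + t * n) = f^[m] i + t * n := by
  induction m generalizing i with
  | zero => simp
  | succ m ih => rw [Function.iterate_succ_apply, map_add_mul_of_periodic h, ih,
      Function.iterate_succ_apply]

theorem iterate_mul_of_shift {n : ℕ} {f : ℤ → ℤ} (h : ∀ i, f (i + n) = f i + n) {i t : ℤ}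
    (hi : f i = i + t * n) (m : ℕ) : f^[m] i = i + m * t * n := by
  induction m with
  | zero => simp
  | succ m ih =>
    rw [Function.iterate_succ_apply', ih, map_add_mul_of_periodic h, hi]; push_cast; ring

/-- The translation number of a monotone periodic map is unique. -/
theorem shift_unique {n : ℕ} (hn : 0 < n) {f : ℤ → ℤ} (hf : Monotone f)
    (h : ∀ i, f (i + n) = f i + n) {x y p q : ℤ} (hx : f x = x + p * n) (hy : f y = y + q * n) :
    p = q := by
  have key : ∀ {x y p q : ℤ}, f x = x + p * n → f y = y + q * n → p ≤ q := by
    intro x y p q hx hy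
    by_contra! hlt
    -- As n ≥ 1, the points are at most K periods apart. After 2K + 1 iterations an excess p - q ≥ 1
    -- of speed outweighs that gap on both sides.
    set K := (|x - y|).toNat with hK
    have hKx : x - y ≤ K := by rw [hK]; have := le_abs_self (x - y); have := abs_nonneg (x-y); omega
    have hKy : y - x ≤ K := by
      rw [hK]; have := neg_le_abs (x - y); have := abs_nonneg (x-y); omega
    have hn' : (1 : ℤ) ≤ n := by exact_mod_cast hn
    have h1 : x ≤ y + (K : ℤ) * n := by nlinarith
    have h2 := hf.iterate (2 * K + 1) h1
    rw [iterate_add_mul_of_periodic h, iterate_mul_of_shift h hx, iterate_mul_of_shift h hy] at h2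
    push_cast at h2
    have h3 : (2 * (K : ℤ) + 1) * n ≤ (2 * K + 1) * (p - q) * n := by
      apply mul_le_mul_of_nonneg_right _ (by positivity)
      nlinarith
    nlinarith
  exact le_antisymm (key hx hy) (key hy hx)

/-- Some iterate of a self-map of a finite type is idempotent. -/
theorem exists_iterate_idempotent {α : Type*} [Finite α] (f : α → α) :
    ∃ N : ℕ, 0 < N ∧ ∀ x, f^[N] (f^[N] x) = f^[N] x := by
  obtain ⟨a, b, hab, h⟩ := Finite.exists_ne_map_eq_of_infinite (fun m : ℕ => f^[m])
  wlog hlt : a < b generalizing a b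
  · exact this b a hab.symm h.symm (by omega)
  obtain ⟨p, rfl⟩ := Nat.exists_eq_add_of_lt hlt
  replace h : f^[a] = f^[a + p + 1] := h
  have step : ∀ t s x, f^[a + t + s * (p + 1)] x = f^[a + t] x := by
    intro t s x
    induction s with
    | zero => simp
    | succ s ih =>
      rw [show a + t + (s + 1) * (p + 1) = (t + s * (p + 1)) + (a + p + 1) by ring,
        Function.iterate_add_apply, ← h, ← Function.iterate_add_apply,
        show t + s * (p + 1) + a = a + t + s * (p + 1) by ring, ih]
  -- A multiple of the eventual period p + 1 that is at least the preperiod a.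
  refine ⟨(a + 1) * (p + 1), by positivity, fun x => ?_⟩
  rw [← Function.iterate_add_apply]
  obtain ⟨t, ht⟩ := Nat.exists_eq_add_of_le (show a ≤ (a + 1) * (p + 1) by nlinarith)
  conv_rhs => rw [ht]
  rw [← step t (a + 1) x, ← ht]

namespace KupischPair

variable {n : ℕ} {f k : ℤ → ℤ} (h : KupischPair n f k)
include h

theorem monotone : Monotone f := fun i j hij => by
  rw [← h.gc]; exact ((h.gc _ _).2 le_rfl).trans hij

theorem le_map_adj (b : ℤ) : b ≤ f (k b) := (h.gc _ _).1 le_rfl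

theorem map_adj_sub_one_lt (b : ℤ) : f (k b - 1) < b := by
  by_contra! hb
  have := (h.gc _ _).2 hb
  omega

theorem adj_add (b : ℤ) : k (b + n) = k b + n := by
  apply le_antisymm
  · rw [h.gc, h.map_add]; linarith [h.le_map_adj b]
  · have : k b ≤ k (b + n) - n := by
      rw [h.gc]
      have h1 := h.le_map_adj (b + n)
      have h2 := h.map_add (k (b + n) - n)
      rw [sub_add_cancel] at h2
      linarith
    linarith

theorem adj_monotone : Monotone k := fun b c hbc => by
  rw [h.gc]; exact hbc.trans (h.le_map_adj c)

/-- The opposite pair. -/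
theorem reverse : KupischPair n (fun x => -k (-x)) (fun x => -f (-x)) where
  pos := h.pos
  gc b i := by
    have := h.gc (-i) (-b)
    constructor <;> intro H <;> [have := this.2 (by linarith); have := this.1 (by linarith)] <;>
      linarith
  map_add i := by
    have := h.adj_add (-(i + n))
    rw [show -(i + (n : ℤ)) + n = -i by ring] at this
    linarith
  lt_map i := by
    have h1 : k (-i) ≤ -i - 2 := by
      rw [h.gc]; linarith [h.lt_map (-i - 2)]
    linarith

/-- Over the integers a left adjoint of `f` also yields a right adjoint, by negating both sides of
the adjunction. This right adjoint is the map that represents `ψ`. -/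
theorem le_iff (i j : ℤ) : f i ≤ j ↔ i ≤ k (j + 1) - 1 := by
  have := h.gc (j + 1) i
  constructor
  · intro H
    by_contra! H'
    have := this.1 (by omega)
    omega
  · intro H
    by_contra! H'
    have := this.2 (by omega)
    omega

/-- The eventual retraction onto the cyclic elements. -/
theorem exists_retraction : ∃ (N : ℕ) (q : ℤ) (ρ : ℤ → ℤ), 0 < N ∧
    (∀ x, f^[N] x = ρ x + q * n) ∧ (∀ x, ρ (ρ x) = ρ x) ∧
    (∀ x, IsCyclicMod n f x ↔ ρ x = x) := by
  have : NeZero n := ⟨h.pos.ne'⟩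
  have hcong : ∀ x y : ℤ, (x : ZMod n) = y → (f x : ZMod n) = f y := by
    intro x y hxy
    obtain ⟨t, ht⟩ := (ZMod.intCast_eq_intCast_iff_dvd_sub x y n).1 hxy
    rw [show y = x + t * n by linarith, map_add_mul_of_periodic h.map_add]
    simp
  let F : ZMod n → ZMod n := fun z => (f (z.val : ℤ) : ZMod n)
  have hF : ∀ (m : ℕ) (x : ℤ), F^[m] (x : ZMod n) = (f^[m] x : ℤ) := by
    intro m
    induction m with
    | zero => intro x; rfl
    | succ m ih =>
      intro x
      rw [Function.iterate_succ_apply, Function.iterate_succ_apply, ← ih]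
      congr 1
      exact hcong _ _ (by simp)
  obtain ⟨N, hN, hidem⟩ := exists_iterate_idempotent F
  have hdiv : ∀ x y : ℤ, (x : ZMod n) = y → ∃ t : ℤ, y = x + t * n := by
    intro x y hxy
    obtain ⟨t, ht⟩ := (ZMod.intCast_eq_intCast_iff_dvd_sub x y n).1 hxy
    exact ⟨t, by linarith⟩
  have hper := fun i => iterate_add_mul_of_periodic h.map_add N i 1
  simp only [one_mul] at hper
  have hmon := h.monotone.iterate N
  have hex : ∀ x, ∃ t : ℤ, f^[N] (f^[N] x) = f^[N] x + t * n := fun x =>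
    hdiv _ _ (by have := hidem x; rw [hF, hF] at this; exact this.symm)
  -- Idempotency modulo n moves each point of the image of `f^[N]` by a multiple of n;
  -- `shift_unique` makes the multiple the same for all points.
  obtain ⟨q, hq⟩ := hex 0
  have hall : ∀ x, f^[N] (f^[N] x) = f^[N] x + q * n := by
    intro x
    obtain ⟨t, ht⟩ := hex x
    rw [ht, shift_unique h.pos hmon hper ht hq]
  refine ⟨N, q, fun x => f^[N] x - q * n, hN, fun x => by ring, fun x => ?_, fun x => ?_⟩
  · have := iterate_add_mul_of_periodic h.map_add N (f^[N] x) (-q)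
    rw [hall] at this
    simp only
    rw [show f^[N] x - q * n = f^[N] x + -q * n by ring, this]; ring
  · constructor
    · rintro ⟨m, hm, t, ht⟩
      have h1 : F^[N] (x : ZMod n) = x := by
        have h2 : F^[m] (x : ZMod n) = x := by rw [hF, ht]; simp
        have h3 : (F^[m])^[N] (x : ZMod n) = x := Function.iterate_fixed h2 N
        rw [← Function.iterate_mul, mul_comm, Function.iterate_mul] at h3
        obtain ⟨m, rfl⟩ := Nat.exists_eq_add_of_lt hm
        have h4 : ∀ m, (F^[N])^[m + 1] (x : ZMod n) = F^[N] x := by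
          intro m
          induction m with
          | zero => rfl
          | succ m ih => rw [Function.iterate_succ_apply', ih, hidem]
        rw [← h4 (0 + m), h3]
      rw [hF] at h1
      obtain ⟨s, hs⟩ := hdiv _ _ h1.symm
      change f^[N] x - q * n = x
      rw [hs, shift_unique h.pos hmon hper hs hq]; ring
    · intro hx
      replace hx : f^[N] x - q * n = x := hx
      exact ⟨N, hN, q, by linarith⟩

end KupischPair

/-! ### The retraction onto cyclic elements, termination and blackness. -/

/-- `ρ` is the eventual retraction onto the cyclic elements of `f`. -/
structure IsEventualRetraction (n : ℕ) (f ρ : ℤ → ℤ) (N : ℕ) (q : ℤ) : Prop where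
  pos : 0 < N
  iterate : ∀ x, f^[N] x = ρ x + q * n
  idem : ∀ x, ρ (ρ x) = ρ x
  cyclic_iff : ∀ x, IsCyclicMod n f x ↔ ρ x = x

namespace KupischPair

variable {n : ℕ} {f k ρ : ℤ → ℤ} {N : ℕ} {q : ℤ}

theorem isCyclicMod_map (h : KupischPair n f k) {i : ℤ} (hi : IsCyclicMod n f i) :
    IsCyclicMod n f (f i) := by
  obtain ⟨m, hm, t, ht⟩ := hi
  refine ⟨m, hm, t, ?_⟩
  rw [← Function.iterate_succ_apply, Function.iterate_succ_apply', ht,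
    map_add_mul_of_periodic h.map_add]

variable (h : KupischPair n f k) (r : IsEventualRetraction n f ρ N q)
include h r

theorem retraction_monotone : Monotone ρ := fun x y hxy => by
  have := h.monotone.iterate N hxy
  rw [r.iterate, r.iterate] at this
  linarith

theorem retraction_map (x : ℤ) : ρ (f x) = f (ρ x) := by
  have h1 := r.iterate (f x)
  rw [← Function.iterate_succ_apply, Function.iterate_succ_apply', r.iterate,
    map_add_mul_of_periodic h.map_add] at h1
  linarith

theorem retraction_add_mul (x t : ℤ) : ρ (x + t * n) = ρ x + t * n := by
  have := iterate_add_mul_of_periodic h.map_add N x t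
  rw [r.iterate, r.iterate] at this
  linarith

-- On fixed points of `ρ` the iterate `f^[N]` is a translation, so `f` cannot identify two of them.
omit h in
theorem retraction_injective {x y : ℤ} (hx : ρ x = x) (hy : ρ y = y) (hxy : f x = f y) :
    x = y := by
  have h1 : f^[N] x = f^[N] y := by
    obtain ⟨M, rfl⟩ := Nat.exists_eq_add_of_lt r.pos
    rw [Function.iterate_succ_apply, Function.iterate_succ_apply, hxy]
  rw [r.iterate, r.iterate, hx, hy] at h1
  linarith

/-- The preimage is f^(N-1) y translated back by q periods. With injectivity, `f` permutes the
cyclic elements and preserves their order. -/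
theorem retraction_surjective {y : ℤ} (hy : ρ y = y) : ∃ x, ρ x = x ∧ f x = y := by
  obtain ⟨M, hM⟩ := Nat.exists_eq_add_of_lt r.pos
  have h1 := r.iterate y
  rw [hM, Function.iterate_succ_apply', hy, zero_add] at h1
  have h2 : f (f^[M] y + -q * n) = y := by
    rw [map_add_mul_of_periodic h.map_add, h1]; ring
  refine ⟨_, ?_, h2⟩
  have hc : ∀ m, ρ (f^[m] y) = f^[m] y := by
    intro m
    induction m with
    | zero => exact hy
    | succ m ih => rw [Function.iterate_succ_apply', retraction_map h r, ih]
  rw [retraction_add_mul h r, hc]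

/-- Since `ρ` commutes with `f` and `f` is injective on cyclic elements, an equality of iterates
descends to the retractions; applying `f^[N]` gives the converse. -/
theorem syzygyTerminates_iff (a b : ℤ) :
    SyzygyTerminates f a b ↔ ρ a = ρ b ∨ ρ b = f (ρ a) := by
  have hinj : ∀ m x y, ρ x = x → ρ y = y → f^[m] x = f^[m] y → x = y := by
    intro m
    induction m with
    | zero => intro x y _ _ e; exact e
    | succ m ih =>
      intro x y hx hy e
      rw [Function.iterate_succ_apply, Function.iterate_succ_apply] at e
      exact retraction_injective r hx hy (ih _ _ (by rw [retraction_map h r, hx])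
        (by rw [retraction_map h r, hy]) e)
  have hcomm : ∀ m x, ρ (f^[m] x) = f^[m] (ρ x) := by
    intro m
    induction m with
    | zero => intro x; rfl
    | succ m ih => intro x; rw [Function.iterate_succ_apply, ih, retraction_map h r,
        Function.iterate_succ_apply]
  constructor
  · rintro ⟨m, e | e⟩
    · left
      exact hinj m _ _ (r.idem _) (r.idem _) (by rw [← hcomm, ← hcomm, e])
    · right
      refine hinj m _ _ (r.idem _) (by rw [retraction_map h r, r.idem]) ?_
      rw [← hcomm, e, Function.iterate_succ_apply, hcomm, retraction_map h r]
  · rintro (e | e)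
    · exact ⟨N, Or.inl (by rw [r.iterate, r.iterate, e])⟩
    · refine ⟨N, Or.inr ?_⟩
      rw [Function.iterate_succ_apply', r.iterate, r.iterate, map_add_mul_of_periodic h.map_add, e]

/-- If some simple interval has non-terminating syzygies, then no cyclic `c` is followed
immediately by `f c`. -/
theorem exists_cyclic_between (hinf : ∃ i, ¬ SyzygyTerminates f i (i + 1)) {c : ℤ}
    (hc : ρ c = c) : ∃ d, ρ d = d ∧ c < d ∧ d < f c := by
  obtain ⟨i, hi⟩ := hinf
  rw [syzygyTerminates_iff h r, not_or] at hi
  have hmon := retraction_monotone h r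
  have hle1 : ρ i ≤ ρ (i + 1) := hmon (by omega)
  have hle2 : ρ (i + 1) ≤ f (ρ i) := by
    rw [← retraction_map h r]; exact hmon (by linarith [h.lt_map i])
  -- If the gap between c and f c has no cyclic element, neither has any gap between successive
  -- iterates, as `f` is an order-preserving permutation of the cyclic elements. The orbit of c then
  -- contains every cyclic element above c, which a translate of the pair ρ i < ρ (i + 1) < f (ρ i)
  -- contradicts.
  by_contra! hcon
  have hpos : (1 : ℤ) ≤ n := by exact_mod_cast h.pos
  have hiter : ∀ t : ℕ, ρ (f^[t] c) = f^[t] c ∧ c + t ≤ f^[t] c ∧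
      ∀ d, ρ d = d → f^[t] c < d → f^[t + 1] c ≤ d := by
    intro t
    induction t with
    | zero => exact ⟨hc, by simp, hcon⟩
    | succ t ih =>
      obtain ⟨ih1, ih2, ih3⟩ := ih
      refine ⟨by rw [Function.iterate_succ_apply', retraction_map h r, ih1], ?_, ?_⟩
      · rw [Function.iterate_succ_apply']
        have := h.lt_map (f^[t] c)
        push_cast; linarith
      · intro d hd hlt
        obtain ⟨e, he, rfl⟩ := retraction_surjective h r hd
        rw [Function.iterate_succ_apply' f (t + 1)]
        apply h.monotone
        apply ih3 e he
        by_contra! hle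
        have := h.monotone hle
        rw [Function.iterate_succ_apply'] at hlt
        linarith
  -- translate the witness beyond `c`
  obtain ⟨x, hx, y, hy, hcx, hxy, hyx⟩ : ∃ x, ρ x = x ∧ ∃ y, ρ y = y ∧ c ≤ x ∧ x < y ∧ y < f x := by
    obtain ⟨K, hK⟩ : ∃ K : ℤ, c ≤ ρ i + K * n := ⟨|c - ρ i|, by
      have h1 := le_abs_self (c - ρ i)
      have h2 := abs_nonneg (c - ρ i)
      nlinarith⟩
    refine ⟨ρ i + K * n, by rw [retraction_add_mul h r, r.idem], ρ (i + 1) + K * n,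
      by rw [retraction_add_mul h r, r.idem], hK, ?_, ?_⟩
    · have := lt_of_le_of_ne hle1 hi.1
      linarith
    · rw [map_add_mul_of_periodic h.map_add]
      have := lt_of_le_of_ne hle2 hi.2
      linarith
  have hex : ∃ t : ℕ, x < f^[t] c := ⟨(x - c).toNat + 1, by
    have := (hiter ((x - c).toNat + 1)).2.1
    push_cast at this
    omega⟩
  classical
  have hspec := Nat.find_spec hex
  obtain ⟨t, ht⟩ : ∃ t, Nat.find hex = t + 1 := by
    refine Nat.exists_eq_succ_of_ne_zero fun h0 => ?_
    rw [h0] at hspec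
    simp only [Function.iterate_zero, id] at hspec
    linarith
  have hmin : f^[t] c ≤ x := by
    have := Nat.find_min hex (m := t) (by omega)
    exact not_lt.1 this
  rw [ht] at hspec
  have hxt : f^[t] c = x := by
    by_contra hne
    have := (hiter t).2.2 x hx (lt_of_le_of_ne hmin hne)
    linarith
  have := (hiter t).2.2 y hy (by rw [hxt]; exact hxy)
  rw [Function.iterate_succ_apply', hxt] at this
  linarith

/-- If all cyclic elements are black, then all elements lie below their retraction. -/
theorem le_retraction (hb : ∀ c, ρ c = c → f c ≠ f (c + 1)) (x : ℤ) : x ≤ ρ x := by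
  -- With c = ρ x < x, blackness along the orbit of c keeps the images of c and c + 1 apart, so ρ (c
  -- + 1) > c; but c + 1 ≤ x gives ρ (c + 1) ≤ ρ x = c.
  by_contra! hlt
  have hc := r.idem x
  set c := ρ x with hcdef
  have hstep : ∀ m, ρ (f^[m] c) = f^[m] c ∧ f^[m] c + 1 ≤ f^[m] (c + 1) := by
    intro m
    induction m with
    | zero => exact ⟨hc, le_rfl⟩
    | succ m ih =>
      rw [Function.iterate_succ_apply', Function.iterate_succ_apply']
      refine ⟨by rw [retraction_map h r, ih.1], ?_⟩
      have h1 := h.monotone ih.2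
      have h2 := hb _ ih.1
      have h3 := h.monotone (show f^[m] c ≤ f^[m] c + 1 by omega)
      omega
  have h1 := (hstep N).2
  rw [r.iterate, r.iterate, hc] at h1
  have h2 := retraction_monotone h r (show c + 1 ≤ x by omega)
  omega

/-- If ρ b < f (ρ (k b)), the cyclic preimage e of ρ b lies below k b, so f e ≤ f (k b - 1) < b.
Since b ≤ ρ b = f e, this is impossible. -/
theorem terminates_of_black (hb : ∀ c, ρ c = c → f c ≠ f (c + 1)) (b : ℤ) :
    SyzygyTerminates f (k b) b := by
  rw [syzygyTerminates_iff h r]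
  right
  have hle : ρ b ≤ f (ρ (k b)) := by
    rw [← retraction_map h r]; exact retraction_monotone h r (h.le_map_adj b)
  by_contra hne
  obtain ⟨e, he, hfe⟩ := retraction_surjective h r (r.idem b)
  have h1 : e < ρ (k b) := by
    by_contra! hge
    have := h.monotone hge
    exact hne (le_antisymm hle (by rw [← hfe]; exact this))
  have h2 : e ≤ k b - 1 := by
    by_contra! hge
    have := retraction_monotone h r (show k b ≤ e by omega)
    rw [he] at this
    omega
  have h3 := h.monotone h2
  have h4 := h.map_adj_sub_one_lt b
  have h5 := le_retraction h r hb b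
  omega

/-- Call u a jump if ρ u < ρ (u + 1). Jumps have preimages under `f` that are again jumps, so every
jump is an N-th iterate and hence cyclic. A cyclic c that is not black would be followed by a jump
in its own fibre. -/
theorem black_of_terminates (hinf : ∃ i, ¬ SyzygyTerminates f i (i + 1))
    (ht : ∀ b, SyzygyTerminates f (k b) b) {c : ℤ} (hc : ρ c = c) : f c ≠ f (c + 1) := by
  have hmon := retraction_monotone h r
  -- The other alternative ρ (k b) = ρ b is excluded by a cyclic d between ρ (k b - 1) and its
  -- image: d < k b and d ≥ k b both contradict monotonicity of `ρ`.
  have htwo : ∀ b, ρ b = ρ (f (k b)) := by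
    intro b
    have h1 := ht b
    rw [syzygyTerminates_iff h r] at h1
    rw [retraction_map h r]
    refine h1.resolve_left fun h2 => ?_
    have h3 : f (ρ (k b - 1)) ≤ ρ b := by
      rw [← retraction_map h r]; exact hmon (h.map_adj_sub_one_lt b).le
    obtain ⟨d, hd, hd1, hd2⟩ := exists_cyclic_between h r hinf (r.idem (k b - 1))
    rcases lt_or_ge d (k b) with hlt | hge
    · have := hmon (show d ≤ k b - 1 by omega)
      rw [hd] at this
      omega
    · have := hmon hge
      rw [hd] at this
      omega
  -- every element is below a largest element of its fibre
  have hmax : ∀ x, ∃ u, x ≤ u ∧ ρ u = ρ x ∧ ρ u < ρ (u + 1) := by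
    intro x
    have hbd : ∀ z, ρ z = ρ x → z ≤ x + n := by
      intro z hz
      by_contra! hlt
      have := hmon hlt.le
      have h1 := retraction_add_mul h r x 1
      have := h.pos
      rw [one_mul] at h1
      omega
    obtain ⟨u, hu, hu'⟩ := Int.exists_greatest_of_bdd (P := fun z => x ≤ z ∧ ρ z = ρ x)
      ⟨x + n, fun z hz => hbd z hz.2⟩ ⟨x, le_rfl, rfl⟩
    refine ⟨u, hu.1, hu.2, lt_of_le_of_ne (hmon (by omega)) fun e => ?_⟩
    have := hu' (u + 1) ⟨by omega, by rw [← e, hu.2]⟩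
    omega
  have hpre : ∀ u, ρ u < ρ (u + 1) → ∃ w, ρ w < ρ (w + 1) ∧ f w = u := by
    intro u hu
    obtain ⟨w, hw1, hw2, hw3⟩ := hmax (k u)
    -- Here w is the top of the fibre of k u; an overshoot f w > u would cross the jump at u,
    -- although ρ (f w) = ρ u.
    refine ⟨w, hw3, le_antisymm ?_ ((h.le_map_adj u).trans (h.monotone hw1))⟩
    by_contra! hlt
    have h1 := hmon (show u + 1 ≤ f w by omega)
    have h2 : ρ (f w) = ρ u := by
      rw [retraction_map h r, hw2, ← retraction_map h r, ← htwo]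
    omega
  have hpreN : ∀ m u, ρ u < ρ (u + 1) → ∃ w, f^[m] w = u := by
    intro m
    induction m with
    | zero => intro u _; exact ⟨u, rfl⟩
    | succ m ih =>
      intro u hu
      obtain ⟨v, hv, rfl⟩ := hpre u hu
      obtain ⟨w, rfl⟩ := ih v hv
      exact ⟨w, Function.iterate_succ_apply' _ _ _⟩
  intro heq
  have h1 : ρ (c + 1) = c := by
    apply retraction_injective r (r.idem _) hc
    rw [← retraction_map h r, ← heq, retraction_map h r, hc]
  obtain ⟨u, hu1, hu2, hu3⟩ := hmax (c + 1)
  obtain ⟨w, hw⟩ := hpreN N u hu3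
  have h2 : ρ u = u := by
    rw [← hw, r.iterate, retraction_add_mul h r, r.idem]
  omega

-- Blackness says that c is the largest element with image f c, which is what the right adjoint
-- selects.
omit r in
theorem adj_map_of_black (hb : ∀ c, ρ c = c → f c ≠ f (c + 1)) {c : ℤ} (hc : ρ c = c) :
    k (f c + 1) - 1 = c := by
  have h1 := (h.le_iff c (f c)).1 le_rfl
  have h2 : ¬ (c + 1 ≤ k (f c + 1) - 1) := by
    rw [← h.le_iff]
    have := h.monotone (show c ≤ c + 1 by omega)
    have := hb c hc
    omega
  omega

/-- The right adjoint g inverts `f` on `f`-cyclic elements, giving one direction. For a g-cyclic j,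
the counit f^M (g^M j) ≤ j and equality of translation numbers give ρ j ≤ j, while blackness gives j
≤ ρ j. -/
theorem cyclic_iff_of_black (hb : ∀ c, ρ c = c → f c ≠ f (c + 1)) (j : ℤ) :
    IsCyclicMod n f j ↔ IsCyclicMod n (fun j => k (j + 1) - 1) j := by
  set g : ℤ → ℤ := fun j => k (j + 1) - 1 with hg
  have hgper : ∀ i, g (i + n) = g i + n := fun i => by
    simp only [hg]
    rw [show i + (n : ℤ) + 1 = (i + 1) + n by ring, h.adj_add]; ring
  have hgmon : Monotone g := fun x y hxy => by
    have := h.adj_monotone (show x + 1 ≤ y + 1 by omega)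
    simp only [hg]; omega
  have hgf : ∀ m c, ρ c = c → g^[m] (f^[m] c) = c := by
    intro m
    induction m with
    | zero => intro c _; rfl
    | succ m ih =>
      intro c hc
      rw [Function.iterate_succ_apply', Function.iterate_succ_apply, ih (f c)
        (by rw [retraction_map h r, hc])]
      exact adj_map_of_black h hb hc
  constructor
  · intro hj
    have hρ := (r.cyclic_iff j).1 hj
    obtain ⟨m, hm, t, ht⟩ := hj
    refine ⟨m, hm, -t, ?_⟩
    have := hgf m j hρ
    rw [ht, iterate_add_mul_of_periodic hgper] at this
    linarith
  · rintro ⟨m, hm, t, ht⟩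
    rw [r.cyclic_iff]
    have hfg : ∀ m x, f^[m] (g^[m] x) ≤ x := by
      intro m
      induction m with
      | zero => intro x; exact le_rfl
      | succ m ih =>
        intro x
        rw [Function.iterate_succ_apply', Function.iterate_succ_apply (f := g)]
        rw [h.le_iff]
        exact ih _
    have hfN : ∀ s x, f^[s * N] (ρ x) = ρ x + s * q * n := by
      intro s x
      rw [mul_comm, Function.iterate_mul]
      refine iterate_mul_of_shift (fun i => ?_) ?_ s
      · simpa using iterate_add_mul_of_periodic h.map_add N i 1
      · rw [r.iterate, r.idem]
    have e1 : g^[m * N] j = j + N * t * n := by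
      rw [Function.iterate_mul]
      refine iterate_mul_of_shift (fun i => ?_) ht N
      simpa using iterate_add_mul_of_periodic hgper m i 1
    have e2 : g^[m * N] (ρ j) = ρ j + -(m * q) * n := by
      have := hgf (m * N) (ρ j) (r.idem j)
      rw [hfN, iterate_add_mul_of_periodic hgper] at this
      linarith
    -- Both j and ρ j are translated by the same iterate of g, so N t = -(m q).
    have e3 := shift_unique h.pos (hgmon.iterate (m * N))
      (fun i => by simpa using iterate_add_mul_of_periodic hgper (m * N) i 1) e1 e2
    have e4 := hfg (m * N) j
    rw [e1, iterate_add_mul_of_periodic h.map_add] at e4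
    have e5 : ρ (f^[m * N] j) = f^[m * N] (ρ j) := by
      generalize m * N = l
      induction l with
      | zero => rfl
      | succ l ih => rw [Function.iterate_succ_apply', Function.iterate_succ_apply',
          retraction_map h r, ih]
    have e6 := retraction_monotone h r e4
    rw [retraction_add_mul h r, e5, hfN, e3] at e6
    have e7 := le_retraction h r hb j
    -- `f^[m * N] j` is already cyclic
    have e8 : f^[m * N] j = ρ j + m * q * n := by
      obtain ⟨m', rfl⟩ := Nat.exists_eq_add_of_lt hm
      rw [show (0 + m' + 1) * N = m' * N + N by ring, Function.iterate_add_apply, r.iterate,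
        iterate_add_mul_of_periodic h.map_add, hfN]
      push_cast; ring
    rw [e8, e3] at e4
    linarith

/-- With g the right adjoint, g (f c) is cyclic and has the same image as c, by f g f = f;
injectivity on cyclic elements gives g (f c) = c, so c is the largest element with that image. -/
theorem black_of_cyclic_iff
    (hcyc : ∀ j, IsCyclicMod n f j ↔ IsCyclicMod n (fun j => k (j + 1) - 1) j)
    {c : ℤ} (hc : ρ c = c) : f c ≠ f (c + 1) := by
  have h1 := h.isCyclicMod_map ((r.cyclic_iff c).2 hc)
  obtain ⟨m, hm, t, ht⟩ := (hcyc _).1 h1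
  set g : ℤ → ℤ := fun j => k (j + 1) - 1 with hg
  have hgper : ∀ i, g (i + n) = g i + n := fun i => by
    simp only [hg]
    rw [show i + (n : ℤ) + 1 = (i + 1) + n by ring, h.adj_add]; ring
  have h2 : IsCyclicMod n f (g (f c)) := by
    rw [hcyc]
    refine ⟨m, hm, t, ?_⟩
    rw [← Function.iterate_succ_apply, Function.iterate_succ_apply', ht,
      map_add_mul_of_periodic hgper]
  have h3 : f (g (f c)) = f c := by
    apply le_antisymm
    · rw [h.le_iff]
    · exact h.monotone ((h.le_iff _ _).1 le_rfl)
  have h4 := retraction_injective r ((r.cyclic_iff _).1 h2) hc h3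
  intro heq
  have := (h.le_iff (c + 1) (f c)).1 heq.ge
  have : k (f c + 1) - 1 = c := h4
  omega

end KupischPair

/-! ### The combinatorial equivalence, by reflection of the integers. -/

/-- The cosyzygy sequence of the interval `[a, b)` with respect to `k` terminates. -/
def CosyzygyTerminates (k : ℤ → ℤ) (a b : ℤ) : Prop :=
  ∃ m : ℕ, k^[m] a = k^[m] b ∨ k^[m] a = k^[m + 1] b

theorem exists_isEventualRetraction {n : ℕ} {f k : ℤ → ℤ} (h : KupischPair n f k) :
    ∃ (ρ : ℤ → ℤ) (N : ℕ) (q : ℤ), IsEventualRetraction n f ρ N q := by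
  obtain ⟨N, q, ρ, h1, h2, h3, h4⟩ := h.exists_retraction
  exact ⟨ρ, N, q, h1, h2, h3, h4⟩

section Equivalences

open KupischPair

theorem isCyclicMod_neg {n : ℕ} {f g : ℤ → ℤ} (hfg : ∀ i, f (-i - 1) = -g i - 1) (i : ℤ) :
    IsCyclicMod n f (-i - 1) ↔ IsCyclicMod n g i := by
  have hiter : ∀ (m : ℕ) i, f^[m] (-i - 1) = -g^[m] i - 1 := by
    intro m
    induction m with
    | zero => intro i; rfl
    | succ m ih => intro i; rw [Function.iterate_succ_apply, hfg, ih, Function.iterate_succ_apply]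
  constructor
  · rintro ⟨m, hm, t, ht⟩
    exact ⟨m, hm, -t, by rw [hiter] at ht; linarith⟩
  · rintro ⟨m, hm, t, ht⟩
    exact ⟨m, hm, -t, by rw [hiter, ht]; ring⟩

/-- The combinatorial equivalence: termination of the (co)syzygies of injectives and projectives,
blackness of the cyclic elements on either side, and coincidence of the two cyclic sets. -/
theorem KupischPair.tfae {n : ℕ} {f k : ℤ → ℤ} (h : KupischPair n f k)
    (hinf : ∃ i, ¬ SyzygyTerminates f i (i + 1)) :
    List.TFAE [(∀ i, CosyzygyTerminates k i (f i)) ∧ ∀ b, SyzygyTerminates f (k b) b,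
      ∀ c, IsCyclicMod n f c → f c ≠ f (c + 1),
      ∀ c, IsCyclicMod n (fun j => k (j + 1) - 1) c → k c ≠ k (c + 1),
      ∀ j, IsCyclicMod n f j ↔ IsCyclicMod n (fun j => k (j + 1) - 1) j] := by
  obtain ⟨ρ, N, q, r⟩ := exists_isEventualRetraction h
  obtain ⟨ρ', N', q', r'⟩ := exists_isEventualRetraction h.reverse
  -- The reflection i ↦ -i - 1, rather than i ↦ -i, carries the first map of the reversed pair to
  -- the right adjoint of `f`, and the right adjoint of the reversed pair to `f`.
  have c1 : ∀ i, IsCyclicMod n (fun x => -k (-x)) (-i - 1) ↔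
      IsCyclicMod n (fun j => k (j + 1) - 1) i :=
    isCyclicMod_neg fun i => by
      rw [show -(-i - 1) = i + 1 by ring]; ring
  have c2 : ∀ i, IsCyclicMod n (fun j => (fun x => -f (-x)) (j + 1) - 1) (-i - 1) ↔
      IsCyclicMod n f i :=
    isCyclicMod_neg fun i => by
      simp only
      rw [show -(-i - 1 + 1) = i by ring]
  have b' : (∀ c, IsCyclicMod n (fun j => k (j + 1) - 1) c → k c ≠ k (c + 1)) ↔
      ∀ c, ρ' c = c → (fun x => -k (-x)) c ≠ (fun x => -k (-x)) (c + 1) := by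
    constructor
    · intro H c hc heq
      rw [← r'.cyclic_iff, show c = -(-c - 1) - 1 by ring, c1] at hc
      refine H _ hc ?_
      simp only [neg_inj] at heq
      rw [show -c - 1 = -(c + 1) by ring, ← heq]
      congr 1; ring
    · intro H c hc heq
      refine H (-c - 1) (by rw [← r'.cyclic_iff, c1]; exact hc) ?_
      simp only [neg_inj]
      rw [show -(-c - 1) = c + 1 by ring, show -(-c - 1 + 1) = c by ring, heq]
  have e24 : (∀ c, IsCyclicMod n f c → f c ≠ f (c + 1)) ↔
      ∀ j, IsCyclicMod n f j ↔ IsCyclicMod n (fun j => k (j + 1) - 1) j :=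
    ⟨fun H => cyclic_iff_of_black h r fun c hc => H c ((r.cyclic_iff c).2 hc),
      fun H c hc => black_of_cyclic_iff h r H ((r.cyclic_iff c).1 hc)⟩
  have e34 : (∀ c, IsCyclicMod n (fun j => k (j + 1) - 1) c → k c ≠ k (c + 1)) ↔
      ∀ j, IsCyclicMod n f j ↔ IsCyclicMod n (fun j => k (j + 1) - 1) j := by
    rw [b']
    constructor
    · intro H j
      have := cyclic_iff_of_black h.reverse r' H (-j - 1)
      rw [c1, c2] at this
      exact this.symm
    · intro H c hc
      refine black_of_cyclic_iff h.reverse r' (fun j => ?_) hc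
      have := H (-j - 1)
      rw [← c1, ← c2, show -(-j - 1) - 1 = j by ring] at this
      exact this.symm
  tfae_have 2 ↔ 4 := e24
  tfae_have 3 ↔ 4 := e34
  -- Only the injectives are used here; the projectives come back through the reversed pair in the
  -- converse.
  tfae_have 1 → 2 := fun H c hc =>
    black_of_terminates h r hinf H.2 ((r.cyclic_iff c).1 hc)
  tfae_have 2 → 1 := by
    intro H
    refine ⟨fun i => ?_, terminates_of_black h r fun c hc => H c ((r.cyclic_iff c).2 hc)⟩
    obtain ⟨m, hm⟩ := terminates_of_black h.reverse r' (b'.1 (e34.2 (e24.1 H))) (-i)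
    have hiter : ∀ (m : ℕ) x, (fun x => -k (-x))^[m] (-x) = -k^[m] x := by
      intro m
      induction m with
      | zero => intro x; rfl
      | succ m ih => intro x; rw [Function.iterate_succ_apply, neg_neg, ih,
          Function.iterate_succ_apply]
    refine ⟨m, ?_⟩
    simp only [neg_neg, hiter, neg_inj] at hm
    exact hm.imp Eq.symm id
  tfae_finish

end Equivalences

/-! ### Length, uniserial modules and their tops. -/

section Length

variable {A : Type u} [Ring A] {M N : Type u} [AddCommGroup M] [Module A M]
  [AddCommGroup N] [Module A N]

theorem length_submodule_add_quotient (K : Submodule A M) :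
    Module.length A M = Module.length A K + Module.length A (M ⧸ K) :=
  Module.length_eq_add_of_exact K.subtype K.mkQ K.injective_subtype K.mkQ_surjective
    (LinearMap.exact_subtype_mkQ K)

theorem length_ker_add {p : M →ₗ[A] N} (hp : Function.Surjective p) :
    Module.length A M = Module.length A (LinearMap.ker p) + Module.length A N :=
  Module.length_eq_add_of_exact (LinearMap.ker p).subtype p (LinearMap.ker p).injective_subtype hp
    (LinearMap.exact_subtype_ker_map p)

theorem eq_of_le_of_length_le [IsArtinian A M] [IsNoetherian A M] {K L : Submodule A M}
    (hKL : K ≤ L) (h : Module.length A L ≤ Module.length A K) : K = L := by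
  by_contra hne
  have hne' : Submodule.comap L.subtype K ≠ ⊤ := fun ht => by
    rw [Submodule.comap_subtype_eq_top] at ht
    exact hne (le_antisymm hKL ht)
  have := Submodule.length_lt hne'
  rw [(Submodule.comapSubtypeEquivOfLe hKL).length_eq] at this
  exact absurd h (not_le.2 this)

theorem bijective_of_surjective_of_length_le [IsArtinian A M] [IsNoetherian A M]
    {p : M →ₗ[A] N} (hp : Function.Surjective p) (h : Module.length A M ≤ Module.length A N) :
    Function.Bijective p := by
  refine ⟨?_, hp⟩
  rw [← LinearMap.ker_eq_bot]
  have h1 := length_ker_add hp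
  have h2 : Module.length A M ≠ ⊤ := Module.length_ne_top
  have h3 : Module.length A (LinearMap.ker p) = 0 := by
    rw [h1] at h h2
    by_contra h0
    have : Module.length A N ≠ ⊤ := fun h => h2 (by rw [h, add_top])
    have h4 : 0 + Module.length A N < Module.length A (LinearMap.ker p) + Module.length A N :=
      (ENat.add_lt_add_iff_right this).2 (pos_iff_ne_zero.2 h0)
    rw [zero_add] at h4
    exact absurd h (not_le.2 h4)
  rwa [Module.length_eq_zero_iff, Submodule.subsingleton_iff_eq_bot] at h3

end Length

section Uniserial

variable {A : Type u} [Ring A] {M N : Type u} [AddCommGroup M] [Module A M]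
  [AddCommGroup N] [Module A N]

theorem IsUniserial.of_injective (h : IsUniserial A N) (f : M →ₗ[A] N)
    (hf : Function.Injective f) : IsUniserial A M := fun K L =>
  (h (K.map f) (L.map f)).imp (fun H => (Submodule.map_le_map_iff_of_injective hf _ _).1 H)
    (fun H => (Submodule.map_le_map_iff_of_injective hf _ _).1 H)

theorem IsUniserial.of_surjective (h : IsUniserial A M) (f : M →ₗ[A] N)
    (hf : Function.Surjective f) : IsUniserial A N := fun K L =>
  (h (K.comap f) (L.comap f)).imp (fun H => (Submodule.comap_le_comap_iff_of_surjective hf).1 H)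
    (fun H => (Submodule.comap_le_comap_iff_of_surjective hf).1 H)

theorem IsUniserial.eq_of_length_eq [IsArtinian A M] [IsNoetherian A M] (h : IsUniserial A M)
    {K L : Submodule A M} (hKL : Module.length A K = Module.length A L) : K = L :=
  (h K L).elim (fun H => eq_of_le_of_length_le H hKL.ge)
    fun H => (eq_of_le_of_length_le H hKL.le).symm

theorem IsUniserial.le_of_isCoatom (h : IsUniserial A M) {K L : Submodule A M} (hL : IsCoatom L)
    (hK : K ≠ ⊤) : K ≤ L :=
  (h K L).elim id fun H => by
    rcases hL.le_iff.1 H with h1 | h1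
    · exact absurd h1 hK
    · exact h1.le

theorem IsUniserial.le_of_isAtom (h : IsUniserial A M) {K L : Submodule A M} (hL : IsAtom L)
    (hK : K ≠ ⊥) : L ≤ K :=
  (h L K).elim id fun H => by
    rcases hL.le_iff.1 H with h1 | h1
    · exact absurd h1 hK
    · exact h1.ge

end Uniserial

section Simple

variable {A : Type u} [Ring A]

/-- A representative of an isomorphism class of simple modules. -/
noncomputable def SimpleClass.rep (s : SimpleClass A) : ModuleCat.{u} A := (Quotient.out s).1

instance (s : SimpleClass A) : IsSimpleModule A s.rep := (Quotient.out s).2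

theorem SimpleClass.mk_eq_mk {S T : SimpleMod A} :
    SimpleClass.mk S = SimpleClass.mk T ↔ Nonempty (S.1 ≃ₗ[A] T.1) := by
  refine Quotient.eq.trans ⟨fun ⟨e⟩ => ⟨e.toLinearEquiv⟩, fun ⟨e⟩ => ⟨e.toModuleIso⟩⟩

theorem SimpleClass.mk_rep (s : SimpleClass A) : SimpleClass.mk ⟨s.rep, inferInstance⟩ = s :=
  Quotient.out_eq s

theorem SimpleClass.nonempty_equiv_rep (S : SimpleMod A) :
    Nonempty (S.1 ≃ₗ[A] (SimpleClass.mk S).rep) := by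
  rw [← SimpleClass.mk_eq_mk (T := ⟨(SimpleClass.mk S).rep, inferInstance⟩)]
  exact (SimpleClass.mk_rep _).symm

theorem SimpleClass.exists_equiv_rep (M : Type u) [AddCommGroup M] [Module A M]
    (h : IsSimpleModule A M) : ∃ s : SimpleClass A, Nonempty (M ≃ₗ[A] s.rep) :=
  ⟨_, SimpleClass.nonempty_equiv_rep ⟨ModuleCat.of A M, h⟩⟩

theorem SimpleClass.eq_of_equiv {s t : SimpleClass A} (e : s.rep ≃ₗ[A] t.rep) : s = t := by
  rw [← s.mk_rep, ← t.mk_rep, SimpleClass.mk_eq_mk]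
  exact ⟨e⟩

theorem SimpleClass.mk_eq_iff {S : SimpleMod A} {s : SimpleClass A} :
    SimpleClass.mk S = s ↔ Nonempty (S.1 ≃ₗ[A] s.rep) := by
  constructor
  · rintro rfl; exact SimpleClass.nonempty_equiv_rep S
  · rintro ⟨e⟩
    obtain ⟨e'⟩ := SimpleClass.nonempty_equiv_rep S
    exact SimpleClass.eq_of_equiv (e'.symm.trans e)

end Simple

section Chain

variable {A : Type u} [Ring A]

/-- `M` is uniserial of length `ℓ` with top of class `s` (unless `M = 0`). -/
structure IsChainModule (s : SimpleClass A) (ℓ : ℕ) (M : Type u) [AddCommGroup M] [Module A M] :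
    Prop where
  uniserial : IsUniserial A M
  length : Module.length A M = ℓ
  top : ℓ ≠ 0 → ∃ p : M →ₗ[A] s.rep, Function.Surjective p

variable {M N : Type u} [AddCommGroup M] [Module A M] [AddCommGroup N] [Module A N]
  {s t : SimpleClass A} {ℓ : ℕ}

namespace IsChainModule

theorem congr (h : IsChainModule s ℓ M) (e : M ≃ₗ[A] N) : IsChainModule s ℓ N where
  uniserial := h.uniserial.of_surjective e.toLinearMap e.surjective
  length := by rw [← e.length_eq, h.length]
  top h0 := by
    obtain ⟨p, hp⟩ := h.top h0
    exact ⟨p ∘ₗ e.symm.toLinearMap, hp.comp e.symm.surjective⟩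

theorem isFiniteLength (h : IsChainModule s ℓ M) : IsFiniteLength A M := by
  rw [← Module.length_ne_top_iff, h.length]; exact ENat.natCast_ne_top _

theorem isNoetherian (h : IsChainModule s ℓ M) : IsNoetherian A M :=
  (isFiniteLength_iff_isNoetherian_isArtinian.1 h.isFiniteLength).1

theorem isArtinian (h : IsChainModule s ℓ M) : IsArtinian A M :=
  (isFiniteLength_iff_isNoetherian_isArtinian.1 h.isFiniteLength).2

theorem nontrivial (h : IsChainModule s ℓ M) (h0 : ℓ ≠ 0) : Nontrivial M := by
  rw [← Module.length_pos_iff (R := A), h.length]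
  exact_mod_cast Nat.pos_of_ne_zero h0

theorem subsingleton_iff (h : IsChainModule s ℓ M) : Subsingleton M ↔ ℓ = 0 := by
  rw [← Module.length_eq_zero_iff (R := A), h.length]; exact_mod_cast Iff.rfl

theorem of_isSimpleModule (e : M ≃ₗ[A] s.rep) : IsChainModule s 1 M := by
  have hM : IsSimpleModule A M := IsSimpleModule.congr e
  refine ⟨fun K L => ?_, by rw [Nat.cast_one, Module.length_eq_one_iff]; exact hM,
    fun _ => ⟨e.toLinearMap, e.surjective⟩⟩
  rcases eq_bot_or_eq_top K with rfl | rfl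
  · exact Or.inl bot_le
  · exact Or.inr le_top

theorem zero [Subsingleton M] : IsChainModule s 0 M :=
  ⟨fun K L => Or.inl fun x hx => by rw [Subsingleton.elim x 0]; exact L.zero_mem,
    by rw [Nat.cast_zero, Module.length_eq_zero_iff]; infer_instance, fun h => absurd rfl h⟩

theorem exists_equiv_rep (h : IsChainModule s 1 M) : Nonempty (M ≃ₗ[A] s.rep) := by
  obtain ⟨p, hp⟩ := h.top one_ne_zero
  have := h.isNoetherian
  have := h.isArtinian
  refine ⟨LinearEquiv.ofBijective p (bijective_of_surjective_of_length_le hp ?_)⟩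
  rw [h.length, Module.length_eq_one A s.rep, Nat.cast_one]

/-- All surjections from a uniserial module to simple modules have the same kernel. -/
theorem top_unique (h : IsChainModule s ℓ M) {p : M →ₗ[A] t.rep} (hp : Function.Surjective p) :
    s = t := by
  have h0 : ℓ ≠ 0 := fun h0 => by
    have := h.subsingleton_iff.2 h0
    have := hp.subsingleton
    have : Nontrivial t.rep := IsSimpleModule.nontrivial A _
    exact not_subsingleton t.rep ‹_›
  obtain ⟨q, hq⟩ := h.top h0
  have hk : LinearMap.ker p = LinearMap.ker q := by
    have h1 := LinearMap.isCoatom_ker_of_surjective hp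
    have h2 := LinearMap.isCoatom_ker_of_surjective hq
    exact le_antisymm (h.uniserial.le_of_isCoatom h2 h1.1) (h.uniserial.le_of_isCoatom h1 h2.1)
  exact SimpleClass.eq_of_equiv ((LinearMap.quotKerEquivOfSurjective q hq).symm.trans
    ((Submodule.quotEquivOfEq _ _ hk.symm).trans (LinearMap.quotKerEquivOfSurjective p hp)))

theorem class_unique (h : IsChainModule s ℓ M) (h' : IsChainModule t ℓ M) (h0 : ℓ ≠ 0) : s = t := by
  obtain ⟨p, hp⟩ := h'.top h0
  exact h.top_unique hp

theorem of_surjective (h : IsChainModule s ℓ M) {f : M →ₗ[A] N} (hf : Function.Surjective f)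
    {m : ℕ} (hm : Module.length A N = m) : IsChainModule s m N := by
  refine ⟨h.uniserial.of_surjective f hf, hm, fun h0 => ?_⟩
  have hN : Nontrivial N := by
    rw [← Module.length_pos_iff (R := A), hm]; exact_mod_cast Nat.pos_of_ne_zero h0
  have hM : Nontrivial M := hf.nontrivial
  have hℓ : ℓ ≠ 0 := fun h1 => not_subsingleton M (h.subsingleton_iff.2 h1)
  obtain ⟨p, hp⟩ := h.top hℓ
  have hne : LinearMap.ker f ≠ ⊤ := fun ht => by
    obtain ⟨y, hy⟩ := exists_ne (0 : N)
    obtain ⟨x, rfl⟩ := hf y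
    exact hy (LinearMap.mem_ker.1 (ht ▸ Submodule.mem_top))
  have hle := h.uniserial.le_of_isCoatom (LinearMap.isCoatom_ker_of_surjective hp) hne
  refine ⟨((LinearMap.ker f).liftQ p hle) ∘ₗ (LinearMap.quotKerEquivOfSurjective f hf).symm.toLinearMap,
    ?_⟩
  intro y
  obtain ⟨x, rfl⟩ := hp y
  refine ⟨f x, ?_⟩
  have : (LinearMap.quotKerEquivOfSurjective f hf).symm (f x) = Submodule.Quotient.mk x := by
    rw [LinearEquiv.symm_apply_eq]; rfl
  simp only [LinearMap.comp_apply, LinearEquiv.coe_coe, this]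
  rfl

/-- A map whose composite with a surjection onto the simple top is onto is itself onto. -/
theorem surjective_of_comp (h : IsChainModule s ℓ M) {p : M →ₗ[A] t.rep} {g : N →ₗ[A] M}
    (hpg : Function.Surjective (p ∘ₗ g)) : Function.Surjective g := by
  rw [← LinearMap.range_eq_top]
  by_contra hne
  have hp : Function.Surjective p := Function.Surjective.of_comp (g := g) hpg
  have h1 := LinearMap.isCoatom_ker_of_surjective hp
  have hle := h.uniserial.le_of_isCoatom h1 hne
  have : Nontrivial t.rep := IsSimpleModule.nontrivial A _
  obtain ⟨y, hy⟩ := exists_ne (0 : t.rep)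
  obtain ⟨x, rfl⟩ := hpg y
  exact hy (LinearMap.mem_ker.1 (hle ⟨x, rfl⟩))

end IsChainModule

theorem exists_isChainModule (hM : IsUniserial A M) (hf : IsFiniteLength A M) [Nontrivial M] :
    ∃ (s : SimpleClass A) (ℓ : ℕ), ℓ ≠ 0 ∧ IsChainModule s ℓ M := by
  obtain ⟨_, _⟩ := isFiniteLength_iff_isNoetherian_isArtinian.1 hf
  obtain ⟨ℓ, hℓ⟩ := ENat.ne_top_iff_exists.1 (Module.length_ne_top_iff.2 hf)
  obtain ⟨K, hK, -⟩ := (eq_top_or_exists_le_coatom (⊥ : Submodule A M)).resolve_left bot_ne_top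
  have := isSimpleModule_iff_isCoatom.2 hK
  obtain ⟨s, ⟨e⟩⟩ := SimpleClass.exists_equiv_rep (M ⧸ K) this
  refine ⟨s, ℓ, fun h0 => ?_, hM, hℓ.symm, fun _ => ⟨e.toLinearMap ∘ₗ K.mkQ,
    e.surjective.comp K.mkQ_surjective⟩⟩
  rw [h0] at hℓ
  exact not_subsingleton M (Module.length_eq_zero_iff.1 hℓ.symm)

end Chain

/-! ### Serial artinian rings and the successor of a simple module. -/

/-- Serial artinian rings, in terms of uniserial projective covers and injective envelopes. -/
class IsSerialArtinian (A : Type u) [Ring A] : Prop where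
  isArtinianRing : IsArtinianRing A
  exists_cover : ∀ s : SimpleClass A, ∃ (P : ModuleCat.{u} A) (c : ℕ), c ≠ 0 ∧
    Module.Projective A P ∧ IsChainModule s c P
  exists_hull : ∀ s : SimpleClass A, ∃ (E : ModuleCat.{u} A) (i : s.rep →ₗ[A] E),
    IsInjectiveEnvelope i ∧ IsFiniteLength A E ∧ IsUniserial A E

attribute [instance] IsSerialArtinian.isArtinianRing

section Serial

variable {A : Type u} [Ring A] [IsSerialArtinian A]

/-- The projective cover of a simple module. -/
noncomputable def cover (s : SimpleClass A) : ModuleCat.{u} A :=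
  (IsSerialArtinian.exists_cover s).choose

/-- The length of the projective cover of a simple module. -/
noncomputable def coverLength (s : SimpleClass A) : ℕ :=
  (IsSerialArtinian.exists_cover s).choose_spec.choose

theorem coverLength_ne_zero (s : SimpleClass A) : coverLength s ≠ 0 :=
  (IsSerialArtinian.exists_cover s).choose_spec.choose_spec.1

instance (s : SimpleClass A) : Module.Projective A (cover s) :=
  (IsSerialArtinian.exists_cover s).choose_spec.choose_spec.2.1

theorem isChainModule_cover (s : SimpleClass A) : IsChainModule s (coverLength s) (cover s) :=
  (IsSerialArtinian.exists_cover s).choose_spec.choose_spec.2.2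

variable {M N : Type u} [AddCommGroup M] [Module A M] [AddCommGroup N] [Module A N]
  {s t : SimpleClass A} {ℓ : ℕ}

theorem exists_cover_surjective (s : SimpleClass A) :
    ∃ p : cover s →ₗ[A] s.rep, Function.Surjective p :=
  (isChainModule_cover s).top (coverLength_ne_zero s)

omit [IsSerialArtinian A] in
theorem IsChainModule.exists_surjective_of_projective (h : IsChainModule s ℓ M)
    {P : Type u} [AddCommGroup P] [Module A P] [Module.Projective A P] {p : P →ₗ[A] s.rep}
    (hp : Function.Surjective p) : ∃ f : P →ₗ[A] M, Function.Surjective f := by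
  by_cases h0 : ℓ = 0
  · have := h.subsingleton_iff.2 h0
    exact ⟨0, fun y => ⟨0, Subsingleton.elim _ _⟩⟩
  obtain ⟨q, hq⟩ := h.top h0
  obtain ⟨f, hf⟩ := Module.projective_lifting_property q p hq
  exact ⟨f, h.surjective_of_comp (p := q) (by rw [hf]; exact hp)⟩

theorem IsChainModule.exists_cover_surjective (h : IsChainModule s ℓ M) :
    ∃ f : cover s →ₗ[A] M, Function.Surjective f := by
  obtain ⟨p, hp⟩ := Nakayama.exists_cover_surjective s
  exact h.exists_surjective_of_projective hp

theorem IsChainModule.le_coverLength (h : IsChainModule s ℓ M) : ℓ ≤ coverLength s := by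
  obtain ⟨f, hf⟩ := h.exists_cover_surjective
  have := Module.length_le_of_surjective f hf
  rw [h.length, (isChainModule_cover s).length] at this
  exact_mod_cast this

theorem IsChainModule.projective_of_eq (h : IsChainModule s (coverLength s) M) :
    Module.Projective A M := by
  obtain ⟨f, hf⟩ := h.exists_cover_surjective
  have := (isChainModule_cover s).isNoetherian
  have := (isChainModule_cover s).isArtinian
  exact Module.Projective.of_equiv (LinearEquiv.ofBijective f
    (bijective_of_surjective_of_length_le hf (by rw [h.length, (isChainModule_cover s).length])))

theorem IsChainModule.projective_iff (h : IsChainModule s ℓ M) (h0 : ℓ ≠ 0) :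
    Module.Projective A M ↔ ℓ = coverLength s := by
  refine ⟨fun hP => le_antisymm h.le_coverLength ?_, fun he => by subst he; exact h.projective_of_eq⟩
  obtain ⟨p, hp⟩ := h.top h0
  obtain ⟨f, hf⟩ := (isChainModule_cover s).exists_surjective_of_projective hp
  have := Module.length_le_of_surjective f hf
  rw [h.length, (isChainModule_cover s).length] at this
  exact_mod_cast this

/-- The radical of the cover is uniserial, so it has a single top. The condition sits inside the
existential so that `next` is total; nothing is said about its value when the cover is simple. -/
theorem exists_next (s : SimpleClass A) : ∃ t : SimpleClass A, coverLength s ≠ 1 →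
    ∃ K : Submodule A (cover s), IsChainModule t (coverLength s - 1) K := by
  by_cases h1 : coverLength s = 1
  · exact ⟨s, fun h => absurd h1 h⟩
  obtain ⟨p, hp⟩ := exists_cover_surjective s
  have hc := isChainModule_cover s
  have hlen := length_ker_add hp
  have := coverLength_ne_zero s
  rw [hc.length, Module.length_eq_one A s.rep] at hlen
  have hlen' : Module.length A (LinearMap.ker p) = (coverLength s - 1 : ℕ) := by
    have h2 : Module.length A (LinearMap.ker p) ≠ ⊤ := fun h => by
      rw [h, top_add] at hlen
      exact ENat.natCast_ne_top _ hlen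
    obtain ⟨m, hm⟩ := ENat.ne_top_iff_exists.1 h2
    rw [← hm] at hlen ⊢
    have : coverLength s = m + 1 := by exact_mod_cast hlen
    rw [this]; rfl
  have hnt : Nontrivial (LinearMap.ker p) := by
    rw [← Module.length_pos_iff (R := A), hlen']
    exact_mod_cast (by omega : 0 < coverLength s - 1)
  obtain ⟨t, ℓ, -, h⟩ := exists_isChainModule
    (hc.uniserial.of_injective _ (LinearMap.ker p).injective_subtype)
    (Module.length_ne_top_iff.1 (by rw [hlen']; exact ENat.natCast_ne_top _))
  refine ⟨t, fun _ => ⟨LinearMap.ker p, ?_⟩⟩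
  have : ℓ = coverLength s - 1 := by
    have := h.length.symm.trans hlen'
    exact_mod_cast this
  rwa [← this]

/-- The class of the top of the radical of the projective cover, when the latter is not simple. -/
noncomputable def next (s : SimpleClass A) : SimpleClass A := (exists_next s).choose

omit [IsSerialArtinian A] in
theorem length_of_add_eq {K : Submodule A M} {i j : ℕ} (h : Module.length A M = (i + j : ℕ))
    (hK : Module.length A K = i) : Module.length A (M ⧸ K) = j := by
  rw [length_submodule_add_quotient K, hK, Nat.cast_add] at h
  exact (ENat.addLECancellable_of_ne_top (ENat.natCast_ne_top i)).inj.1 h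

omit [IsSerialArtinian A] in
theorem length_ker_of_add_eq {p : M →ₗ[A] N} (hp : Function.Surjective p) {i j : ℕ}
    (h : Module.length A M = (i + j : ℕ)) (hN : Module.length A N = i) :
    Module.length A (LinearMap.ker p) = j := by
  rw [length_ker_add hp, hN, Nat.cast_add, add_comm] at h
  exact (ENat.addLECancellable_of_ne_top (ENat.natCast_ne_top i)).inj.1 h

/-- The surjection from the cover takes radical onto radical, so the second layer depends only on
the top. Thus the composition factors of a uniserial module are successive iterates of `next`. -/
theorem IsChainModule.exists_radical (h : IsChainModule s (ℓ + 1) M) :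
    ∃ K : Submodule A M, IsChainModule (next s) ℓ K ∧ IsChainModule s 1 (M ⧸ K) := by
  have := h.isNoetherian
  have := h.isArtinian
  by_cases h0 : ℓ = 0
  · subst h0
    exact ⟨⊥, IsChainModule.zero, h.congr (Submodule.quotEquivOfEqBot ⊥ rfl).symm⟩
  obtain ⟨f, hf⟩ := h.exists_cover_surjective
  have hle := h.le_coverLength
  have hc := isChainModule_cover s
  obtain ⟨L, hL⟩ := (exists_next s).choose_spec (by omega)
  change IsChainModule (next s) _ L at hL
  have := hc.isNoetherian
  have := hc.isArtinian
  obtain ⟨p, hp⟩ := h.top (by omega)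
  have hlen : Module.length A (LinearMap.ker (p ∘ₗ f)) = (coverLength s - 1 : ℕ) :=
    length_ker_of_add_eq (p := p ∘ₗ f) (hp.comp hf : Function.Surjective (p ∘ f)) (i := 1)
      (by rw [hc.length]; congr 1; have := coverLength_ne_zero s; omega)
      (by rw [Module.length_eq_one A s.rep]; rfl)
  have hLk : L = LinearMap.ker (p ∘ₗ f) := hc.uniserial.eq_of_length_eq (by rw [hL.length, hlen])
  have hlenp : Module.length A (LinearMap.ker p) = ℓ :=
    length_ker_of_add_eq hp (i := 1) (by rw [h.length, add_comm])
      (by rw [Module.length_eq_one A s.rep]; rfl)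
  have hmem : ∀ x : L, f x ∈ LinearMap.ker p := fun x => by
    have : (x : cover s) ∈ LinearMap.ker (p ∘ₗ f) := hLk ▸ x.2
    exact this
  refine ⟨LinearMap.ker p, hL.of_surjective (f := (f.comp L.subtype).codRestrict _ hmem) ?_ hlenp,
    IsChainModule.of_isSimpleModule (LinearMap.quotKerEquivOfSurjective p hp)⟩
  rintro ⟨y, hy⟩
  obtain ⟨x, rfl⟩ := hf y
  exact ⟨⟨x, by rw [hLk]; exact hy⟩, rfl⟩

theorem IsChainModule.exists_submodule {i j : ℕ} (h : IsChainModule s (i + j) M) :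
    ∃ K : Submodule A M, IsChainModule (next^[i] s) j K ∧ IsChainModule s i (M ⧸ K) := by
  have := h.isNoetherian
  have := h.isArtinian
  suffices H : ∃ K : Submodule A M, IsChainModule (next^[i] s) j K by
    obtain ⟨K, hK⟩ := H
    exact ⟨K, hK, h.of_surjective K.mkQ_surjective
      (length_of_add_eq (by rw [h.length, add_comm]) hK.length)⟩
  induction i generalizing j with
  | zero => exact ⟨⊤, (by rwa [zero_add] at h : IsChainModule s j M).congr Submodule.topEquiv.symm⟩
  | succ i ih =>
    obtain ⟨K, hK⟩ := ih (j := j + 1) (by rwa [← add_assoc, add_right_comm])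
    obtain ⟨L, hL, -⟩ := hK.exists_radical
    refine ⟨L.map K.subtype, ?_⟩
    rw [Function.iterate_succ_apply']
    exact hL.congr (K.equivSubtypeMap L)

theorem IsChainModule.submodule {i j : ℕ} (h : IsChainModule s (i + j) M) {K : Submodule A M}
    (hK : Module.length A K = j) :
    IsChainModule (next^[i] s) j K ∧ IsChainModule s i (M ⧸ K) := by
  have := h.isNoetherian
  have := h.isArtinian
  obtain ⟨L, hL⟩ := h.exists_submodule
  rwa [h.uniserial.eq_of_length_eq (hK.trans hL.1.length.symm)]

theorem IsChainModule.ker {i j : ℕ} (h : IsChainModule s (i + j) M) {f : M →ₗ[A] N}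
    (hf : Function.Surjective f) (hN : Module.length A N = i) :
    IsChainModule (next^[i] s) j (LinearMap.ker f) :=
  (h.submodule (length_ker_of_add_eq hf h.length hN)).1

/-- The syzygy of a uniserial module. -/
theorem IsChainModule.exists_syzygy (h : IsChainModule s ℓ M) :
    ∃ f : cover s →ₗ[A] M, Function.Surjective f ∧
      IsChainModule (next^[ℓ] s) (coverLength s - ℓ) (LinearMap.ker f) := by
  obtain ⟨f, hf⟩ := h.exists_cover_surjective
  refine ⟨f, hf, IsChainModule.ker ?_ hf h.length⟩
  rw [Nat.add_sub_cancel' h.le_coverLength]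
  exact isChainModule_cover s

/-- The radical of the cover of s has top `next s`, hence is a quotient of the next cover. This
becomes the monotonicity of `coverEnd`. -/
theorem coverLength_le_coverLength_next (s : SimpleClass A) :
    coverLength s ≤ coverLength (next s) + 1 := by
  by_contra! hlt
  obtain ⟨m, hm⟩ := Nat.exists_eq_add_of_lt hlt
  have h := isChainModule_cover s
  rw [show coverLength s = 1 + (coverLength (next s) + m + 1) by omega] at h
  obtain ⟨K, hK, -⟩ := h.exists_submodule
  have := hK.le_coverLength
  simp at this

theorem exists_isChainModule_of_le (h : ℓ ≤ coverLength s) :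
    ∃ M : ModuleCat.{u} A, IsChainModule s ℓ M := by
  obtain ⟨j, hj⟩ := Nat.exists_eq_add_of_le h
  have h := isChainModule_cover s
  rw [hj] at h
  obtain ⟨K, -, hK⟩ := h.exists_submodule
  exact ⟨ModuleCat.of A (cover s ⧸ K), hK⟩

end Serial

/-! ### Composition factors, and the central idempotent of a set closed under succession. -/

section Factor

variable {A : Type u} [Ring A] [IsSerialArtinian A]
  {M N : Type u} [AddCommGroup M] [Module A M] [AddCommGroup N] [Module A N]
  {s t : SimpleClass A} {ℓ : ℕ}

/-- The simple modules of class `s` occur as composition factors of `M`. -/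
def IsFactor (s : SimpleClass A) (M : Type u) [AddCommGroup M] [Module A M] : Prop :=
  ∃ f : cover s →ₗ[A] M, f ≠ 0

theorem IsFactor.of_injective (h : IsFactor s M) {f : M →ₗ[A] N} (hf : Function.Injective f) :
    IsFactor s N := by
  obtain ⟨g, hg⟩ := h
  refine ⟨f ∘ₗ g, fun h0 => hg (LinearMap.ext fun x => hf ?_)⟩
  rw [LinearMap.zero_apply, map_zero]
  exact LinearMap.congr_fun h0 x

theorem IsFactor.of_surjective (h : IsFactor s N) {f : M →ₗ[A] N} (hf : Function.Surjective f) :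
    IsFactor s M := by
  obtain ⟨g, hg⟩ := h
  obtain ⟨k, rfl⟩ := Module.projective_lifting_property f g hf
  exact ⟨k, fun h0 => hg (by rw [h0, LinearMap.comp_zero])⟩

theorem IsFactor.ker_or (h : IsFactor s M) (f : M →ₗ[A] N) :
    IsFactor s (LinearMap.ker f) ∨ IsFactor s N := by
  obtain ⟨g, hg⟩ := h
  by_cases h0 : f ∘ₗ g = 0
  · left
    refine ⟨g.codRestrict _ fun x => LinearMap.congr_fun h0 x, fun h1 => hg ?_⟩
    ext x
    exact congrArg Subtype.val (LinearMap.congr_fun h1 x)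
  · exact Or.inr ⟨_, h0⟩

theorem isFactor_rep_iff : IsFactor s t.rep ↔ s = t := by
  constructor
  · rintro ⟨f, hf⟩
    exact (isChainModule_cover s).top_unique
      (LinearMap.surjective_of_ne_zero hf)
  · rintro rfl
    obtain ⟨p, hp⟩ := exists_cover_surjective s
    refine ⟨p, fun h0 => ?_⟩
    have : Nontrivial s.rep := IsSimpleModule.nontrivial A _
    obtain ⟨y, hy⟩ := exists_ne (0 : s.rep)
    obtain ⟨x, rfl⟩ := hp y
    exact hy (by rw [h0]; rfl)

omit [IsSerialArtinian A] in
theorem exists_surjective_rep (M : Type u) [AddCommGroup M] [Module A M] [Module.Finite A M]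
    {K : Submodule A M} (hK : K ≠ ⊤) : ∃ (s : SimpleClass A) (p : M →ₗ[A] s.rep),
      Function.Surjective p ∧ K ≤ LinearMap.ker p := by
  obtain ⟨L, hL, hKL⟩ := (eq_top_or_exists_le_coatom K).resolve_left hK
  obtain ⟨s, ⟨e⟩⟩ := SimpleClass.exists_equiv_rep (M ⧸ L) (isSimpleModule_iff_isCoatom.2 hL)
  refine ⟨s, e.toLinearMap ∘ₗ L.mkQ, e.surjective.comp L.mkQ_surjective, fun x hx => ?_⟩
  simpa using hKL hx

theorem exists_isFactor (M : Type u) [AddCommGroup M] [Module A M] [Nontrivial M] :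
    ∃ s, IsFactor (A := A) s M := by
  obtain ⟨x, hx⟩ := exists_ne (0 : M)
  have : Nontrivial (A ∙ x) := by
    rw [Submodule.nontrivial_iff_ne_bot, Ne, Submodule.span_singleton_eq_bot]
    exact hx
  obtain ⟨s, p, hp, -⟩ := exists_surjective_rep (A ∙ x) (K := (⊥ : Submodule A (A ∙ x))) bot_ne_top
  exact ⟨s, ((isFactor_rep_iff.2 rfl).of_surjective hp).of_injective
    (Submodule.injective_subtype _)⟩

theorem isFactor_self (s : SimpleClass A) : IsFactor s A := by
  have hc := isChainModule_cover s
  have := hc.nontrivial (coverLength_ne_zero s)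
  obtain ⟨x, hx⟩ := exists_ne (0 : cover s)
  obtain ⟨σ, hσ⟩ := Module.projective_def'.1 (inferInstance : Module.Projective A (cover s))
  by_contra hcon
  refine hx ?_
  have h0 : σ x = 0 := by
    ext y
    by_contra hne
    exact hcon ⟨Finsupp.lapply y ∘ₗ σ, fun h => hne (LinearMap.congr_fun h x)⟩
  have := LinearMap.congr_fun hσ x
  rw [LinearMap.comp_apply, h0, map_zero] at this
  exact this.symm

theorem finite_isFactor (hM : IsFiniteLength A M) : {s : SimpleClass A | IsFactor s M}.Finite := by
  induction hM with
  | of_subsingleton =>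
    exact Set.finite_empty.subset fun s ⟨f, hf⟩ =>
      hf (LinearMap.ext fun x => Subsingleton.elim _ _)
  | @of_simple_quotient M _ _ K _ _ ih =>
    obtain ⟨t, ⟨e⟩⟩ := SimpleClass.exists_equiv_rep (A := A) (M ⧸ K) inferInstance
    refine (ih.union (Set.finite_singleton t)).subset fun s hs => ?_
    rcases hs.ker_or K.mkQ with h | h
    · left
      rw [Submodule.ker_mkQ] at h
      exact h
    · right
      exact isFactor_rep_iff.1 (h.of_injective (f := e.toLinearMap) e.injective)

instance : Finite (SimpleClass A) := by
  have h : IsFiniteLength A A := Module.length_ne_top_iff.1 Module.length_ne_top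
  exact Set.finite_univ_iff.1 ((finite_isFactor h).subset fun s _ => isFactor_self s)

/-- Neighbouring composition factors are related by `next`, so a uniserial module lies entirely
inside or entirely outside O. -/
theorem IsChainModule.mem_iff_of_isFactor (h : IsChainModule s ℓ M) {O : Set (SimpleClass A)}
    (hO : ∀ s, coverLength s ≠ 1 → (s ∈ O ↔ next s ∈ O)) (ht : IsFactor t M) : t ∈ O ↔ s ∈ O := by
  induction ℓ generalizing s M with
  | zero =>
    obtain ⟨f, hf⟩ := ht
    have := h.subsingleton_iff.2 rfl
    exact absurd (LinearMap.ext fun x => Subsingleton.elim _ _) hf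
  | succ ℓ ih =>
    obtain ⟨K, hK, hK'⟩ := h.exists_radical
    rcases ht.ker_or K.mkQ with h1 | h1
    · rw [Submodule.ker_mkQ] at h1
      have hl : ℓ ≠ 0 := fun h0 => by
        obtain ⟨f, hf⟩ := h1
        have := hK.subsingleton_iff.2 h0
        exact absurd (LinearMap.ext fun x => Subsingleton.elim _ _) hf
      rw [ih hK h1, hO s (by have := h.le_coverLength; omega)]
    · obtain ⟨e⟩ := hK'.exists_equiv_rep
      rw [isFactor_rep_iff.1 (h1.of_injective (f := e.toLinearMap) e.injective)]

end Factor

section Connected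

variable {A : Type u} [Ring A] [IsSerialArtinian A]
  {M N : Type u} [AddCommGroup M] [Module A M] [AddCommGroup N] [Module A N]

theorem IsFactor.span_map {x : M} {s : SimpleClass A} (f : M →ₗ[A] N)
    (h : IsFactor s (A ∙ f x)) : IsFactor s (A ∙ x) := by
  have hmem : ∀ y : (A ∙ x), f y ∈ (A ∙ f x) := fun y => by
    rw [← Set.image_singleton, ← Submodule.map_span]
    exact Submodule.mem_map_of_mem y.2
  refine h.of_surjective (f := (f ∘ₗ (A ∙ x).subtype).codRestrict _ hmem) ?_
  rintro ⟨y, hy⟩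
  obtain ⟨a, rfl⟩ := Submodule.mem_span_singleton.1 hy
  refine ⟨⟨a • x, Submodule.smul_mem _ _ (Submodule.mem_span_singleton_self x)⟩, ?_⟩
  exact Subtype.ext (map_smul f a x)

/-- The largest submodule all whose composition factors belong to `O`. -/
def factorSubmodule (O : Set (SimpleClass A)) (M : Type u) [AddCommGroup M] [Module A M] :
    Submodule A M where
  carrier := {x | ∀ s, IsFactor s (A ∙ x) → s ∈ O}
  zero_mem' s h := by
    obtain ⟨f, hf⟩ := h
    have : Subsingleton (A ∙ (0 : M)) := by
      rw [Submodule.span_zero_singleton]; infer_instance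
    exact absurd (LinearMap.ext fun x => Subsingleton.elim _ _) hf
  add_mem' := by
    intro x y hx hy s hs
    have h1 : IsFactor s (A ∙ ((x, y) : M × M)) := by
      refine IsFactor.span_map (LinearMap.fst A M M + LinearMap.snd A M M) ?_
      simpa using hs
    have hmem : ∀ z : (A ∙ ((x, y) : M × M)), (z : M × M).1 ∈ (A ∙ x) := by
      rintro ⟨z, hz⟩
      obtain ⟨a, rfl⟩ := Submodule.mem_span_singleton.1 hz
      exact Submodule.smul_mem _ _ (Submodule.mem_span_singleton_self x)
    obtain ⟨g, hg⟩ := h1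
    by_cases h0 : LinearMap.fst A M M ∘ₗ Submodule.subtype _ ∘ₗ g = 0
    · refine hy s ?_
      have hmem' : ∀ z : (A ∙ ((x, y) : M × M)), (z : M × M).2 ∈ (A ∙ y) := by
        rintro ⟨z, hz⟩
        obtain ⟨a, rfl⟩ := Submodule.mem_span_singleton.1 hz
        exact Submodule.smul_mem _ _ (Submodule.mem_span_singleton_self y)
      refine ⟨((LinearMap.snd A M M ∘ₗ Submodule.subtype _).codRestrict _ hmem') ∘ₗ g,
        fun h3 => hg ?_⟩
      ext z
      · exact LinearMap.congr_fun h0 z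
      · exact congrArg Subtype.val (LinearMap.congr_fun h3 z)
    · refine hx s ⟨((LinearMap.fst A M M ∘ₗ Submodule.subtype _).codRestrict _ hmem) ∘ₗ g,
        fun h3 => h0 ?_⟩
      ext z
      exact congrArg Subtype.val (LinearMap.congr_fun h3 z)
  smul_mem' := by
    intro a x hx s hs
    exact hx s (IsFactor.of_injective hs (f := Submodule.inclusion
      ((Submodule.span_singleton_le_iff_mem _ _).2
        (Submodule.smul_mem _ _ (Submodule.mem_span_singleton_self x))))
      (Submodule.inclusion_injective _))

theorem factorSubmodule_map (O : Set (SimpleClass A)) (f : M →ₗ[A] N) {x : M}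
    (hx : x ∈ factorSubmodule O M) : f x ∈ factorSubmodule O N := fun s hs =>
  hx s (IsFactor.span_map f hs)

theorem factorSubmodule_inf_compl (O : Set (SimpleClass A)) {x : M}
    (hx : x ∈ factorSubmodule O M) (hx' : x ∈ factorSubmodule Oᶜ M) : x = 0 := by
  by_contra h0
  have : Nontrivial (A ∙ x) := by
    rw [Submodule.nontrivial_iff_ne_bot, Ne, Submodule.span_singleton_eq_bot]
    exact h0
  obtain ⟨s, hs⟩ := exists_isFactor (A := A) (A ∙ x)
  exact hx' s hs (hx s hs)

theorem range_le_factorSubmodule {O : Set (SimpleClass A)}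
    (hO : ∀ s, coverLength s ≠ 1 → (s ∈ O ↔ next s ∈ O)) {s : SimpleClass A} (hs : s ∈ O)
    (f : cover s →ₗ[A] M) (x : cover s) : f x ∈ factorSubmodule O M := by
  refine factorSubmodule_map O f fun t ht => ?_
  rw [(isChainModule_cover s).mem_iff_of_isFactor hO
    (ht.of_injective (Submodule.injective_subtype _))]
  exact hs

/-- Over a connected algebra, a nonempty set of simple modules closed under `next` in both
directions contains all simple modules. -/
theorem eq_univ_of_next_closed (hconn : IsConnected A) {O : Set (SimpleClass A)}
    (hne : O.Nonempty) (hO : ∀ s, coverLength s ≠ 1 → (s ∈ O ↔ next s ∈ O)) : O = Set.univ := by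
  have hO' : ∀ s, coverLength s ≠ 1 → (s ∈ Oᶜ ↔ next s ∈ Oᶜ) := fun s hs => not_congr (hO s hs)
  -- Otherwise some map onto a simple s kills the sum; it is hit by a map from the cover of s, whose
  -- image lies in one of the two summands.
  have htop : factorSubmodule O A ⊔ factorSubmodule Oᶜ A = ⊤ := by
    by_contra hcon
    obtain ⟨s, p, hp, hle⟩ := exists_surjective_rep A hcon
    obtain ⟨q, hq⟩ := exists_cover_surjective s
    obtain ⟨f, rfl⟩ := Module.projective_lifting_property p q hp
    have : Nontrivial s.rep := IsSimpleModule.nontrivial A _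
    obtain ⟨y, hy⟩ := exists_ne (0 : s.rep)
    obtain ⟨x, rfl⟩ := hq y
    refine hy (hle ?_)
    by_cases hs : s ∈ O
    · exact (le_sup_left : factorSubmodule O A ≤ _) (range_le_factorSubmodule hO hs f x)
    · exact (le_sup_right : factorSubmodule Oᶜ A ≤ _)
        (range_le_factorSubmodule hO' (s := s) hs f x)
  obtain ⟨e, he, e', he', hee⟩ := Submodule.mem_sup.1 (htop ▸ Submodule.mem_top : (1 : A) ∈ _)
  -- Right multiplication is a left-linear endomorphism, so both summands are two-sided ideals and
  -- the component e of 1 is a central idempotent.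
  have hright : ∀ (O : Set (SimpleClass A)) (x a : A), x ∈ factorSubmodule O A →
      x * a ∈ factorSubmodule O A := fun O x a hx =>
    factorSubmodule_map O (LinearMap.toSpanSingleton A A a) hx
  have hzero : ∀ a, e * a - a * e = 0 := fun a => by
    refine factorSubmodule_inf_compl O (sub_mem (hright O e a he)
      ((factorSubmodule O A).smul_mem a he)) ?_
    have : e * a - a * e = a * e' - e' * a := by
      rw [eq_sub_of_add_eq' hee]; noncomm_ring
    rw [this]
    exact sub_mem ((factorSubmodule Oᶜ A).smul_mem a he') (hright _ e' a he')
  have hidem : IsIdempotentElem e := by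
    have : e * e' = 0 := factorSubmodule_inf_compl O (hright O e e' he)
      ((factorSubmodule Oᶜ A).smul_mem e he')
    have h2 : e * (e + e') = e := by rw [hee, mul_one]
    rwa [mul_add, this, add_zero] at h2
  have hcen : e ∈ Set.center A := by
    rw [Semigroup.mem_center_iff]
    exact fun a => (sub_eq_zero.1 (hzero a)).symm
  have key : ∀ (O : Set (SimpleClass A)), (∀ s, coverLength s ≠ 1 → (s ∈ O ↔ next s ∈ O)) →
      (1 : A) ∈ factorSubmodule Oᶜ A → ∀ s, s ∉ O := by
    intro O hO h1 s hs
    obtain ⟨f, hf⟩ := isFactor_self s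
    refine hf (LinearMap.ext fun x => factorSubmodule_inf_compl O
      (range_le_factorSubmodule hO hs f x) ?_)
    have := (factorSubmodule Oᶜ A).smul_mem (f x) h1
    rwa [smul_eq_mul, mul_one] at this
  rcases hconn.2 e hcen hidem with h0 | h1
  · obtain ⟨s, hs⟩ := hne
    rw [h0, zero_add] at hee
    exact absurd hs (key O hO (hee ▸ he') s)
  · ext s
    simp only [Set.mem_univ, iff_true]
    have := key Oᶜ hO' (by rw [compl_compl]; exact h1 ▸ he) s
    simpa using this

end Connected

/-! ### Injective envelopes of simple modules and injectivity of succession. -/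

section Hull

variable {A : Type u} [Ring A] [IsSerialArtinian A]
  {M N : Type u} [AddCommGroup M] [Module A M] [AddCommGroup N] [Module A N]
  {s t : SimpleClass A} {ℓ : ℕ}

/-- The injective envelope of a simple module. -/
noncomputable def hull (s : SimpleClass A) : ModuleCat.{u} A :=
  (IsSerialArtinian.exists_hull s).choose

/-- The inclusion of a simple module in its injective envelope. -/
noncomputable def hullIncl (s : SimpleClass A) : s.rep →ₗ[A] hull s :=
  (IsSerialArtinian.exists_hull s).choose_spec.choose

theorem isInjectiveEnvelope_hullIncl (s : SimpleClass A) : IsInjectiveEnvelope (hullIncl s) :=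
  (IsSerialArtinian.exists_hull s).choose_spec.choose_spec.1

theorem exists_isChainModule_hull (t : SimpleClass A) :
    ∃ (s : SimpleClass A) (d : ℕ), d ≠ 0 ∧ IsChainModule s d (hull t) := by
  have h := (IsSerialArtinian.exists_hull t).choose_spec.choose_spec.2
  have : Nontrivial (hull t) :=
    have : Nontrivial t.rep := IsSimpleModule.nontrivial A _
    (isInjectiveEnvelope_hullIncl t).mono.nontrivial
  exact exists_isChainModule h.2 h.1

/-- The class of the top of the injective envelope. -/
noncomputable def hullTop (t : SimpleClass A) : SimpleClass A := (exists_isChainModule_hull t).choose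

/-- The length of the injective envelope. -/
noncomputable def hullLength (t : SimpleClass A) : ℕ :=
  (exists_isChainModule_hull t).choose_spec.choose

theorem hullLength_ne_zero (t : SimpleClass A) : hullLength t ≠ 0 :=
  (exists_isChainModule_hull t).choose_spec.choose_spec.1

theorem isChainModule_hull (t : SimpleClass A) :
    IsChainModule (hullTop t) (hullLength t) (hull t) :=
  (exists_isChainModule_hull t).choose_spec.choose_spec.2

theorem next_iterate_hullTop (t : SimpleClass A) : next^[hullLength t - 1] (hullTop t) = t := by
  have h := isChainModule_hull t
  have h0 := hullLength_ne_zero t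
  rw [show hullLength t = (hullLength t - 1) + 1 by omega] at h
  have e := LinearEquiv.ofInjective (hullIncl t) (isInjectiveEnvelope_hullIncl t).mono
  have h1 := (h.submodule (K := LinearMap.range (hullIncl t)) (by
    rw [← e.length_eq, Module.length_eq_one A t.rep, Nat.cast_one])).1
  exact (h1.congr e.symm).class_unique (IsChainModule.of_isSimpleModule (LinearEquiv.refl A _))
    one_ne_zero

/-- A uniserial module with socle of class `t` embeds in the injective envelope of `t`. -/
theorem IsChainModule.exists_injective_hull {i : ℕ} (h : IsChainModule s (i + 1) M) :
    ∃ f : M →ₗ[A] hull (next^[i] s), Function.Injective f := by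
  obtain ⟨K, hK, -⟩ := h.exists_submodule
  obtain ⟨e⟩ := hK.exists_equiv_rep
  set t := next^[i] s
  have henv := isInjectiveEnvelope_hullIncl t
  obtain ⟨f, hf⟩ := henv.injective.out K.subtype K.injective_subtype (hullIncl t ∘ₗ e.toLinearMap)
  refine ⟨f, ?_⟩
  rw [← LinearMap.ker_eq_bot]
  by_contra hne
  have hat : IsAtom K := isSimpleModule_iff_isAtom.1 (IsSimpleModule.congr e)
  have hle := h.uniserial.le_of_isAtom hat hne
  refine hat.1 (eq_bot_iff.2 fun x hx => ?_)
  have h1 := hf ⟨x, hx⟩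
  rw [show f (K.subtype ⟨x, hx⟩) = 0 from hle hx] at h1
  have h2 : e ⟨x, hx⟩ = 0 := henv.mono (by rw [map_zero]; exact h1.symm)
  have h3 : (⟨x, hx⟩ : K) = 0 := e.injective (by rw [h2, map_zero])
  exact congrArg Subtype.val h3

/-- Both modules embed in the injective envelope of their common socle, which is uniserial and so
has only one submodule of length 2. -/
theorem IsChainModule.eq_of_next_eq {s' : SimpleClass A} (h : IsChainModule s 2 M)
    (h' : IsChainModule s' 2 N) (he : next s = next s') : s = s' := by
  obtain ⟨f, hf⟩ := IsChainModule.exists_injective_hull (i := 1) h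
  obtain ⟨g, hg⟩ := IsChainModule.exists_injective_hull (i := 1) h'
  have hH := isChainModule_hull (next s')
  have := hH.isNoetherian
  have := hH.isArtinian
  obtain ⟨f, hf⟩ : ∃ f : M →ₗ[A] hull (next s'), Function.Injective f := by
    rw [← he]; exact ⟨f, hf⟩
  obtain ⟨g, hg⟩ : ∃ g : N →ₗ[A] hull (next s'), Function.Injective g := ⟨g, hg⟩
  have e1 := LinearEquiv.ofInjective f hf
  have e2 := LinearEquiv.ofInjective g hg
  have e3 := hH.uniserial.eq_of_length_eq (K := LinearMap.range f) (L := LinearMap.range g)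
    (by rw [← e1.length_eq, ← e2.length_eq, h.length, h'.length])
  exact (h.congr (e1.trans ((LinearEquiv.ofEq _ _ e3).trans e2.symm))).class_unique h' two_ne_zero

theorem next_injective (h : ∀ s : SimpleClass A, coverLength s ≠ 1) :
    Function.Injective (next : SimpleClass A → SimpleClass A) := by
  have hex : ∀ s : SimpleClass A, ∃ M : ModuleCat.{u} A, IsChainModule s 2 M := fun s =>
    exists_isChainModule_of_le (by have := h s; have := coverLength_ne_zero s; omega)
  intro s s' he
  obtain ⟨M, hM⟩ := hex s
  obtain ⟨N, hN⟩ := hex s'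
  exact hM.eq_of_next_eq hN he

end Hull

/-! ### Finite homological dimensions and the global dimension. -/

section Dimension

variable (A : Type u) [Ring A]

/-- `M` has finite projective dimension. -/
def FinitePd (M : Type u) [AddCommGroup M] [Module A M] : Prop :=
  ∃ n, HasProjectiveDimensionLT (ModuleCat.of A M) n

/-- `M` has finite injective dimension. -/
def FiniteId (M : Type u) [AddCommGroup M] [Module A M] : Prop :=
  ∃ n, HasInjectiveDimensionLT (ModuleCat.of A M) n

variable {A} {M N P : Type u} [AddCommGroup M] [Module A M] [AddCommGroup N] [Module A N]
  [AddCommGroup P] [Module A P]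

theorem projectiveDimension_ne_top_iff_finitePd (M : ModuleCat.{u} A) :
    projectiveDimension M ≠ ⊤ ↔ FinitePd A M := by
  rw [projectiveDimension_ne_top_iff]
  exact ⟨fun ⟨n, h⟩ => ⟨n + 1, h⟩, fun ⟨n, h⟩ => ⟨n, hasProjectiveDimensionLT_of_ge _ n _ (by omega)⟩⟩

theorem injectiveDimension_ne_top_iff_finiteId (M : ModuleCat.{u} A) :
    injectiveDimension M ≠ ⊤ ↔ FiniteId A M := by
  rw [injectiveDimension_ne_top_iff]
  exact ⟨fun ⟨n, h⟩ => ⟨n + 1, h⟩, fun ⟨n, h⟩ => ⟨n, hasInjectiveDimensionLT_of_ge _ n _ (by omega)⟩⟩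

theorem shortExact_of_injective_surjective {f : N →ₗ[A] P} {g : P →ₗ[A] M}
    (hf : Function.Injective f) (hg : Function.Surjective g) (h : Function.Exact f g) :
    (ModuleCat.shortComplexOfCompEqZero f g h.linearMap_comp_eq_zero).ShortExact :=
  ModuleCat.shortComplex_shortExact _ h hf hg

theorem hasProjectiveDimensionLT_one_iff :
    HasProjectiveDimensionLT (ModuleCat.of A M) 1 ↔ Module.Projective A M := by
  rw [← projective_iff_hasProjectiveDimensionLT_one, ← IsProjective.iff_projective]

theorem hasInjectiveDimensionLT_one_iff :
    HasInjectiveDimensionLT (ModuleCat.of A M) 1 ↔ Module.Injective A M := by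
  rw [← injective_iff_hasInjectiveDimensionLT_one, ← Module.injective_iff_injective_object]

theorem FinitePd.of_projective [Module.Projective A M] : FinitePd A M :=
  ⟨1, hasProjectiveDimensionLT_one_iff.2 inferInstance⟩

theorem FiniteId.of_injective (h : Module.Injective A M) : FiniteId A M :=
  ⟨1, hasInjectiveDimensionLT_one_iff.2 h⟩

theorem FinitePd.of_subsingleton [Subsingleton M] : FinitePd A M :=
  have : Module.Projective A M := inferInstance
  FinitePd.of_projective

theorem FinitePd.of_retract (h : FinitePd A M) (i : N →ₗ[A] M) (r : M →ₗ[A] N)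
    (hri : r ∘ₗ i = LinearMap.id) : FinitePd A N := by
  obtain ⟨n, h⟩ := h
  refine ⟨n, Retract.hasProjectiveDimensionLT (Y := ModuleCat.of A M)
    ⟨ModuleCat.ofHom i, ModuleCat.ofHom r, ?_⟩ n⟩
  rw [← ModuleCat.ofHom_comp, hri]
  rfl

theorem FiniteId.of_retract (h : FiniteId A M) (i : N →ₗ[A] M) (r : M →ₗ[A] N)
    (hri : r ∘ₗ i = LinearMap.id) : FiniteId A N := by
  obtain ⟨n, h⟩ := h
  refine ⟨n, Retract.hasInjectiveDimensionLT (Y := ModuleCat.of A M)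
    ⟨ModuleCat.ofHom i, ModuleCat.ofHom r, ?_⟩ n⟩
  rw [← ModuleCat.ofHom_comp, hri]
  rfl

theorem FinitePd.of_exact {f : N →ₗ[A] P} {g : P →ₗ[A] M}
    (hf : Function.Injective f) (hg : Function.Surjective g) (h : Function.Exact f g)
    (hN : FinitePd A N) (hM : FinitePd A M) : FinitePd A P := by
  obtain ⟨n, hN⟩ := hN
  obtain ⟨m, hM⟩ := hM
  exact ⟨max n m, (shortExact_of_injective_surjective hf hg h).hasProjectiveDimensionLT_X₂ _
    (hasProjectiveDimensionLT_of_ge _ n _ (le_max_left _ _))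
    (hasProjectiveDimensionLT_of_ge _ m _ (le_max_right _ _))⟩

theorem FiniteId.of_exact {f : N →ₗ[A] P} {g : P →ₗ[A] M}
    (hf : Function.Injective f) (hg : Function.Surjective g) (h : Function.Exact f g)
    (hN : FiniteId A N) (hM : FiniteId A M) : FiniteId A P := by
  obtain ⟨n, hN⟩ := hN
  obtain ⟨m, hM⟩ := hM
  exact ⟨max n m, (shortExact_of_injective_surjective hf hg h).hasInjectiveDimensionLT_X₂ _
    (hasInjectiveDimensionLT_of_ge _ n _ (le_max_left _ _))
    (hasInjectiveDimensionLT_of_ge _ m _ (le_max_right _ _))⟩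

theorem FinitePd.of_submodule_of_quotient (K : Submodule A M) (h : FinitePd A K)
    (h' : FinitePd A (M ⧸ K)) : FinitePd A M :=
  FinitePd.of_exact K.injective_subtype K.mkQ_surjective (LinearMap.exact_subtype_mkQ K) h h'

theorem finitePd_ker_iff [Module.Projective A P] {g : P →ₗ[A] M} (hg : Function.Surjective g) :
    FinitePd A (LinearMap.ker g) ↔ FinitePd A M := by
  have hP : Projective (ModuleCat.of A P) := (IsProjective.iff_projective P).1 inferInstance
  have hS := shortExact_of_injective_surjective (LinearMap.ker g).injective_subtype hg
    (LinearMap.exact_subtype_ker_map g)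
  constructor
  · rintro ⟨n, h⟩
    exact ⟨n + 2, (hS.hasProjectiveDimensionLT_X₃_iff n hP).2
      (hasProjectiveDimensionLT_of_ge _ n _ (by omega))⟩
  · rintro ⟨n, h⟩
    exact ⟨n + 1, (hS.hasProjectiveDimensionLT_X₃_iff n hP).1
      (hasProjectiveDimensionLT_of_ge _ n _ (by omega))⟩

theorem finiteId_quotient_iff (hP : Module.Injective A P) {f : N →ₗ[A] P}
    (hf : Function.Injective f) :
    FiniteId A (P ⧸ LinearMap.range f) ↔ FiniteId A N := by
  have hP : Injective (ModuleCat.of A P) := (Module.injective_iff_injective_object A P).1 hP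
  have hS := shortExact_of_injective_surjective hf (LinearMap.range f).mkQ_surjective
    (LinearMap.exact_map_mkQ_range f)
  constructor
  · rintro ⟨n, h⟩
    exact ⟨n + 2, (hS.hasInjectiveDimensionLT_X₃_iff n hP).1
      (hasInjectiveDimensionLT_of_ge _ n _ (by omega))⟩
  · rintro ⟨n, h⟩
    exact ⟨n + 1, (hS.hasInjectiveDimensionLT_X₃_iff n hP).2
      (hasInjectiveDimensionLT_of_ge _ n _ (by omega))⟩

theorem projectiveDimension_eq_one_iff {M : ModuleCat.{u} A} [Module.Projective A P]
    {g : P →ₗ[A] M} (hg : Function.Surjective g) :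
    projectiveDimension M = 1 ↔
      ¬ Module.Projective A M ∧ Module.Projective A (LinearMap.ker g) := by
  have hP : Projective (ModuleCat.of A P) := (IsProjective.iff_projective P).1 inferInstance
  have hS := shortExact_of_injective_surjective (LinearMap.ker g).injective_subtype hg
    (LinearMap.exact_subtype_ker_map g)
  have h1 := hS.hasProjectiveDimensionLT_X₃_iff 0 hP
  have h2 := projectiveDimension_le_iff M 1
  have h3 := projectiveDimension_ge_iff M 1
  rw [le_antisymm_iff, and_comm, ← hasProjectiveDimensionLT_one_iff (M := M),
    ← hasProjectiveDimensionLT_one_iff (M := LinearMap.ker g)]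
  exact and_congr h3 (h2.trans h1)

theorem injectiveDimension_eq_one_iff {N : ModuleCat.{u} A} (hP : Module.Injective A P)
    {f : N →ₗ[A] P} (hf : Function.Injective f) :
    injectiveDimension N = 1 ↔
      ¬ Module.Injective A N ∧ Module.Injective A (P ⧸ LinearMap.range f) := by
  have hP : Injective (ModuleCat.of A P) := (Module.injective_iff_injective_object A P).1 hP
  have hS := shortExact_of_injective_surjective hf (LinearMap.range f).mkQ_surjective
    (LinearMap.exact_map_mkQ_range f)
  have h1 := hS.hasInjectiveDimensionLT_X₃_iff 0 hP
  have h2 := injectiveDimension_le_iff N 1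
  have h3 := injectiveDimension_ge_iff N 1
  rw [le_antisymm_iff, and_comm, ← hasInjectiveDimensionLT_one_iff (M := N),
    ← hasInjectiveDimensionLT_one_iff (M := P ⧸ LinearMap.range f)]
  exact and_congr h3 (h2.trans h1.symm)

end Dimension

section GlobalDimension

variable {A : Type u} [Ring A]

theorem hasProjectiveDimensionLT_of_isFiniteLength {n : ℕ}
    (h : ∀ s : SimpleClass A, HasProjectiveDimensionLT s.rep n) (M : Type u) [AddCommGroup M]
    [Module A M] (hM : IsFiniteLength A M) : HasProjectiveDimensionLT (ModuleCat.of A M) n := by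
  induction hM with
  | @of_subsingleton M _ _ _ =>
    have : HasProjectiveDimensionLT (ModuleCat.of A M) 0 :=
      (ModuleCat.isZero_of_subsingleton _).hasProjectiveDimensionLT_zero
    exact hasProjectiveDimensionLT_of_ge _ 0 _ (by omega)
  | @of_simple_quotient M _ _ K _ _ ih =>
    obtain ⟨t, ⟨e⟩⟩ := SimpleClass.exists_equiv_rep (A := A) (M ⧸ K) inferInstance
    have := h t
    have h2 : HasProjectiveDimensionLT (ModuleCat.of A (M ⧸ K)) n :=
      hasProjectiveDimensionLT_of_iso (X := t.rep) e.symm.toModuleIso n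
    exact (shortExact_of_injective_surjective K.injective_subtype K.mkQ_surjective
      (LinearMap.exact_subtype_mkQ K)).hasProjectiveDimensionLT_X₂ n ih h2

open Abelian

/-- Injective dimension is detected on cyclic modules. -/
theorem hasInjectiveDimensionLT_of_cyclic (n : ℕ) (X : ModuleCat.{u} A)
    (h : ∀ (I : Ideal A) (e : Ext (ModuleCat.of A (A ⧸ I)) X (n + 1)), e = 0) :
    HasInjectiveDimensionLT X (n + 1) := by
  induction n generalizing X with
  | zero =>
    rw [zero_add, ← injective_iff_hasInjectiveDimensionLT_one,
      ← Module.injective_iff_injective_object, ← Module.Baer.iff_injective]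
    intro I g
    have hS := shortExact_of_injective_surjective I.injective_subtype I.mkQ_surjective
      (LinearMap.exact_subtype_mkQ I)
    -- The connecting map sends `g` to a class in Ext¹ of A ⧸ I, which vanishes, so `g` extends to
    -- the ring as Baer's criterion asks.
    obtain ⟨y, hy⟩ := Ext.contravariant_sequence_exact₁ hS X
      (Ext.mk₀ (ModuleCat.ofHom g : ModuleCat.of A I ⟶ X)) (add_zero 1) (h I _)
    obtain ⟨y, rfl⟩ := (Ext.mk₀_bijective _ _).2 y
    rw [Ext.mk₀_comp_mk₀] at hy
    have h1 := (Ext.mk₀_bijective _ _).1 hy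
    refine ⟨y.hom, fun x hx => ?_⟩
    exact LinearMap.congr_fun (congrArg ModuleCat.Hom.hom h1) ⟨x, hx⟩
  | succ n ih =>
    obtain ⟨p⟩ := EnoughInjectives.presentation X
    have hS : (ShortComplex.mk _ _ (Limits.cokernel.condition p.f)).ShortExact :=
      { exact := ShortComplex.exact_cokernel p.f }
    rw [← hS.hasInjectiveDimensionLT_X₃_iff n p.injective]
    refine ih _ fun I e => ?_
    obtain ⟨x, rfl⟩ := Ext.covariant_sequence_exact₃ _ hS e rfl (h I _)
    rw [Ext.eq_zero_of_injective x, Ext.zero_comp]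

/-- Finitely many simple modules give a common bound on modules of finite length, in particular on
cyclic ones. Cyclic modules detect injective dimension, so every module obeys the bound, also those
not finitely generated. -/
theorem globalDimension_ne_top [IsArtinianRing A] [Finite (SimpleClass A)]
    (h : ∀ s : SimpleClass A, FinitePd A s.rep) : globalDimension A ≠ ⊤ := by
  choose d hd using h
  obtain ⟨n, hn⟩ := (Set.finite_range d).bddAbove
  have hs : ∀ s : SimpleClass A, HasProjectiveDimensionLT s.rep (n + 1) := fun s => by
    have := hd s
    exact hasProjectiveDimensionLT_of_ge _ (d s) _ ((hn ⟨s, rfl⟩).trans (Nat.le_succ _))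
  have hX : ∀ X : ModuleCat.{u} A, HasInjectiveDimensionLT X (n + 1) := fun X =>
    hasInjectiveDimensionLT_of_cyclic n X fun I e => by
      have := hasProjectiveDimensionLT_of_isFiniteLength hs (A ⧸ I)
        (Module.length_ne_top_iff.1 Module.length_ne_top)
      exact e.eq_zero_of_hasProjectiveDimensionLT (n + 1) le_rfl
  have hM : globalDimension A ≤ (n : WithBot ℕ∞) := iSup_le fun M => by
    rw [projectiveDimension_le_iff]
    refine HasProjectiveDimensionLT.mk fun i hi Y e => ?_
    have := hX Y
    exact e.eq_zero_of_hasInjectiveDimensionLT (n + 1) hi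
  intro htop
  rw [htop, top_le_iff] at hM
  exact absurd (WithBot.coe_eq_coe.1 hM) (ENat.natCast_ne_top n)

end GlobalDimension

/-! ### Absence of simple projective modules. -/

section NoSimpleProjective

variable {A : Type u} [Ring A] [IsSerialArtinian A]

/-- The radical of the module and the syzygy of its simple top both have top `next s`, one step
closer to the simple projective. -/
theorem finitePd_of_coverLength_iterate (k : ℕ) {s : SimpleClass A}
    (h : coverLength (next^[k] s) = 1) {ℓ : ℕ} {M : Type u} [AddCommGroup M] [Module A M]
    (hM : IsChainModule s ℓ M) : FinitePd A M := by
  induction k generalizing s ℓ M with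
  | zero =>
    replace h : coverLength s = 1 := h
    have hle := hM.le_coverLength
    rcases Nat.eq_zero_or_pos ℓ with h0 | h0
    · have := hM.subsingleton_iff.2 h0
      exact FinitePd.of_subsingleton
    · have := (hM.projective_iff (by omega)).2 (by omega)
      exact FinitePd.of_projective
  | succ k ih =>
    rcases ℓ with _ | ℓ
    · have := hM.subsingleton_iff.2 rfl
      exact FinitePd.of_subsingleton
    · obtain ⟨K, hK, hK'⟩ := hM.exists_radical
      obtain ⟨g, hg, hker⟩ := hK'.exists_syzygy
      exact FinitePd.of_submodule_of_quotient K (ih h hK) ((finitePd_ker_iff hg).1 (ih h hker))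

/-- The simple modules from which `next` leads to a simple projective form a set closed in both
directions. If nonempty it contains all simple modules, and then all have finite projective
dimension. -/
theorem coverLength_ne_one (hconn : IsConnected A) (hgl : globalDimension A = ⊤)
    (s : SimpleClass A) : coverLength s ≠ 1 := by
  intro hs
  have huniv := eq_univ_of_next_closed hconn (O := {s | ∃ k, coverLength (next^[k] s) = 1})
    ⟨s, 0, hs⟩ (fun s hs => by
      constructor
      · rintro ⟨_ | k, hk⟩
        · exact absurd hk hs
        · exact ⟨k, hk⟩
      · rintro ⟨k, hk⟩
        exact ⟨k + 1, hk⟩)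
  refine globalDimension_ne_top (fun t => ?_) hgl
  obtain ⟨k, hk⟩ := huniv.ge (Set.mem_univ t)
  exact finitePd_of_coverLength_iterate k hk
    (IsChainModule.of_isSimpleModule (LinearEquiv.refl A t.rep))

end NoSimpleProjective

/-! ### Cyclic numbering of the simple modules; modules as intervals. -/

/-- Connected serial artinian rings of infinite global dimension. -/
class IsCyclicSerial (A : Type u) [Ring A] : Prop extends IsSerialArtinian A where
  connected : IsConnected A
  globalDimension_eq_top : globalDimension A = ⊤

section Cyclic

variable {A : Type u} [Ring A] [hA : IsCyclicSerial A]

theorem two_le_coverLength (s : SimpleClass A) : 2 ≤ coverLength s := by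
  have := coverLength_ne_zero s
  have := coverLength_ne_one hA.connected hA.globalDimension_eq_top s
  omega

theorem next_injective_of_cyclic : Function.Injective (next : SimpleClass A → SimpleClass A) :=
  next_injective fun s => by have := two_le_coverLength s; omega

variable (A) in
/-- The permutation `next` of the simple modules. -/
noncomputable def nextPerm : Equiv.Perm (SimpleClass A) :=
  Equiv.ofBijective next (Finite.injective_iff_bijective.1 next_injective_of_cyclic)

theorem nextPerm_apply (s : SimpleClass A) : nextPerm A s = next s := rfl

variable (A) in
theorem nonempty_simpleClass : Nonempty (SimpleClass A) := by
  have := hA.connected.1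
  obtain ⟨s, -⟩ := exists_isFactor (A := A) A
  exact ⟨s⟩

/-- The simple modules, numbered cyclically by the integers. -/
noncomputable def label (i : ℤ) : SimpleClass A :=
  (nextPerm A ^ i) (nonempty_simpleClass A).some

variable (A) in
/-- The number of simple modules. -/
noncomputable def period : ℕ :=
  Function.minimalPeriod (fun s => nextPerm A • s) (nonempty_simpleClass A).some

theorem label_add_one (i : ℤ) : (label (i + 1) : SimpleClass A) = next (label i) := by
  rw [label, add_comm, zpow_add, zpow_one, Equiv.Perm.mul_apply, nextPerm_apply, label]

theorem label_add_nat (i : ℤ) (m : ℕ) :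
    (label (i + m) : SimpleClass A) = next^[m] (label i) := by
  induction m with
  | zero => simp
  | succ m ih =>
    rw [Function.iterate_succ_apply', ← ih, ← label_add_one]
    congr 1
    push_cast; ring

variable (A) in
theorem period_pos : 0 < period A := by
  apply Function.minimalPeriod_pos_of_mem_periodicPts
  exact (Function.Injective.mem_periodicPts (MulAction.injective (nextPerm A)) _)

theorem label_eq_iff (i j : ℤ) : (label i : SimpleClass A) = label j ↔
    ∃ t : ℤ, i = j + t * (period A : ℤ) := by
  have h : (label i : SimpleClass A) = label j ↔
      nextPerm A ^ (i - j) • (nonempty_simpleClass A).some = (nonempty_simpleClass A).some := by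
    rw [Equiv.Perm.smul_def, sub_eq_neg_add, zpow_add, Equiv.Perm.mul_apply, zpow_neg,
      Equiv.Perm.inv_eq_iff_eq]
    exact Iff.rfl
  rw [h, MulAction.zpow_smul_eq_iff_minimalPeriod_dvd]
  constructor
  · rintro ⟨t, ht⟩
    refine ⟨t, ?_⟩
    rw [period]
    linarith
  · rintro ⟨t, ht⟩
    refine ⟨t, ?_⟩
    rw [period] at ht
    linarith

/-- An orbit of the permutation `next` is closed in both directions, so connectedness leaves a
single orbit. -/
theorem label_surjective : Function.Surjective (label : ℤ → SimpleClass A) := by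
  have := eq_univ_of_next_closed hA.connected (O := Set.range (label : ℤ → SimpleClass A))
    ⟨_, 0, rfl⟩ (fun s _ => by
      constructor
      · rintro ⟨i, rfl⟩
        exact ⟨i + 1, label_add_one i⟩
      · rintro ⟨i, hi⟩
        refine ⟨i - 1, next_injective_of_cyclic ?_⟩
        rw [← label_add_one, sub_add_cancel, hi])
  exact Set.range_eq_univ.1 this

variable (A) in
/-- The end of the projective module beginning at `i`. -/
noncomputable def coverEnd (i : ℤ) : ℤ := i + coverLength (label i : SimpleClass A)

variable (A) in
/-- The beginning of the injective module ending at `b`. -/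
noncomputable def hullStart (b : ℤ) : ℤ := b - hullLength (label (b - 1) : SimpleClass A)

/-- `M` is the uniserial module with composition factors `a, …, b - 1`. -/
def IsInterval (a b : ℤ) (M : Type u) [AddCommGroup M] [Module A M] : Prop :=
  a ≤ b ∧ IsChainModule (label a : SimpleClass A) (b - a).toNat M

variable {M N : Type u} [AddCommGroup M] [Module A M] [AddCommGroup N] [Module A N] {a b : ℤ}

theorem IsInterval.le_coverEnd (h : IsInterval (A := A) a b M) : b ≤ coverEnd A a := by
  have := h.2.le_coverLength
  have := h.1
  rw [coverEnd]
  omega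

theorem IsInterval.subsingleton_iff (h : IsInterval (A := A) a b M) : Subsingleton M ↔ a = b := by
  have := h.1
  rw [h.2.subsingleton_iff]
  omega

theorem isInterval_cover (i : ℤ) :
    IsInterval (A := A) i (coverEnd A i) (cover (label i : SimpleClass A)) := by
  refine ⟨by rw [coverEnd]; omega, ?_⟩
  rw [coverEnd, add_sub_cancel_left, Int.toNat_natCast]
  exact isChainModule_cover _

theorem IsInterval.submodule (h : IsInterval (A := A) a b M) {m : ℤ} (ham : a ≤ m) (hmb : m ≤ b)
    {K : Submodule A M} (hK : Module.length A K = (b - m).toNat) :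
    IsInterval (A := A) m b K ∧ IsInterval (A := A) a m (M ⧸ K) := by
  have h2 := h.2
  rw [show (b - a).toNat = (m - a).toNat + (b - m).toNat by omega] at h2
  obtain ⟨h3, h4⟩ := h2.submodule hK
  rw [← label_add_nat, show a + ((m - a).toNat : ℤ) = m by omega] at h3
  exact ⟨⟨hmb, h3⟩, ham, h4⟩

theorem exists_isInterval (hab : a ≤ b) (hb : b ≤ coverEnd A a) :
    ∃ M : ModuleCat.{u} A, IsInterval (A := A) a b M := by
  obtain ⟨M, hM⟩ := exists_isChainModule_of_le (A := A) (s := label a) (ℓ := (b - a).toNat)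
    (by rw [coverEnd] at hb; omega)
  exact ⟨M, hab, hM⟩

theorem isInterval_hull (b : ℤ) : IsInterval (A := A) (hullStart A b) b
    (hull (label (b - 1) : SimpleClass A)) := by
  refine ⟨by rw [hullStart]; omega, ?_⟩
  have h := isChainModule_hull (label (b - 1) : SimpleClass A)
  have h0 := hullLength_ne_zero (label (b - 1) : SimpleClass A)
  rw [hullStart, sub_sub_cancel, Int.toNat_natCast]
  convert h
  have h1 := next_iterate_hullTop (label (b - 1) : SimpleClass A)
  apply next_injective_of_cyclic.iterate (hullLength (label (b - 1) : SimpleClass A) - 1)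
  rw [h1, ← label_add_nat]
  congr 1
  omega

/-- The empty interval is allowed: the zero module placed at a has the whole cover of a as its
syzygy, so two steps always replace (a, b) by their images under `coverEnd A`. -/
theorem IsInterval.exists_syzygy (h : IsInterval (A := A) a b M) :
    ∃ f : cover (label a : SimpleClass A) →ₗ[A] M, Function.Surjective f ∧
      IsInterval (A := A) b (coverEnd A a) (LinearMap.ker f) := by
  obtain ⟨f, hf, hker⟩ := h.2.exists_syzygy
  have := h.1
  rw [← label_add_nat, show a + ((b - a).toNat : ℤ) = b by omega] at hker
  have hle := h.le_coverEnd
  refine ⟨f, hf, hle, ?_⟩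
  rw [coverEnd] at hle ⊢
  convert hker using 1
  omega

theorem IsInterval.exists_cosyzygy (h : IsInterval (A := A) a b M) (hab : a < b) :
    ∃ f : M →ₗ[A] hull (label (b - 1) : SimpleClass A), Function.Injective f ∧
      IsInterval (A := A) (hullStart A b) a
        (hull (label (b - 1) : SimpleClass A) ⧸ LinearMap.range f) := by
  have h2 := h.2
  rw [show (b - a).toNat = (b - a).toNat - 1 + 1 by omega] at h2
  have hex := h2.exists_injective_hull
  rw [← label_add_nat, show a + (((b - a).toNat - 1 : ℕ) : ℤ) = b - 1 by omega] at hex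
  obtain ⟨f, hf⟩ := hex
  have hH := isInterval_hull (A := A) b
  have hle : hullStart A b ≤ a := by
    have := Module.length_le_of_injective f hf
    rw [hH.2.length, h.2.length] at this
    have h3 : (b - a).toNat ≤ (b - hullStart A b).toNat := by exact_mod_cast this
    have := hH.1
    omega
  refine ⟨f, hf, (hH.submodule hle h.1 ?_).2⟩
  rw [← (LinearEquiv.ofInjective f hf).length_eq, h.2.length]

theorem IsInterval.hullStart_le (h : IsInterval (A := A) a b M) (hab : a < b) :
    hullStart A b ≤ a := by
  obtain ⟨f, -, hf⟩ := h.exists_cosyzygy hab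
  exact hf.1

variable (A) in
theorem coverEnd_mono : Monotone (coverEnd A) := by
  refine monotone_int_of_le_succ fun i => ?_
  have := coverLength_le_coverLength_next (label i : SimpleClass A)
  rw [coverEnd, coverEnd, label_add_one]
  omega

variable (A) in
theorem kupischPair : KupischPair (period A) (coverEnd A) (hullStart A) where
  pos := period_pos A
  gc b i := by
    constructor
    · intro h
      exact (isInterval_hull (A := A) b).le_coverEnd.trans (coverEnd_mono A h)
    · intro h
      -- Here i < b, so [i, b) is a nonzero quotient of the cover of i; it embeds in the injective
      -- ending at b and cannot start before it.
      by_contra! hlt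
      have h1 := (isInterval_hull (A := A) b).1
      obtain ⟨M, hM⟩ := exists_isInterval (A := A) (a := i) (b := b) (by omega) h
      have := hM.hullStart_le (by omega)
      omega
  map_add i := by
    have : (label (i + period A) : SimpleClass A) = label i :=
      (label_eq_iff _ _).2 ⟨1, by ring⟩
    rw [coverEnd, coverEnd, this]; ring
  lt_map i := by
    have := two_le_coverLength (label i : SimpleClass A)
    rw [coverEnd]
    omega

theorem IsInterval.projective_iff (h : IsInterval (A := A) a b M) (hab : a < b) :
    Module.Projective A M ↔ coverEnd A a = b := by
  rw [h.2.projective_iff (by omega), coverEnd]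
  omega

omit hA in
theorem injective_of_equiv (h : Module.Injective A M) (e : M ≃ₗ[A] N) : Module.Injective A N := by
  refine ⟨fun X Y _ _ _ _ j hj g => ?_⟩
  obtain ⟨k, hk⟩ := h.out j hj (e.symm.toLinearMap ∘ₗ g)
  refine ⟨e.toLinearMap ∘ₗ k, fun x => ?_⟩
  have := hk x
  simp [this]

/-- A nonzero injective submodule splits off the envelope, and a uniserial module has no proper
nonzero summand, so the cosyzygy is zero. -/
theorem IsInterval.injective_iff (h : IsInterval (A := A) a b M) (hab : a < b) :
    Module.Injective A M ↔ hullStart A b = a := by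
  obtain ⟨f, hf, hq⟩ := h.exists_cosyzygy hab
  have hinj := (isInjectiveEnvelope_hullIncl (label (b - 1) : SimpleClass A)).injective
  have hH := isInterval_hull (A := A) b
  constructor
  · intro hM
    obtain ⟨r, hr⟩ := hM.out f hf LinearMap.id
    have hnt : ¬ Subsingleton M := by rw [h.subsingleton_iff]; omega
    have hker : LinearMap.ker r ⊓ LinearMap.range f = ⊥ := by
      rw [eq_bot_iff]
      rintro _ ⟨hx, ⟨y, rfl⟩⟩
      have h1 : r (f y) = 0 := hx
      rw [hr] at h1
      simp only [LinearMap.id_apply] at h1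
      simp [h1]
    have hker' : LinearMap.ker r = ⊥ := by
      rcases hH.2.uniserial (LinearMap.ker r) (LinearMap.range f) with h1 | h1
      · rwa [inf_eq_left.2 h1] at hker
      · rw [inf_eq_right.2 h1, LinearMap.range_eq_bot] at hker
        refine absurd ⟨fun x y => hf ?_⟩ hnt
        rw [hker]; rfl
    rw [← hq.subsingleton_iff]
    refine Submodule.Quotient.subsingleton_iff.2 (eq_top_iff.2 fun x _ => ⟨r x, ?_⟩)
    apply LinearMap.ker_eq_bot.1 hker'
    exact hr (r x)
  · intro heq
    have := hq.subsingleton_iff.2 heq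
    rw [Submodule.Quotient.subsingleton_iff, LinearMap.range_eq_top] at this
    exact injective_of_equiv hinj (LinearEquiv.ofBijective f ⟨hf, this⟩).symm

theorem IsInterval.finitePd_of_iterate (m : ℕ) (h : IsInterval (A := A) a b M)
    (hm : (coverEnd A)^[m] a = (coverEnd A)^[m] b ∨ (coverEnd A)^[m] b = (coverEnd A)^[m + 1] a) :
    FinitePd A M := by
  induction m generalizing a b M with
  | zero =>
    by_cases hab : a = b
    · have := h.subsingleton_iff.2 hab
      exact FinitePd.of_subsingleton
    · have hab' := lt_of_le_of_ne h.1 hab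
      have := (h.projective_iff hab').2 (hm.resolve_left hab).symm
      exact FinitePd.of_projective
  | succ m ih =>
    obtain ⟨f, hf, hK⟩ := h.exists_syzygy
    obtain ⟨g, hg, hL⟩ := hK.exists_syzygy
    rw [← finitePd_ker_iff hf, ← finitePd_ker_iff hg]
    exact ih hL (by simpa only [Function.iterate_succ_apply] using hm)

theorem IsInterval.terminates_of_hasProjectiveDimensionLT (n : ℕ) (h : IsInterval (A := A) a b M)
    (hn : HasProjectiveDimensionLT (ModuleCat.of A M) (n + 1)) :
    SyzygyTerminates (coverEnd A) a b := by
  induction n generalizing a b M with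
  | zero =>
    by_cases hab : a = b
    · exact ⟨0, Or.inl hab⟩
    · exact ⟨0, Or.inr ((h.projective_iff (lt_of_le_of_ne h.1 hab)).1
        (hasProjectiveDimensionLT_one_iff.1 hn)).symm⟩
  | succ n ih =>
    obtain ⟨f, hf, hK⟩ := h.exists_syzygy
    have hP : Projective (ModuleCat.of A (cover (label a : SimpleClass A))) :=
      (IsProjective.iff_projective _).1 inferInstance
    have hS := shortExact_of_injective_surjective (LinearMap.ker f).injective_subtype hf
      (LinearMap.exact_subtype_ker_map f)
    -- A single syzygy turns (a, b) into (b, coverEnd a), which exchanges the two alternatives: zero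
    -- or projective.
    obtain ⟨m, hm | hm⟩ := ih hK ((hS.hasProjectiveDimensionLT_X₃_iff n hP).1 hn)
    · exact ⟨m, Or.inr hm⟩
    · exact ⟨m + 1, Or.inl hm⟩

theorem IsInterval.finitePd_iff (h : IsInterval (A := A) a b M) :
    FinitePd A M ↔ SyzygyTerminates (coverEnd A) a b := by
  constructor
  · rintro ⟨n, hn⟩
    exact h.terminates_of_hasProjectiveDimensionLT n (hasProjectiveDimensionLT_of_ge _ n _ (by omega))
  · rintro ⟨m, hm⟩
    exact h.finitePd_of_iterate m hm

theorem IsInterval.finiteId_of_iterate (m : ℕ) (h : IsInterval (A := A) a b M)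
    (hm : (hullStart A)^[m] a = (hullStart A)^[m] b ∨
      (hullStart A)^[m] a = (hullStart A)^[m + 1] b) : FiniteId A M := by
  have hsub : ∀ {a b : ℤ} {M : Type u} [AddCommGroup M] [Module A M],
      IsInterval (A := A) a b M → a = b → FiniteId A M := by
    intro a b M _ _ h hab
    have := h.subsingleton_iff.2 hab
    exact FiniteId.of_injective
      ⟨fun X Y _ _ _ _ j hj g => ⟨0, fun x => Subsingleton.elim _ _⟩⟩
  induction m generalizing a b M with
  | zero =>
    by_cases hab : a = b
    · exact hsub h hab
    · exact FiniteId.of_injective ((h.injective_iff (lt_of_le_of_ne h.1 hab)).2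
        (hm.resolve_left hab).symm)
  | succ m ih =>
    by_cases hab : a = b
    · exact hsub h hab
    obtain ⟨f, hf, hK⟩ := h.exists_cosyzygy (lt_of_le_of_ne h.1 hab)
    rw [← finiteId_quotient_iff (isInjectiveEnvelope_hullIncl _).injective hf]
    by_cases hab' : hullStart A b = a
    · exact hsub hK hab'
    obtain ⟨g, hg, hL⟩ := hK.exists_cosyzygy (lt_of_le_of_ne hK.1 hab')
    rw [← finiteId_quotient_iff (isInjectiveEnvelope_hullIncl _).injective hg]
    exact ih hL (by simpa only [Function.iterate_succ_apply] using hm)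

theorem IsInterval.cosyzygyTerminates_of_hasInjectiveDimensionLT (n : ℕ)
    (h : IsInterval (A := A) a b M) (hn : HasInjectiveDimensionLT (ModuleCat.of A M) (n + 1)) :
    CosyzygyTerminates (hullStart A) a b := by
  induction n generalizing a b M with
  | zero =>
    by_cases hab : a = b
    · exact ⟨0, Or.inl hab⟩
    · exact ⟨0, Or.inr ((h.injective_iff (lt_of_le_of_ne h.1 hab)).1
        (hasInjectiveDimensionLT_one_iff.1 hn)).symm⟩
  | succ n ih =>
    by_cases hab : a = b
    · exact ⟨0, Or.inl hab⟩
    obtain ⟨f, hf, hK⟩ := h.exists_cosyzygy (lt_of_le_of_ne h.1 hab)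
    have hP : Injective (ModuleCat.of A (hull (label (b - 1) : SimpleClass A))) :=
      (Module.injective_iff_injective_object A _).1 (isInjectiveEnvelope_hullIncl _).injective
    have hS := shortExact_of_injective_surjective hf (LinearMap.range f).mkQ_surjective
      (LinearMap.exact_map_mkQ_range f)
    obtain ⟨m, hm | hm⟩ := ih hK ((hS.hasInjectiveDimensionLT_X₃_iff n hP).2 hn)
    · exact ⟨m, Or.inr hm.symm⟩
    · exact ⟨m + 1, Or.inl hm.symm⟩

theorem IsInterval.finiteId_iff (h : IsInterval (A := A) a b M) :
    FiniteId A M ↔ CosyzygyTerminates (hullStart A) a b := by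
  constructor
  · rintro ⟨n, hn⟩
    exact h.cosyzygyTerminates_of_hasInjectiveDimensionLT n
      (hasInjectiveDimensionLT_of_ge _ n _ (by omega))
  · rintro ⟨m, hm⟩
    exact h.finiteId_of_iterate m hm

theorem isInterval_rep (i : ℤ) : IsInterval (A := A) i (i + 1) (label i : SimpleClass A).rep := by
  refine ⟨by omega, ?_⟩
  rw [add_sub_cancel_left]
  exact IsChainModule.of_isSimpleModule (LinearEquiv.refl A _)

variable (A) in
theorem exists_not_syzygyTerminates : ∃ i, ¬ SyzygyTerminates (coverEnd A) i (i + 1) := by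
  by_contra! hcon
  refine globalDimension_ne_top (fun s => ?_) hA.globalDimension_eq_top
  obtain ⟨i, rfl⟩ := label_surjective s
  exact (isInterval_rep i).finitePd_iff.2 (hcon i)

omit hA in
theorem SimpleClass.projDim_eq (s : SimpleClass A) : s.projDim = projectiveDimension s.rep := by
  conv_lhs => rw [← s.mk_rep]
  rfl

omit hA in
theorem SimpleClass.injDim_eq (s : SimpleClass A) : s.injDim = injectiveDimension s.rep := by
  conv_lhs => rw [← s.mk_rep]
  rfl

/-- With f = `coverEnd A`, the syzygy of the simple i is the nonempty interval [i + 1, f i),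
projective exactly when f (i + 1) = f i; the simple itself is never projective. -/
theorem isGammaBlack_label_iff (i : ℤ) :
    IsGammaBlack (label i : SimpleClass A) ↔ coverEnd A i ≠ coverEnd A (i + 1) := by
  rw [IsGammaBlack, SimpleClass.projDim_eq, Ne]
  have h := isInterval_rep (A := A) i
  obtain ⟨f, hf, hK⟩ := h.exists_syzygy
  have hlt := (kupischPair A).lt_map i
  rw [projectiveDimension_eq_one_iff hf, hK.projective_iff hlt, h.projective_iff (by omega),
    eq_comm (a := coverEnd A (i + 1))]
  simp [hlt.ne']

/-- With k = `hullStart A`, the cosyzygy is [k (j + 1), j), nonempty, and injective exactly when k j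
= k (j + 1). -/
theorem isPsiBlack_label_iff (j : ℤ) :
    IsPsiBlack (label j : SimpleClass A) ↔ hullStart A j ≠ hullStart A (j + 1) := by
  rw [IsPsiBlack, SimpleClass.injDim_eq, Ne]
  have h := isInterval_rep (A := A) j
  obtain ⟨f, hf, hK⟩ := h.exists_cosyzygy (by omega)
  have hlt : hullStart A (j + 1) ≤ j - 1 := by
    rw [(kupischPair A).gc]
    have := (kupischPair A).lt_map (j - 1)
    omega
  rw [injectiveDimension_eq_one_iff (isInjectiveEnvelope_hullIncl _).injective hf,
    hK.injective_iff (by omega), h.injective_iff (by omega)]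
  have : hullStart A (j + 1) ≠ j := by omega
  simp [this]

end Cyclic

/-! ### Reduction of the regular module and its dual to covers and hulls. -/

section Decomposition

variable {A : Type u} [Ring A] [IsSerialArtinian A]

theorem length_lt_of_add {x y : ℕ∞} {m : ℕ} (h : (m : ℕ∞) = x + y) (hy : y ≠ 0) :
    ∃ k : ℕ, x = k ∧ k < m := by
  have hx : x ≠ ⊤ := fun h1 => ENat.natCast_ne_top m (by rw [h, h1, top_add])
  have hy' : y ≠ ⊤ := fun h1 => ENat.natCast_ne_top m (by rw [h, h1, add_top])
  obtain ⟨k, rfl⟩ := ENat.ne_top_iff_exists.1 hx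
  obtain ⟨l, rfl⟩ := ENat.ne_top_iff_exists.1 hy'
  refine ⟨k, rfl, ?_⟩
  have h1 : m = k + l := by exact_mod_cast h
  have h2 : l ≠ 0 := by exact_mod_cast hy
  omega

/-- Finitely generated projective modules are built from the modules `cover s`. -/
theorem projective_induction {motive : ∀ (Q : Type u) [AddCommGroup Q] [Module A Q], Prop}
    (zero : ∀ (Q : Type u) [AddCommGroup Q] [Module A Q], Subsingleton Q → motive Q)
    (step : ∀ (Q : Type u) [AddCommGroup Q] [Module A Q] (s : SimpleClass A)
      (g : Q →ₗ[A] cover s) (σ : cover s →ₗ[A] Q), g ∘ₗ σ = LinearMap.id →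
        motive (LinearMap.ker g) → motive Q)
    (Q : Type u) [AddCommGroup Q] [Module A Q] [Module.Finite A Q] [Module.Projective A Q] :
    motive Q := by
  obtain ⟨m, hm⟩ := ENat.ne_top_iff_exists.1 (Module.length_ne_top (R := A) (M := Q))
  induction m using Nat.strong_induction_on generalizing Q with
  | _ m ih =>
  by_cases hQ : Subsingleton Q
  · exact zero Q hQ
  have hQ' : Nontrivial Q := not_subsingleton_iff_nontrivial.1 hQ
  obtain ⟨s, p, hp, -⟩ := exists_surjective_rep Q (K := (⊥ : Submodule A Q)) bot_ne_top
  obtain ⟨g, hg⟩ := (isChainModule_cover s).exists_surjective_of_projective hp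
  obtain ⟨σ, hσ⟩ := Module.projective_lifting_property g LinearMap.id hg
  have hmem : ∀ x, (LinearMap.id - σ ∘ₗ g : Q →ₗ[A] Q) x ∈ LinearMap.ker g := fun x => by
    have := LinearMap.congr_fun hσ (g x)
    simp only [LinearMap.comp_apply, LinearMap.id_apply] at this
    simp [this]
  have : Module.Projective A (LinearMap.ker g) :=
    Module.Projective.of_split (LinearMap.ker g).subtype
      ((LinearMap.id - σ ∘ₗ g : Q →ₗ[A] Q).codRestrict _ hmem) (by
        ext x
        have : g x = 0 := x.2
        simp [this])
  have hlen := length_ker_add hg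
  rw [← hm] at hlen
  have hc := isChainModule_cover s
  obtain ⟨k, hk, hlt⟩ := length_lt_of_add hlen
    (by rw [hc.length]; exact_mod_cast coverLength_ne_zero s)
  exact step Q s g σ hσ (ih k hlt _ hk.symm)

theorem finiteId_self_iff : FiniteId A A ↔ ∀ s : SimpleClass A, FiniteId A (cover s) := by
  constructor
  · intro h s
    obtain ⟨p, hp⟩ := exists_cover_surjective s
    have hne : Nontrivial s.rep := IsSimpleModule.nontrivial A _
    obtain ⟨y, hy⟩ := exists_ne (0 : s.rep)
    obtain ⟨x, rfl⟩ := hp y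
    have hsurj : Function.Surjective (LinearMap.toSpanSingleton A (cover s) x) := by
      apply (isChainModule_cover s).surjective_of_comp (p := p)
      refine LinearMap.surjective_of_ne_zero fun h0 => hy ?_
      simpa using LinearMap.congr_fun h0 1
    obtain ⟨σ, hσ⟩ := Module.projective_lifting_property _ LinearMap.id hsurj
    exact h.of_retract σ _ hσ
  · intro h
    refine projective_induction (motive := fun (Q : Type u) [AddCommGroup Q] [Module A Q] => FiniteId A Q) ?_ ?_ A
    · intro Q _ _ hQ
      exact FiniteId.of_injective
        ⟨fun X Y _ _ _ _ j hj g => ⟨0, fun x => Subsingleton.elim _ _⟩⟩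
    · intro Q _ _ s g σ hσ hker
      have hg : Function.Surjective g := fun y => ⟨σ y, LinearMap.congr_fun hσ y⟩
      exact FiniteId.of_exact (LinearMap.ker g).injective_subtype hg
        (LinearMap.exact_subtype_ker_map g) hker (h s)

variable {E : Type u} [AddCommGroup E] [Module A E]

omit [IsSerialArtinian A] in
theorem exists_injective_of_hull {I : Type u} [AddCommGroup I] [Module A I] {M : Type u}
    [AddCommGroup M] [Module A M] {i : M →ₗ[A] I} (hi : IsInjectiveEnvelope i)
    (hE : Module.Injective A E) {j : M →ₗ[A] E} (hj : Function.Injective j) :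
    ∃ f : I →ₗ[A] E, Function.Injective f ∧ f ∘ₗ i = j := by
  obtain ⟨f, hf⟩ := hE.out i hi.mono j
  refine ⟨f, ?_, LinearMap.ext hf⟩
  rw [← LinearMap.ker_eq_bot]
  apply hi.essential
  rw [eq_bot_iff]
  rintro _ ⟨hx, ⟨y, rfl⟩⟩
  have h1 : f (i y) = 0 := hx
  rw [hf] at h1
  have : y = 0 := hj (by rw [h1, map_zero])
  simp [this]

theorem finitePd_of_injective (h : ∀ s : SimpleClass A, FinitePd A (hull s))
    [Module.Finite A E] (hE : Module.Injective A E) : FinitePd A E := by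
  obtain ⟨m, hm⟩ := ENat.ne_top_iff_exists.1 (Module.length_ne_top (R := A) (M := E))
  induction m using Nat.strong_induction_on generalizing E with
  | _ m ih =>
  by_cases hE' : Subsingleton E
  · exact FinitePd.of_subsingleton
  have hnt : Nontrivial E := not_subsingleton_iff_nontrivial.1 hE'
  obtain ⟨K, hK, -⟩ := (eq_bot_or_exists_atom_le (⊤ : Submodule A E)).resolve_left top_ne_bot
  obtain ⟨s, ⟨e⟩⟩ := SimpleClass.exists_equiv_rep K (isSimpleModule_iff_isAtom.2 hK)
  obtain ⟨f, hf, -⟩ := exists_injective_of_hull (isInjectiveEnvelope_hullIncl s) hE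
    (j := K.subtype ∘ₗ e.symm.toLinearMap) (K.injective_subtype.comp e.symm.injective)
  obtain ⟨r, hr⟩ := (isInjectiveEnvelope_hullIncl s).injective.out f hf LinearMap.id
  have hle : LinearMap.range f ≤ LinearMap.ker (LinearMap.id - f ∘ₗ r) := by
    rintro _ ⟨x, rfl⟩
    have := hr x
    simp only [LinearMap.id_apply] at this
    simp [this]
  -- The retraction `r` makes the quotient a direct summand of E, with section induced by `id - f ∘ₗ
  -- r`.
  have hQ : Module.Injective A (E ⧸ LinearMap.range f) := by
    refine ⟨fun X Y _ _ _ _ j hj g => ?_⟩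
    obtain ⟨k, hk⟩ := hE.out j hj ((LinearMap.range f).liftQ _ hle ∘ₗ g)
    refine ⟨(LinearMap.range f).mkQ ∘ₗ k, fun x => ?_⟩
    rw [LinearMap.comp_apply, hk, LinearMap.comp_apply]
    obtain ⟨y, hy⟩ := (LinearMap.range f).mkQ_surjective (g x)
    rw [← hy]
    change (LinearMap.range f).mkQ (y - f (r y)) = (LinearMap.range f).mkQ y
    simp
  have hlen := length_submodule_add_quotient (LinearMap.range f)
  rw [← hm, add_comm, ← (LinearEquiv.ofInjective f hf).length_eq] at hlen
  obtain ⟨k, hk, hlt⟩ := length_lt_of_add hlen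
    (by rw [(isChainModule_hull s).length]; exact_mod_cast hullLength_ne_zero s)
  exact FinitePd.of_exact hf (LinearMap.range f).mkQ_surjective (LinearMap.exact_map_mkQ_range f)
    (h s) (ih k hlt hQ hk.symm)

theorem finitePd_injective_iff [Module.Finite A E] (hE : Module.Injective A E)
    (hcog : ∀ s : SimpleClass A, ∃ j : s.rep →ₗ[A] E, Function.Injective j) :
    FinitePd A E ↔ ∀ s : SimpleClass A, FinitePd A (hull s) := by
  refine ⟨fun h s => ?_, fun h => finitePd_of_injective h hE⟩
  obtain ⟨j, hj⟩ := hcog s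
  have henv := isInjectiveEnvelope_hullIncl s
  obtain ⟨f, hf, -⟩ := exists_injective_of_hull henv hE hj
  obtain ⟨r, hr⟩ := henv.injective.out f hf LinearMap.id
  exact h.of_retract f r (LinearMap.ext hr)

end Decomposition

/-! ### Uniqueness of covers and envelopes; socles and tops. -/

section CoverEnvelope

variable {A : Type u} [Ring A] [IsSerialArtinian A]
  {M N P I : Type u} [AddCommGroup M] [Module A M] [AddCommGroup N] [Module A N]
  [AddCommGroup P] [Module A P] [AddCommGroup I] [Module A I]
  {s t : SimpleClass A} {ℓ : ℕ}

theorem IsChainModule.of_isProjectiveCover (h : IsChainModule s ℓ M) (h0 : ℓ ≠ 0)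
    {p : P →ₗ[A] M} (hp : IsProjectiveCover p) : IsChainModule s (coverLength s) P := by
  obtain ⟨q, hq⟩ := h.exists_cover_surjective
  obtain ⟨g, hg⟩ := (have := hp.projective; Module.projective_lifting_property p q hp.surjective)
  have hsurj : Function.Surjective g := by
    rw [← LinearMap.range_eq_top]
    refine hp.superfluous _ (eq_top_iff.2 fun x _ => ?_)
    obtain ⟨y, hy⟩ := hq (p x)
    rw [← hg, LinearMap.comp_apply] at hy
    rw [← add_sub_cancel (g y) x]
    exact Submodule.add_mem_sup ⟨y, rfl⟩ (by simp [hy])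
  obtain ⟨t, ht⟩ := h.top h0
  have := hp.projective
  obtain ⟨k, hk⟩ := (isChainModule_cover s).exists_surjective_of_projective (p := t ∘ₗ p)
    (ht.comp hp.surjective)
  refine (isChainModule_cover s).of_surjective hsurj (le_antisymm ?_ ?_)
  · rw [← (isChainModule_cover s).length]
    exact Module.length_le_of_surjective g hsurj
  · rw [← (isChainModule_cover s).length]
    exact Module.length_le_of_surjective k hk

omit [IsSerialArtinian A] in
theorem IsChainModule.isProjectiveCover (h : IsChainModule s ℓ P) [Module.Projective A P]
    [Nontrivial M] {p : P →ₗ[A] M} (hp : Function.Surjective p) : IsProjectiveCover p where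
  projective := inferInstance
  surjective := hp
  superfluous K hK := by
    rcases h.uniserial K (LinearMap.ker p) with h1 | h1
    · rw [sup_eq_right.2 h1, LinearMap.ker_eq_top] at hK
      obtain ⟨y, hy⟩ := exists_ne (0 : M)
      obtain ⟨x, rfl⟩ := hp y
      exact absurd (by rw [hK]; rfl) hy
    · rwa [sup_eq_left.2 h1] at hK

theorem IsChainModule.exists_isProjectiveCover (h : IsChainModule s ℓ M) (h0 : ℓ ≠ 0) :
    ∃ (P : ModuleCat.{u} A) (p : P →ₗ[A] M), IsProjectiveCover p := by
  obtain ⟨f, hf⟩ := h.exists_cover_surjective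
  have := h.nontrivial h0
  exact ⟨cover s, f, (isChainModule_cover s).isProjectiveCover hf⟩

theorem isChainModule_of_isInjectiveEnvelope (e : M ≃ₗ[A] s.rep) {i : M →ₗ[A] I}
    (hi : IsInjectiveEnvelope i) : IsChainModule (hullTop s) (hullLength s) I := by
  have henv := isInjectiveEnvelope_hullIncl s
  obtain ⟨f, hf, -⟩ := exists_injective_of_hull hi henv.injective
    (j := hullIncl s ∘ₗ e.toLinearMap) (henv.mono.comp e.injective)
  obtain ⟨g, hg, -⟩ := exists_injective_of_hull henv hi.injective
    (j := i ∘ₗ e.symm.toLinearMap) (hi.mono.comp e.symm.injective)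
  have hH := isChainModule_hull s
  have := hH.isNoetherian
  have := hH.isArtinian
  have hr : LinearMap.range f = ⊤ := by
    refine eq_of_le_of_length_le le_top ?_
    rw [Module.length_top, ← (LinearEquiv.ofInjective f hf).length_eq]
    exact Module.length_le_of_injective g hg
  exact hH.congr (LinearEquiv.ofBijective f ⟨hf, LinearMap.range_eq_top.1 hr⟩).symm

theorem IsChainModule.nonempty_socle_equiv {i : ℕ} (h : IsChainModule s (i + 1) M) :
    Nonempty (socle A M ≃ₗ[A] (next^[i] s).rep) := by
  have := h.isNoetherian
  have := h.isArtinian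
  obtain ⟨K, hK, -⟩ := h.exists_submodule
  have heq : socle A M = K := by
    apply le_antisymm
    · refine sSup_le fun L hL => ?_
      have hL' : IsSimpleModule A L := hL
      rw [h.uniserial.eq_of_length_eq (K := L) (L := K)]
      rw [hK.length, Module.length_eq_one A L, Nat.cast_one]
    · refine le_sSup ?_
      obtain ⟨e⟩ := hK.exists_equiv_rep
      exact IsSimpleModule.congr e
  rw [heq]
  exact hK.exists_equiv_rep

omit [IsSerialArtinian A] in
theorem IsChainModule.nonempty_top_equiv (h : IsChainModule s ℓ M) (h0 : ℓ ≠ 0) :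
    Nonempty (Nakayama.top A M ≃ₗ[A] s.rep) := by
  obtain ⟨p, hp⟩ := h.top h0
  have hco := LinearMap.isCoatom_ker_of_surjective hp
  have heq : Module.jacobson A M = LinearMap.ker p := by
    apply le_antisymm
    · exact sInf_le hco
    · exact le_sInf fun L hL => h.uniserial.le_of_isCoatom hL hco.1
  exact ⟨(Submodule.quotEquivOfEq _ _ heq).trans (LinearMap.quotKerEquivOfSurjective p hp)⟩

end CoverEnvelope

/-! ### Matlis duality over the commutative artinian base ring. -/

section Matlis

variable (R : Type u) [CommRing R] [IsArtinianRing R]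

omit [IsArtinianRing R] in
theorem exists_isInjectiveEnvelope_dualizingModule :
    ∃ i : (R ⧸ Ring.jacobson R) →ₗ[R] dualizingModule R, IsInjectiveEnvelope i :=
  (exists_injectiveEnvelope R (R ⧸ Ring.jacobson R)).choose_spec

omit [IsArtinianRing R] in
theorem injective_dualizingModule : Module.Injective R (dualizingModule R) :=
  (exists_isInjectiveEnvelope_dualizingModule R).choose_spec.injective

instance isSemisimpleModule_quotient_jacobson :
    IsSemisimpleModule R (R ⧸ Ring.jacobson R) := by
  rw [IsArtinian.isSemisimpleModule_iff_jacobson]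
  exact Module.jacobson_quotient_jacobson R R

variable {R} {M : Type u} [AddCommGroup M] [Module R M]

/-- The maps from a simple module to the dualizing module form a module of length at most one. -/
theorem exists_smul_eq_of_isSimpleModule [IsSimpleModule R M] {φ : M →ₗ[R] dualizingModule R}
    (hφ : φ ≠ 0) (ψ : M →ₗ[R] dualizingModule R) : ∃ r : R, ψ = r • φ := by
  obtain ⟨i, hi⟩ := exists_isInjectiveEnvelope_dualizingModule R
  -- A simple submodule meets the essential submodule R ⧸ rad R, hence lies in it; the question
  -- moves to the semisimple module R ⧸ rad R, whose endomorphisms are multiplications.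
  have hrange : ∀ χ : M →ₗ[R] dualizingModule R, LinearMap.range χ ≤ LinearMap.range i := by
    intro χ
    by_cases h0 : χ = 0
    · rw [h0, LinearMap.range_zero]; exact bot_le
    have e := LinearEquiv.ofInjective χ (LinearMap.injective_of_ne_zero h0)
    have hat : IsAtom (LinearMap.range χ) :=
      isSimpleModule_iff_isAtom.1 (IsSimpleModule.congr e.symm)
    rcases hat.le_iff.1 (inf_le_left : LinearMap.range χ ⊓ LinearMap.range i ≤ _) with h | h
    · exact absurd (hi.essential _ h) hat.1
    · exact inf_eq_left.1 h
  have hlift : ∀ χ : M →ₗ[R] dualizingModule R, ∃ χ' : M →ₗ[R] R ⧸ Ring.jacobson R,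
      i ∘ₗ χ' = χ := by
    intro χ
    refine ⟨(LinearEquiv.ofInjective i hi.mono).symm.toLinearMap ∘ₗ
      χ.codRestrict _ (fun x => hrange χ ⟨x, rfl⟩), LinearMap.ext fun x => ?_⟩
    have := LinearEquiv.ofInjective_symm_apply (h := hi.mono) i
      (⟨χ x, hrange χ ⟨x, rfl⟩⟩ : LinearMap.range i)
    exact this
  obtain ⟨φ', rfl⟩ := hlift φ
  obtain ⟨ψ', rfl⟩ := hlift ψ
  have hφ' : φ' ≠ 0 := fun h => hφ (by rw [h, LinearMap.comp_zero])
  obtain ⟨h, hh⟩ := IsSemisimpleModule.extension_property φ'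
    (LinearMap.injective_of_ne_zero hφ') ψ'
  obtain ⟨r, hr⟩ := Ideal.Quotient.mk_surjective (h 1)
  refine ⟨r, LinearMap.ext fun x => ?_⟩
  have h1 : ∀ y : R ⧸ Ring.jacobson R, h y = r • y := by
    intro y
    obtain ⟨a, rfl⟩ := Ideal.Quotient.mk_surjective y
    have h2 : Ideal.Quotient.mk (Ring.jacobson R) a = a • (1 : R ⧸ Ring.jacobson R) := by
      rw [Algebra.smul_def, mul_one]; rfl
    rw [h2, map_smul, ← hr, smul_comm]
    congr 1
    rw [Algebra.smul_def, mul_one]; rfl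
  rw [← hh]
  simp only [LinearMap.comp_apply, LinearMap.smul_apply, h1, map_smul]

/-- By left exactness of Hom, each simple factor adds at most one. The inequality suffices below,
where it is applied twice in succession. -/
theorem length_hom_dualizingModule_le (hM : IsFiniteLength R M) :
    Module.length R (M →ₗ[R] dualizingModule R) ≤ Module.length R M := by
  induction hM with
  | @of_subsingleton M _ _ _ =>
    rw [Module.length_eq_zero_iff.2 (inferInstance : Subsingleton (M →ₗ[R] dualizingModule R))]
    exact zero_le
  | @of_simple_quotient M _ _ K _ _ ih =>
    set res : (M →ₗ[R] dualizingModule R) →ₗ[R] (K →ₗ[R] dualizingModule R) :=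
      LinearMap.lcomp R _ K.subtype with hres
    have h1 := length_ker_add (LinearMap.surjective_rangeRestrict res)
    rw [LinearMap.ker_rangeRestrict] at h1
    have h2 : Module.length R (LinearMap.range res) ≤ Module.length R K :=
      (Module.length_le_of_injective _ (Submodule.injective_subtype _)).trans ih
    have h3 : Module.length R (LinearMap.ker res) ≤ 1 := by
      have hlift : ∀ φ : LinearMap.ker res, K ≤ LinearMap.ker φ.1 := fun φ x hx =>
        LinearMap.congr_fun φ.2 ⟨x, hx⟩
      by_cases hsub : Subsingleton (LinearMap.ker res)
      · rw [Module.length_eq_zero_iff.2 hsub]; exact zero_le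
      have hnt := not_subsingleton_iff_nontrivial.1 hsub
      rw [Module.length_eq_one_iff.2]
      rw [isSimpleModule_iff_toSpanSingleton_surjective]
      refine ⟨hnt, fun φ hφ ψ => ?_⟩
      obtain ⟨r, hr⟩ := exists_smul_eq_of_isSimpleModule (M := M ⧸ K)
        (φ := K.liftQ φ.1 (hlift φ)) (fun h0 => hφ (Subtype.ext (LinearMap.ext fun x =>
          LinearMap.congr_fun h0 (Submodule.Quotient.mk x)))) (K.liftQ ψ.1 (hlift ψ))
      refine ⟨r, Subtype.ext (LinearMap.ext fun x => ?_)⟩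
      exact (LinearMap.congr_fun hr (Submodule.Quotient.mk x)).symm
    have h4 := length_submodule_add_quotient K
    rw [Module.length_eq_one R (M ⧸ K)] at h4
    rw [h1, h4, add_comm]
    exact add_le_add h2 h3

/-- The dualizing module is a cogenerator. -/
theorem exists_hom_dualizingModule_ne_zero {x : M} (hx : x ≠ 0) :
    ∃ φ : M →ₗ[R] dualizingModule R, φ x ≠ 0 := by
  obtain ⟨i, hi⟩ := exists_isInjectiveEnvelope_dualizingModule R
  have hnt : Nontrivial (R ∙ x) := by
    rw [Submodule.nontrivial_iff_ne_bot, Ne, Submodule.span_singleton_eq_bot]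
    exact hx
  obtain ⟨L, hL, -⟩ := (eq_top_or_exists_le_coatom (⊥ : Submodule R (R ∙ x))).resolve_left
    bot_ne_top
  have hsimple : IsSimpleModule R ((R ∙ x) ⧸ L) := isSimpleModule_iff_isCoatom.2 hL
  obtain ⟨m, hm, ⟨e⟩⟩ := isSimpleModule_iff_quot_maximal.1 hsimple
  have hle : Ring.jacobson R ≤ m := Ring.jacobson_le_of_isMaximal m
  set q : (R ⧸ Ring.jacobson R) →ₗ[R] (R ⧸ m) := Submodule.factor hle with hq
  have hqs : Function.Surjective q := Submodule.factor_surjective hle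
  -- The simple quotient R ⧸ m of R x is a summand of the semisimple R ⧸ rad R, hence embeds in the
  -- dualizing module; injectivity extends the resulting map from R x.
  obtain ⟨σ, hσ⟩ := IsSemisimpleModule.lifting_property q hqs LinearMap.id
  obtain ⟨φ, hφ⟩ := hi.injective.out (R ∙ x).subtype (Submodule.injective_subtype _)
    (i ∘ₗ σ ∘ₗ e.toLinearMap ∘ₗ L.mkQ)
  refine ⟨φ, fun h0 => ?_⟩
  set x' : (R ∙ x) := ⟨x, Submodule.mem_span_singleton_self x⟩
  have h1 := hφ x'
  rw [show φ ((R ∙ x).subtype x') = 0 from h0] at h1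
  have h2 : σ (e (L.mkQ x')) = 0 := hi.mono (by rw [map_zero]; exact h1.symm)
  have h3 : e (L.mkQ x') = 0 := by
    rw [← LinearMap.id_apply (R := R) (e (L.mkQ x')), ← hσ, LinearMap.comp_apply, h2, map_zero]
  have h4 : L.mkQ x' = 0 := e.injective (by rw [h3, map_zero])
  have h5 : x' ∈ L := by simpa using h4
  apply hL.1
  rw [eq_top_iff]
  rintro ⟨y, hy⟩ -
  obtain ⟨a, rfl⟩ := Submodule.mem_span_singleton.1 hy
  exact L.smul_mem a h5

end Matlis

section DualModule

variable (R A : Type u) [CommRing R] [Ring A] [Algebra R A]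

noncomputable instance Dual.moduleBase (N : Type u) [AddCommGroup N] [Module R N] :
    Module R (Dual R N) :=
  inferInstanceAs (Module R (N →ₗ[R] dualizingModule R))

variable {R A} {N : Type u} [AddCommGroup N] [Module R N]

/-- An element of the dual as a linear map. -/
def Dual.toHom (φ : Dual R N) : N →ₗ[R] dualizingModule R := φ

theorem Dual.ext {φ ψ : Dual R N} (h : ∀ x, φ.toHom x = ψ.toHom x) : φ = ψ := LinearMap.ext h

variable [Module Aᵐᵒᵖ N] [SMulCommClass Aᵐᵒᵖ R N]

omit [Algebra R A] in
theorem Dual.smul_toHom_apply (a : A) (φ : Dual R N) (x : N) :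
    (a • φ).toHom x = φ.toHom (MulOpposite.op a • x) := rfl

theorem Dual.isScalarTower [IsScalarTower R Aᵐᵒᵖ N] : IsScalarTower R A (Dual R N) where
  smul_assoc r a φ := Dual.ext fun x => by
    rw [Dual.smul_toHom_apply, MulOpposite.op_smul, smul_assoc]
    exact φ.toHom.map_smul r _

variable [IsArtinianRing R]

theorem Dual.length_le [Module.Finite R N] : Module.length R (Dual R N) ≤ Module.length R N :=
  length_hom_dualizingModule_le (Module.length_ne_top_iff.1 Module.length_ne_top)

theorem Dual.isFiniteLength [Module.Finite R N] : IsFiniteLength R (Dual R N) := by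
  rw [← Module.length_ne_top_iff]
  exact ne_top_of_le_ne_top Module.length_ne_top (Dual.length_le (R := R) (N := N))

theorem Dual.finite [Module.Finite R N] [IsScalarTower R Aᵐᵒᵖ N] :
    Module.Finite A (Dual R N) := by
  have := (isFiniteLength_iff_isNoetherian_isArtinian.1 (Dual.isFiniteLength (R := R) (N := N))).1
  have := Dual.isScalarTower (R := R) (A := A) (N := N)
  exact Module.Finite.of_restrictScalars_finite R A _

-- This is the adjunction Hom_A(Y, Hom_R(A, J)) ≅ Hom_R(Y, J): evaluate at 1, extend over R, and
-- return by y ↦ (a ↦ h (a • y)).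
omit [IsArtinianRing R] in
variable (R A) in
theorem injective_dual_self : Module.Injective A (Dual R A) := by
  refine ⟨fun X Y _ _ _ _ j hj g => ?_⟩
  let _ : Module R X := Module.compHom X (algebraMap R A)
  let _ : Module R Y := Module.compHom Y (algebraMap R A)
  let j' : X →ₗ[R] Y := { toFun := j, map_add' := map_add j, map_smul' := fun r x => map_smul j (algebraMap R A r) x }
  let g' : X →ₗ[R] dualizingModule R :=
    { toFun := fun x => (g x).toHom 1
      map_add' := fun x y => by rw [map_add]; rfl
      map_smul' := fun r x => by
        change (g (algebraMap R A r • x)).toHom 1 = _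
        rw [map_smul, Dual.smul_toHom_apply, RingHom.id_apply, ← map_smul]
        congr 1
        simp [Algebra.smul_def] }
  obtain ⟨h, hh⟩ := (injective_dualizingModule R).out j' hj g'
  let k : Y → Dual R A := fun y =>
    show A →ₗ[R] dualizingModule R from
    { toFun := fun a => h (a • y)
      map_add' := fun a b => by rw [add_smul, map_add]
      map_smul' := fun r a => by
        rw [RingHom.id_apply, ← map_smul, Algebra.smul_def, mul_smul]
        rfl }
  have hk : ∀ y a, (k y).toHom a = h (a • y) := fun _ _ => rfl
  refine ⟨{ toFun := k, map_add' := fun x y => ?_, map_smul' := fun a y => ?_ }, fun x => ?_⟩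
  · refine Dual.ext fun a => ?_
    rw [hk, smul_add, map_add]; rfl
  · refine Dual.ext fun b => ?_
    rw [hk, RingHom.id_apply, Dual.smul_toHom_apply, hk, MulOpposite.smul_eq_mul_unop, mul_smul]
    rfl
  · refine Dual.ext fun a => ?_
    change (k (j x)).toHom a = _
    rw [hk, ← map_smul]
    refine (hh (a • x)).trans ?_
    change (g (a • x)).toHom 1 = _
    rw [map_smul, Dual.smul_toHom_apply, MulOpposite.smul_eq_mul_unop, one_mul]
    rfl

variable (R) in
theorem exists_injective_dual_self [Module.Finite R A] (s : SimpleClass A) :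
    ∃ f : s.rep →ₗ[A] Dual R A, Function.Injective f := by
  let _ : Module R s.rep := Module.compHom s.rep (algebraMap R A)
  have : Nontrivial s.rep := IsSimpleModule.nontrivial A _
  obtain ⟨x, hx⟩ := exists_ne (0 : s.rep)
  obtain ⟨φ, hφ⟩ := exists_hom_dualizingModule_ne_zero (R := R) hx
  let k : s.rep → Dual R A := fun y =>
    show A →ₗ[R] dualizingModule R from
    { toFun := fun a => φ (a • y)
      map_add' := fun a b => by rw [add_smul, map_add]
      map_smul' := fun r a => by
        rw [RingHom.id_apply, ← map_smul, Algebra.smul_def, mul_smul]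
        rfl }
  have hk : ∀ y a, (k y).toHom a = φ (a • y) := fun _ _ => rfl
  let f : s.rep →ₗ[A] Dual R A :=
    { toFun := k
      map_add' := fun x y => Dual.ext fun a => by rw [hk, smul_add, map_add]; rfl
      map_smul' := fun a y => Dual.ext fun b => by
        rw [hk, RingHom.id_apply, Dual.smul_toHom_apply, hk, MulOpposite.smul_eq_mul_unop, mul_smul]
        rfl }
  refine ⟨f, LinearMap.injective_of_ne_zero fun h0 => hφ ?_⟩
  have h1 : (k x).toHom 1 = 0 := by
    rw [show k x = 0 from LinearMap.congr_fun h0 x]; rfl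
  rwa [hk, one_smul] at h1

end DualModule

/-! ### The Auslander–Reiten translate of a simple module. -/

section Factor

variable {A : Type u} [Ring A] [IsSerialArtinian A]
  {P₀ P₁ M : Type u} [AddCommGroup P₀] [Module A P₀] [AddCommGroup P₁] [Module A P₁]
  [AddCommGroup M] [Module A M] {f : P₁ →ₗ[A] P₀} {t : SimpleClass A} {m : ℕ}

/-- The map `u` kills the kernel of `f`, so it is defined on the range of `f` and extends from there
to a map from P₀ into the hull of M. Length at least 2 forces this extension into M. -/
theorem exists_comp_eq_of_length_range_eq_one (hP₁ : IsUniserial A P₁) (hf0 : f ≠ 0)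
    (hf : IsCoatom (LinearMap.range f)) (hM : IsChainModule t (m + 2) M) (u : P₁ →ₗ[A] M)
    (hu : Module.length A (LinearMap.range u) = 1) : ∃ q : P₀ →ₗ[A] M, q ∘ₗ f = u := by
  have hsimple : IsSimpleModule A (LinearMap.range u) := Module.length_eq_one_iff.1 hu
  have hco : IsCoatom (LinearMap.ker u) := by
    rw [← LinearMap.ker_rangeRestrict]
    exact LinearMap.isCoatom_ker_of_surjective (LinearMap.surjective_rangeRestrict u)
  have hle : LinearMap.ker f ≤ LinearMap.ker u :=
    hP₁.le_of_isCoatom hco fun h => hf0 (LinearMap.ker_eq_top.1 h)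
  let v : LinearMap.range f →ₗ[A] M :=
    (LinearMap.ker f).liftQ u hle ∘ₗ (LinearMap.quotKerEquivRange f).symm.toLinearMap
  have hv : ∀ x, v ⟨f x, ⟨x, rfl⟩⟩ = u x := fun x => by
    have : (LinearMap.quotKerEquivRange f).symm ⟨f x, ⟨x, rfl⟩⟩ = Submodule.Quotient.mk x := by
      rw [LinearEquiv.symm_apply_eq]; rfl
    change (LinearMap.ker f).liftQ u hle ((LinearMap.quotKerEquivRange f).symm _) = _
    rw [this]; rfl
  obtain ⟨ι, hι⟩ := IsChainModule.exists_injective_hull (i := m + 1) hM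
  obtain ⟨q₀, hq₀⟩ := (isInjectiveEnvelope_hullIncl _).injective.out
    (LinearMap.range f).subtype (Submodule.injective_subtype _) (ι ∘ₗ v)
  have hq₀f : ∀ x, q₀ (f x) = ι (u x) := fun x => by
    rw [← hv]; exact hq₀ ⟨f x, ⟨x, rfl⟩⟩
  have hrange : LinearMap.range q₀ ≤ LinearMap.range ι := by
    have hKle : LinearMap.range f ≤ Submodule.comap q₀ (LinearMap.range ι) := by
      rintro _ ⟨x, rfl⟩
      exact ⟨u x, (hq₀f x).symm⟩
    rcases hf.le_iff.1 hKle with h | h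
    · rintro _ ⟨x, rfl⟩
      have : x ∈ Submodule.comap q₀ (LinearMap.range ι) := h ▸ Submodule.mem_top
      exact this
    -- If M were inside the image of `q₀` while its preimage is only the range of `f`, then `u`
    -- would be onto, contradicting its simple image.
    · refine ((isChainModule_hull _).uniserial (LinearMap.range q₀) (LinearMap.range ι)).elim id
        fun h' => ?_
      have htop : LinearMap.range u = ⊤ := by
        rw [eq_top_iff]
        intro y _
        obtain ⟨x, hx⟩ := h' ⟨y, rfl⟩
        have hx' : x ∈ LinearMap.range f := by rw [← h]; exact ⟨y, hx.symm⟩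
        obtain ⟨z, rfl⟩ := hx'
        refine ⟨z, hι ?_⟩
        rw [← hq₀f, hx]
      rw [htop, Module.length_top, hM.length] at hu
      have : m + 2 = 1 := by exact_mod_cast hu
      omega
  refine ⟨(LinearEquiv.ofInjective ι hι).symm.toLinearMap ∘ₗ
    q₀.codRestrict _ (fun x => hrange ⟨x, rfl⟩), LinearMap.ext fun x => hι ?_⟩
  rw [← hq₀f]
  exact LinearEquiv.ofInjective_symm_apply (h := hι) ι
    (⟨q₀ (f x), hrange ⟨f x, rfl⟩⟩ : LinearMap.range ι)

/-- Maps to uniserial modules that are not onto factor through `f`. -/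
theorem exists_comp_eq_of_not_surjective [Module.Projective A P₀] (hP₁ : IsUniserial A P₁)
    (hf0 : f ≠ 0) (hf : IsCoatom (LinearMap.range f)) (hM : IsChainModule t m M) (u : P₁ →ₗ[A] M)
    (hu : ¬ Function.Surjective u) : ∃ q : P₀ →ₗ[A] M, q ∘ₗ f = u := by
  have := hM.isNoetherian
  have := hM.isArtinian
  obtain ⟨r, hr⟩ := ENat.ne_top_iff_exists.1
    (Module.length_ne_top (R := A) (M := LinearMap.range u))
  induction r using Nat.strong_induction_on generalizing u with
  | _ r ih =>
  rcases r with _ | r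
  · have h0 : Subsingleton (LinearMap.range u) := Module.length_eq_zero_iff.1 hr.symm
    rw [Submodule.subsingleton_iff_eq_bot, LinearMap.range_eq_bot] at h0
    exact ⟨0, by rw [h0, LinearMap.zero_comp]⟩
  have hlt : r + 1 < m := by
    have := Submodule.length_lt (fun h => hu (LinearMap.range_eq_top.1 h))
    rw [← hr, hM.length] at this
    exact_mod_cast this
  obtain ⟨m, rfl⟩ := Nat.exists_eq_add_of_lt hlt
  -- Dividing by the submodule of length r leaves a simple image in a module of length m + 2, which
  -- the previous case handles; lifting and subtracting shortens the image.
  rw [show r + 1 + m + 1 = (m + 2) + r by ring] at hM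
  obtain ⟨L, hL, hML⟩ := hM.exists_submodule
  have hLle : L ≤ LinearMap.range u := by
    refine (hM.uniserial L (LinearMap.range u)).elim id fun h => ?_
    have := Module.length_le_of_injective _ (Submodule.inclusion_injective h)
    rw [← hr, hL.length] at this
    have : r + 1 ≤ r := by exact_mod_cast this
    omega
  have h1 : Module.length A (LinearMap.range (L.mkQ ∘ₗ u)) = 1 := by
    have hs := LinearMap.surjective_rangeRestrict (L.mkQ ∘ₗ (LinearMap.range u).subtype)
    have hadd := length_ker_add hs
    rw [LinearMap.ker_rangeRestrict, LinearMap.ker_comp, Submodule.ker_mkQ, ← hr,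
      (Submodule.comapSubtypeEquivOfLe hLle).length_eq, hL.length, LinearMap.range_comp,
      Submodule.range_subtype] at hadd
    rw [LinearMap.range_comp]
    have h2 : ((r : ℕ) : ℕ∞) + 1 = r + Module.length A ((LinearMap.range u).map L.mkQ) := by
      rw [← hadd]; norm_cast
    exact ((ENat.addLECancellable_of_ne_top (ENat.natCast_ne_top r)).inj.1 h2).symm
  obtain ⟨q', hq'⟩ := exists_comp_eq_of_length_range_eq_one hP₁ hf0 hf hML _ h1
  obtain ⟨q, rfl⟩ := Module.projective_lifting_property L.mkQ q' L.mkQ_surjective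
  have hle : LinearMap.range (u - q ∘ₗ f) ≤ L := by
    rintro _ ⟨x, rfl⟩
    have := LinearMap.congr_fun hq' x
    rw [← Submodule.ker_mkQ L, LinearMap.mem_ker, LinearMap.sub_apply, map_sub]
    exact sub_eq_zero.2 this.symm
  have hlen := Module.length_le_of_injective _ (Submodule.inclusion_injective hle)
  rw [hL.length] at hlen
  obtain ⟨k, hk⟩ := ENat.ne_top_iff_exists.1
    (Module.length_ne_top (R := A) (M := LinearMap.range (u - q ∘ₗ f)))
  rw [← hk] at hlen
  have hkr : k ≤ r := by exact_mod_cast hlen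
  obtain ⟨q₂, hq₂⟩ := ih k (by omega) (u - q ∘ₗ f) (fun hsurj => by
    rw [LinearMap.range_eq_top.2 hsurj, top_le_iff] at hle
    have h3 := hL.length
    rw [hle, Module.length_top, hM.length] at h3
    have : m + 2 + r = r := by exact_mod_cast h3
    omega) hk
  exact ⟨q + q₂, by rw [LinearMap.add_comp, hq₂, add_sub_cancel]⟩

/-- Radical maps to finitely generated projective modules factor through `f`. -/
theorem exists_comp_eq_of_radical [Module.Projective A P₀] (hP₁ : IsUniserial A P₁)
    (hf0 : f ≠ 0) (hf : IsCoatom (LinearMap.range f)) (Q : Type u) [AddCommGroup Q] [Module A Q]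
    [Module.Finite A Q] [Module.Projective A Q] (u : P₁ →ₗ[A] Q)
    (hu : ∀ (t : SimpleClass A) (p : Q →ₗ[A] t.rep), p ∘ₗ u = 0) :
    ∃ q : P₀ →ₗ[A] Q, q ∘ₗ f = u := by
  revert u
  refine projective_induction (motive := fun (Q : Type u) [AddCommGroup Q] [Module A Q] =>
    ∀ u : P₁ →ₗ[A] Q, (∀ (t : SimpleClass A) (p : Q →ₗ[A] t.rep), p ∘ₗ u = 0) →
      ∃ q : P₀ →ₗ[A] Q, q ∘ₗ f = u) ?_ ?_ Q
  · intro Q _ _ hQ u _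
    exact ⟨0, LinearMap.ext fun x => Subsingleton.elim _ _⟩
  · intro Q _ _ s g σ hσ ih u hu
    obtain ⟨v₁, hv₁⟩ := exists_comp_eq_of_not_surjective hP₁ hf0 hf (isChainModule_cover s)
      (g ∘ₗ u) (fun hs => by
        obtain ⟨p, hp⟩ := exists_cover_surjective s
        have : Nontrivial s.rep := IsSimpleModule.nontrivial A _
        obtain ⟨y, hy⟩ := exists_ne (0 : s.rep)
        obtain ⟨x, rfl⟩ := (hp.comp hs) y
        exact hy (LinearMap.congr_fun (hu s (p ∘ₗ g)) x))
    have hmem : ∀ x, (LinearMap.id - σ ∘ₗ g : Q →ₗ[A] Q) x ∈ LinearMap.ker g := fun x => by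
      have := LinearMap.congr_fun hσ (g x)
      simp only [LinearMap.comp_apply, LinearMap.id_apply] at this
      simp [this]
    obtain ⟨v₂, hv₂⟩ := ih ((LinearMap.id - σ ∘ₗ g : Q →ₗ[A] Q).codRestrict _ hmem ∘ₗ u)
      (fun t p => hu t (p ∘ₗ (LinearMap.id - σ ∘ₗ g : Q →ₗ[A] Q).codRestrict _ hmem))
    refine ⟨σ ∘ₗ v₁ + (LinearMap.ker g).subtype ∘ₗ v₂, LinearMap.ext fun x => ?_⟩
    have e1 := LinearMap.congr_fun hv₁ x
    have e2 := congrArg Subtype.val (LinearMap.congr_fun hv₂ x)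
    simp only [LinearMap.comp_apply, LinearMap.codRestrict_apply, LinearMap.sub_apply,
      LinearMap.id_apply] at e1 e2
    simp only [LinearMap.comp_apply, LinearMap.add_apply, Submodule.subtype_apply, e1, e2]
    abel

end Factor

section Transpose

variable {A : Type u} [Ring A] [IsSerialArtinian A]
  {P₀ P₁ : Type u} [AddCommGroup P₀] [Module A P₀] [AddCommGroup P₁] [Module A P₁]
  {f : P₁ →ₗ[A] P₀} {s t w : SimpleClass A} {m c₀ c₁ : ℕ}

/-- Since the range of `f` is the maximal submodule of the uniserial P₀, composites with `f` are
radical; the converse is `exists_comp_eq_of_radical`. The transpose is thus Hom(P₁, A) modulo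
radical maps. -/
theorem mem_range_precomp_iff [Module.Projective A P₀] (h₀ : IsUniserial A P₀)
    (hP₁ : IsUniserial A P₁) (hf0 : f ≠ 0) (hf : IsCoatom (LinearMap.range f)) (h : P₁ →ₗ[A] A) :
    h ∈ LinearMap.range (precomp f) ↔ ∀ (t : SimpleClass A) (p : A →ₗ[A] t.rep), p ∘ₗ h = 0 := by
  constructor
  · rintro ⟨v, rfl⟩ t p
    by_cases h0 : p ∘ₗ v = 0
    · change (p ∘ₗ v) ∘ₗ f = 0
      rw [h0, LinearMap.zero_comp]
    · have hco := LinearMap.isCoatom_ker_of_surjective (LinearMap.surjective_of_ne_zero h0)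
      refine LinearMap.ext fun x => ?_
      exact h₀.le_of_isCoatom hco hf.1 ⟨x, rfl⟩
  · intro hh
    obtain ⟨q, hq⟩ := exists_comp_eq_of_radical hP₁ hf0 hf A h hh
    exact ⟨q, hq⟩

omit [IsSerialArtinian A] in
theorem mem_jacobson_iff (a : A) :
    a ∈ Module.jacobson A A ↔ ∀ (t : SimpleClass A) (p : A →ₗ[A] t.rep), p a = 0 := by
  constructor
  · intro ha t p
    by_cases h0 : p = 0
    · rw [h0]; rfl
    · have hco := LinearMap.isCoatom_ker_of_surjective (LinearMap.surjective_of_ne_zero h0)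
      exact (sInf_le (show LinearMap.ker p ∈ {m : Submodule A A | IsCoatom m} from hco)) ha
  · intro h
    refine Submodule.mem_sInf.2 fun L hL => ?_
    obtain ⟨t, ⟨e⟩⟩ := SimpleClass.exists_equiv_rep (A ⧸ L) (isSimpleModule_iff_isCoatom.2 hL)
    have h1 : e (L.mkQ a) = 0 := h t (e.toLinearMap ∘ₗ L.mkQ)
    have h2 : L.mkQ a = 0 := e.injective (by rw [h1, map_zero])
    simpa using h2

/-- Modulo the maps with image in the radical, the maps from a local projective module to the
ring form a simple right module. -/
theorem exists_sub_smul_mem [Module.Projective A P₀] (h₀ : IsUniserial A P₀)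
    (hP₁ : IsUniserial A P₁) (hf0 : f ≠ 0) (hf : IsCoatom (LinearMap.range f))
    {p₁ : P₁ →ₗ[A] w.rep} (hp₁ : Function.Surjective p₁) {h : P₁ →ₗ[A] A}
    (hh : h ∉ LinearMap.range (precomp f)) (h' : P₁ →ₗ[A] A) :
    ∃ a : A, h' - MulOpposite.op a • h ∈ LinearMap.range (precomp f) := by
  simp only [mem_range_precomp_iff h₀ hP₁ hf0 hf] at hh ⊢
  set J := Module.jacobson A A with hJ
  have hss : IsSemisimpleModule A (A ⧸ J) := by
    rw [IsArtinian.isSemisimpleModule_iff_jacobson]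
    exact Module.jacobson_quotient_jacobson A A
  have hco := LinearMap.isCoatom_ker_of_surjective hp₁
  have hkill : ∀ k : P₁ →ₗ[A] A, LinearMap.ker p₁ ≤ LinearMap.ker (J.mkQ ∘ₗ k) := by
    intro k x hx
    rw [LinearMap.ker_comp, Submodule.ker_mkQ, Submodule.mem_comap, mem_jacobson_iff]
    intro t p
    by_cases h0 : p ∘ₗ k = 0
    · exact LinearMap.congr_fun h0 x
    · have hco' := LinearMap.isCoatom_ker_of_surjective (LinearMap.surjective_of_ne_zero h0)
      exact hP₁.le_of_isCoatom hco' hco.1 hx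
  have hker : LinearMap.ker (J.mkQ ∘ₗ h) = LinearMap.ker p₁ := by
    rcases hco.le_iff.1 (hkill h) with h1 | h1
    · refine absurd (fun t p => LinearMap.ext fun x => ?_) hh
      have : x ∈ LinearMap.ker (J.mkQ ∘ₗ h) := h1 ▸ Submodule.mem_top
      rw [LinearMap.ker_comp, Submodule.ker_mkQ, Submodule.mem_comap, mem_jacobson_iff] at this
      exact this t p
    · exact h1
  -- Modulo the radical both maps factor through the simple top of P₁, and `h` becomes injective
  -- there; an endomorphism of the semisimple A ⧸ J carries `h` to `h'`, and it is right
  -- multiplication by a lift of its value at 1.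
  obtain ⟨β, hβ⟩ := IsSemisimpleModule.extension_property
    ((LinearMap.ker (J.mkQ ∘ₗ h)).liftQ (J.mkQ ∘ₗ h) le_rfl)
    (LinearMap.ker_eq_bot.1 (Submodule.ker_liftQ_eq_bot _ _ _ le_rfl))
    ((LinearMap.ker (J.mkQ ∘ₗ h)).liftQ (J.mkQ ∘ₗ h') (hker ▸ hkill h'))
  obtain ⟨a, ha⟩ := J.mkQ_surjective (β (J.mkQ 1))
  refine ⟨a, fun t p => LinearMap.ext fun x => ?_⟩
  have h1 : β (J.mkQ (h x)) = J.mkQ (h' x) :=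
    LinearMap.congr_fun hβ (Submodule.Quotient.mk x)
  have h2 : β (J.mkQ (h x)) = J.mkQ (h x * a) := by
    have e1 : J.mkQ (h x) = h x • J.mkQ 1 := by rw [← map_smul, smul_eq_mul, mul_one]
    rw [e1, map_smul, ← ha, ← map_smul, smul_eq_mul]
  have h3 : h' x - h x * a ∈ J := by
    rw [← Submodule.ker_mkQ J, LinearMap.mem_ker, map_sub, ← h1, h2, sub_self]
  exact (mem_jacobson_iff _).1 h3 t p

end Transpose

section DualTranspose

variable {R A : Type u} [CommRing R] [IsArtinianRing R] [Ring A] [Algebra R A] [Module.Finite R A]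
  [IsSerialArtinian A]
  {P₀ P₁ : Type u} [AddCommGroup P₀] [Module A P₀] [AddCommGroup P₁] [Module A P₁]
  {f : P₁ →ₗ[A] P₀} {s t w : SimpleClass A} {m c₀ c₁ : ℕ}

omit [IsSerialArtinian A] in
theorem finite_hom_of_surjective {x₀ : P₁}
    (hx₀ : Function.Surjective (LinearMap.toSpanSingleton A P₁ x₀)) :
    Module.Finite R (P₁ →ₗ[A] A) := by
  let ev : (P₁ →ₗ[A] A) →ₗ[R] A :=
    { toFun := fun h => h x₀, map_add' := fun _ _ => rfl, map_smul' := fun _ _ => rfl }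
  have hev : Function.Injective ev := by
    intro h h' hh
    refine LinearMap.ext fun y => ?_
    obtain ⟨a, rfl⟩ := hx₀ y
    have : h x₀ = h' x₀ := hh
    rw [LinearMap.toSpanSingleton_apply, map_smul, map_smul, this]
  exact Module.Finite.of_injective ev hev

omit [IsArtinianRing R] [Module.Finite R A] [IsSerialArtinian A] in
theorem finite_transpose [Module.Finite R (P₁ →ₗ[A] A)] : Module.Finite R (Transpose f) := by
  let q : (P₁ →ₗ[A] A) →ₗ[R] Transpose f :=
    { toFun := Submodule.Quotient.mk
      map_add' := fun _ _ => rfl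
      map_smul' := fun _ _ => rfl }
  exact Module.Finite.of_surjective q (Submodule.Quotient.mk_surjective _)

/-- The Auslander–Reiten translate of a simple module is the top of the first syzygy. -/
theorem nonempty_dual_transpose_equiv [Module.Projective A P₀] [Module.Projective A P₁]
    (h₀ : IsUniserial A P₀) (h₁ : IsChainModule w c₁ P₁) (hf0 : f ≠ 0)
    (hf : IsCoatom (LinearMap.range f)) :
    Nonempty (Dual R (Transpose f) ≃ₗ[A] w.rep) := by
  have hP₁ := h₁.uniserial
  have hc₁ : c₁ ≠ 0 := fun h => by
    have := h₁.subsingleton_iff.2 h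
    exact hf0 (LinearMap.ext fun x => by rw [Subsingleton.elim x 0, map_zero, map_zero])
  obtain ⟨p₁, hp₁⟩ := h₁.top hc₁
  have hnt : Nontrivial w.rep := IsSimpleModule.nontrivial A _
  obtain ⟨x₀, hx₀⟩ : ∃ x₀, Function.Surjective (LinearMap.toSpanSingleton A P₁ x₀) := by
    obtain ⟨y, hy⟩ := exists_ne (0 : w.rep)
    obtain ⟨x, rfl⟩ := hp₁ y
    refine ⟨x, h₁.surjective_of_comp (p := p₁) (LinearMap.surjective_of_ne_zero fun h0 => hy ?_)⟩
    simpa using LinearMap.congr_fun h0 1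
  have : Module.Finite R (P₁ →ₗ[A] A) := finite_hom_of_surjective hx₀
  have hfin : Module.Finite R (Transpose f) := finite_transpose
  obtain ⟨σ, hσ⟩ := Module.projective_lifting_property _ LinearMap.id hx₀
  have hσx : ∀ y, σ y • x₀ = y := fun y => LinearMap.congr_fun hσ y
  set W := LinearMap.range (precomp f) with hW
  have hσW : σ ∉ W := by
    rw [hW, mem_range_precomp_iff h₀ hP₁ hf0 hf]
    intro H
    have h2 := H w (p₁ ∘ₗ LinearMap.toSpanSingleton A P₁ x₀)
    rw [LinearMap.comp_assoc, hσ, LinearMap.comp_id] at h2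
    obtain ⟨y, hy⟩ := exists_ne (0 : w.rep)
    obtain ⟨x, rfl⟩ := hp₁ y
    exact hy (by rw [h2]; rfl)
  have hσidem : MulOpposite.op (σ x₀) • σ = σ := LinearMap.ext fun y => by
    change σ y * σ x₀ = σ y
    rw [← smul_eq_mul, ← map_smul, hσx]
  have hne : (Submodule.Quotient.mk σ : Transpose f) ≠ 0 := by
    rwa [Ne, Submodule.Quotient.mk_eq_zero]
  obtain ⟨φ, hφ⟩ := exists_hom_dualizingModule_ne_zero (R := R) hne
  let φ' : Dual R (Transpose f) := φ
  have hφ' : σ x₀ • φ' ≠ 0 := by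
    intro h
    apply hφ
    have h1 : (σ x₀ • φ').toHom (Submodule.Quotient.mk σ) = 0 := by rw [h]; rfl
    rw [Dual.smul_toHom_apply, ← Submodule.Quotient.mk_smul, hσidem] at h1
    exact h1
  have hfinD : IsFiniteLength R (Dual R (Transpose f)) := Dual.isFiniteLength
  obtain ⟨_, _⟩ := isFiniteLength_iff_isNoetherian_isArtinian.1 hfinD
  have htower : IsScalarTower R A (Dual R (Transpose f)) := Dual.isScalarTower
  -- Every nonzero element of the transpose generates it, so none is annihilated by a nonzero
  -- submodule N of the dual. The transpose then embeds in Hom_R(N, J), and comparing lengths over R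
  -- makes N everything.
  have hsimple : IsSimpleModule A (Dual R (Transpose f)) := by
    have : Nontrivial (Dual R (Transpose f)) := ⟨_, _, hφ'⟩
    refine (isSimpleModule_iff _ _).2 { eq_bot_or_eq_top := fun N => ?_ }
    by_cases hN : N = ⊥
    · exact Or.inl hN
    right
    let N' : Submodule R (Dual R (Transpose f)) := N.restrictScalars R
    let ev : Transpose f →ₗ[R] (N' →ₗ[R] dualizingModule R) :=
      { toFun := fun x =>
          { toFun := fun ψ => ψ.1.toHom x
            map_add' := fun _ _ => rfl
            map_smul' := fun _ _ => rfl }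
        map_add' := fun x y => LinearMap.ext fun ψ => ψ.1.toHom.map_add x y
        map_smul' := fun r x => LinearMap.ext fun ψ => ψ.1.toHom.map_smul r x }
    have hev : Function.Injective ev := by
      rw [injective_iff_map_eq_zero]
      intro x hx
      by_contra hx0
      apply hN
      rw [eq_bot_iff]
      intro ψ hψ
      obtain ⟨h, rfl⟩ := Submodule.Quotient.mk_surjective _ x
      rw [Submodule.Quotient.mk_eq_zero] at hx0
      refine Dual.ext fun y => ?_
      obtain ⟨h', rfl⟩ := Submodule.Quotient.mk_surjective _ y
      obtain ⟨a, ha⟩ := exists_sub_smul_mem h₀ hP₁ hf0 hf hp₁ hx0 h'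
      rw [(Submodule.Quotient.eq _).2 ha, Submodule.Quotient.mk_smul, ← Dual.smul_toHom_apply]
      exact LinearMap.congr_fun hx ⟨a • ψ, N.smul_mem a hψ⟩
    have hlen : Module.length R (⊤ : Submodule R (Dual R (Transpose f))) ≤ Module.length R N' := by
      rw [Module.length_top]
      refine Dual.length_le.trans ((Module.length_le_of_injective ev hev).trans ?_)
      exact length_hom_dualizingModule_le (Module.length_ne_top_iff.1 Module.length_ne_top)
    have htop := eq_of_le_of_length_le (le_top : N' ≤ ⊤) hlen
    exact (Submodule.restrictScalars_eq_top_iff R A _).1 htop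
  -- A nonzero map from P₁ to the simple dual identifies it with the top of P₁.
  let k : P₁ →ₗ[A] Dual R (Transpose f) := LinearMap.toSpanSingleton A _ φ' ∘ₗ σ
  have hk : k ≠ 0 := fun h => hφ' (LinearMap.congr_fun h x₀)
  obtain ⟨t, ⟨e⟩⟩ := SimpleClass.exists_equiv_rep _ hsimple
  have hwt : w = t := h₁.top_unique (p := e.toLinearMap ∘ₗ k)
    (e.surjective.comp (LinearMap.surjective_of_ne_zero hk))
  subst hwt
  exact ⟨e⟩

end DualTranspose

/-! ### Translation of the resolution quiver and the Gorenstein property into integers. -/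

section Translate

variable {R A : Type u} [CommRing R] [IsArtinianRing R] [Ring A] [Algebra R A] [Module.Finite R A]
  {M N P₀ P₁ : Type u} [AddCommGroup M] [Module A M] [AddCommGroup N] [Module A N]
  [AddCommGroup P₀] [Module A P₀] [AddCommGroup P₁] [Module A P₁] {s t : SimpleClass A}

theorem nonempty_dual_transpose_equiv_next [IsSerialArtinian A] (e : M ≃ₗ[A] s.rep)
    (hs : 2 ≤ coverLength s) {p₀ : P₀ →ₗ[A] M} (hp₀ : IsProjectiveCover p₀)
    {p₁ : P₁ →ₗ[A] LinearMap.ker p₀} (hp₁ : IsProjectiveCover p₁) :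
    Nonempty (Dual R (Transpose ((LinearMap.ker p₀).subtype ∘ₗ p₁)) ≃ₗ[A] (next s).rep) := by
  have hM := IsChainModule.of_isSimpleModule e
  have hP₀ := hM.of_isProjectiveCover one_ne_zero hp₀
  obtain ⟨c, hc⟩ := Nat.exists_eq_add_of_le hs
  have hK : IsChainModule (next s) (c + 1) (LinearMap.ker p₀) :=
    IsChainModule.ker (i := 1) (by rwa [show 1 + (c + 1) = coverLength s by omega])
      hp₀.surjective hM.length
  have hP₁ := hK.of_isProjectiveCover (by omega) hp₁
  have := hp₀.projective
  have := hp₁.projective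
  have hrange : LinearMap.range ((LinearMap.ker p₀).subtype ∘ₗ p₁) = LinearMap.ker p₀ := by
    rw [LinearMap.range_comp_of_range_eq_top _ (LinearMap.range_eq_top.2 hp₁.surjective),
      Submodule.range_subtype]
  have : IsSimpleModule A M := IsSimpleModule.congr e
  have hco := LinearMap.isCoatom_ker_of_surjective hp₀.surjective
  refine nonempty_dual_transpose_equiv hP₀.uniserial hP₁ (fun h0 => ?_) (by rwa [hrange])
  rw [h0, LinearMap.range_zero] at hrange
  exact Submodule.nontrivial_iff_ne_bot.1 (hK.nontrivial (by omega)) hrange.symm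

theorem isARTranslate_iff [IsSerialArtinian A] (e : M ≃ₗ[A] s.rep) (hs : 2 ≤ coverLength s) :
    IsARTranslate R A M N ↔ Nonempty (N ≃ₗ[A] (next s).rep) := by
  constructor
  · rintro ⟨P₀, P₁, p₀, p₁, hp₀, hp₁, ⟨e'⟩⟩
    obtain ⟨e''⟩ := nonempty_dual_transpose_equiv_next (R := R) e hs hp₀ hp₁
    exact ⟨e'.trans e''⟩
  · rintro ⟨e'⟩
    have hM := IsChainModule.of_isSimpleModule e
    obtain ⟨P₀, p₀, hp₀⟩ := hM.exists_isProjectiveCover one_ne_zero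
    have hP₀ := hM.of_isProjectiveCover one_ne_zero hp₀
    obtain ⟨c, hc⟩ := Nat.exists_eq_add_of_le hs
    have hK : IsChainModule (next s) (c + 1) (LinearMap.ker p₀) :=
      IsChainModule.ker (i := 1) (by rwa [show 1 + (c + 1) = coverLength s by omega])
        hp₀.surjective hM.length
    obtain ⟨P₁, p₁, hp₁⟩ := hK.exists_isProjectiveCover (by omega)
    obtain ⟨e''⟩ := nonempty_dual_transpose_equiv_next (R := R) e hs hp₀ hp₁
    exact ⟨P₀, P₁, p₀, p₁, hp₀, hp₁, ⟨e'.trans e''.symm⟩⟩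

variable [IsCyclicSerial A]

/-- No simple module is projective, so the alternative with the simple injective never occurs. -/
theorem isTauTilde_iff (e : M ≃ₗ[A] s.rep) :
    IsTauTilde R A M N ↔ Nonempty (N ≃ₗ[A] (next s).rep) := by
  have hs := two_le_coverLength s
  have hproj : ¬ Module.Projective A M := by
    rw [(IsChainModule.of_isSimpleModule e).projective_iff one_ne_zero]
    omega
  rw [← isARTranslate_iff (R := R) e hs, IsTauTilde]
  tauto

/-- The socle of the cover is one iterate short of its length, and the translate supplies the last
`next`. -/
theorem isGamma_iff : IsGamma R s t ↔ t = next^[coverLength s] s := by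
  obtain ⟨j, hj⟩ := Nat.exists_eq_add_one_of_ne_zero (coverLength_ne_zero s)
  have key : ∀ {S T : SimpleMod A}, SimpleClass.mk S = s → SimpleClass.mk T = t →
      ∀ {P : ModuleCat.{u} A} {p : P →ₗ[A] S.1}, IsProjectiveCover p →
        (IsTauTilde R A (socle A P) T.1 ↔ t = next^[coverLength s] s) := by
    intro S T hS hT P p hp
    obtain ⟨e⟩ := SimpleClass.mk_eq_iff.1 hS
    have hP := (IsChainModule.of_isSimpleModule e).of_isProjectiveCover one_ne_zero hp
    rw [hj] at hP
    obtain ⟨e'⟩ := hP.nonempty_socle_equiv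
    rw [isTauTilde_iff e', hj, Function.iterate_succ_apply', ← SimpleClass.mk_eq_iff, hT]
  constructor
  · rintro ⟨S, T, hS, hT, P, p, hp, h⟩
    exact (key hS hT hp).1 h
  · intro h
    have hrep := IsChainModule.of_isSimpleModule (LinearEquiv.refl A s.rep)
    obtain ⟨P, p, hp⟩ := hrep.exists_isProjectiveCover one_ne_zero
    exact ⟨⟨s.rep, inferInstance⟩, ⟨t.rep, inferInstance⟩, s.mk_rep, t.mk_rep, P, p, hp,
      (key s.mk_rep t.mk_rep hp).2 h⟩

theorem isPsi_iff : IsPsi R s t ↔ next t = hullTop s := by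
  have key : ∀ {S T : SimpleMod A}, SimpleClass.mk S = s → SimpleClass.mk T = t →
      ∀ {I : ModuleCat.{u} A} {i : S.1 →ₗ[A] I}, IsInjectiveEnvelope i →
        (IsTauTilde R A T.1 (top A I) ↔ next t = hullTop s) := by
    intro S T hS hT I i hi
    obtain ⟨e⟩ := SimpleClass.mk_eq_iff.1 hS
    obtain ⟨e'⟩ := SimpleClass.mk_eq_iff.1 hT
    have hI := isChainModule_of_isInjectiveEnvelope e hi
    obtain ⟨e''⟩ := hI.nonempty_top_equiv (hullLength_ne_zero s)
    rw [isTauTilde_iff e']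
    constructor
    · rintro ⟨f⟩
      exact SimpleClass.eq_of_equiv (f.symm.trans e'')
    · intro h
      rw [h]
      exact ⟨e''⟩
  constructor
  · rintro ⟨S, T, hS, hT, I, i, hi, h⟩
    exact (key hS hT hi).1 h
  · intro h
    exact ⟨⟨s.rep, inferInstance⟩, ⟨t.rep, inferInstance⟩, s.mk_rep, t.mk_rep, hull s, hullIncl s,
      isInjectiveEnvelope_hullIncl s,
      (key s.mk_rep t.mk_rep (i := hullIncl s) (isInjectiveEnvelope_hullIncl s)).2 h⟩

variable (R)

theorem gamma_label (i : ℤ) : gamma R (label i : SimpleClass A) = label (coverEnd A i) := by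
  have h : IsGamma R (label i : SimpleClass A) (gamma R (label i)) :=
    Classical.epsilon_spec (p := IsGamma R (label i : SimpleClass A)) ⟨_, isGamma_iff.2 rfl⟩
  rw [isGamma_iff.1 h, coverEnd, label_add_nat]

theorem psi_label (j : ℤ) :
    psi R (label j : SimpleClass A) = label (hullStart A (j + 1) - 1) := by
  have htop : next (label (hullStart A (j + 1) - 1)) = hullTop (label j : SimpleClass A) := by
    have h := isInterval_hull (A := A) (j + 1)
    have h' := isChainModule_hull (label j : SimpleClass A)
    have h2 := h.2
    rw [hullStart, sub_sub_cancel, Int.toNat_natCast, add_sub_cancel_right] at h2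
    rw [← label_add_one, sub_add_cancel, hullStart, add_sub_cancel_right]
    exact h2.class_unique h' (hullLength_ne_zero _)
  have h : IsPsi R (label j : SimpleClass A) (psi R (label j)) :=
    Classical.epsilon_spec (p := IsPsi R (label j : SimpleClass A)) ⟨_, isPsi_iff.2 htop⟩
  exact next_injective_of_cyclic ((isPsi_iff.1 h).trans htop.symm)

theorem isGammaCyclic_label_iff (i : ℤ) : IsGammaCyclic R (label i : SimpleClass A) ↔
    IsCyclicMod (period A) (coverEnd A) i := by
  have h : ∀ m : ℕ, (gamma R)^[m] (label i : SimpleClass A) = label ((coverEnd A)^[m] i) := by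
    intro m
    induction m with
    | zero => rfl
    | succ m ih => rw [Function.iterate_succ_apply', ih, gamma_label, Function.iterate_succ_apply']
  simp only [IsGammaCyclic, IsCyclicMod, h, label_eq_iff]

theorem isPsiCyclic_label_iff (j : ℤ) : IsPsiCyclic R (label j : SimpleClass A) ↔
    IsCyclicMod (period A) (fun j => hullStart A (j + 1) - 1) j := by
  have h : ∀ m : ℕ, (psi R)^[m] (label j : SimpleClass A) =
      label ((fun j => hullStart A (j + 1) - 1)^[m] j) := by
    intro m
    induction m with
    | zero => rfl
    | succ m ih => rw [Function.iterate_succ_apply', ih, psi_label, Function.iterate_succ_apply']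
  simp only [IsPsiCyclic, IsCyclicMod, h, label_eq_iff]

/-- The ring is built from the covers, each a summand of it; its dual is a finitely generated
injective cogenerator, so each hull is a summand of it and it is built from hulls. -/
theorem isGorenstein_iff : IsGorenstein R A ↔
    (∀ i, CosyzygyTerminates (hullStart A) i (coverEnd A i)) ∧
      ∀ b, SyzygyTerminates (coverEnd A) (hullStart A b) b := by
  have : Module.Finite A (Dual R A) := Dual.finite
  rw [IsGorenstein, injectiveDimension_ne_top_iff_finiteId, finiteId_self_iff,
    projectiveDimension_ne_top_iff_finitePd,
    finitePd_injective_iff (injective_dual_self R A) (exists_injective_dual_self R)]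
  refine and_congr ⟨fun h i => (isInterval_cover i).finiteId_iff.1 (h _), fun h s => ?_⟩
    ⟨fun h b => (isInterval_hull b).finitePd_iff.1 (h _), fun h s => ?_⟩
  · obtain ⟨i, rfl⟩ := label_surjective s
    exact (isInterval_cover i).finiteId_iff.2 (h i)
  · obtain ⟨i, rfl⟩ := label_surjective s
    have := (isInterval_hull (A := A) (i + 1)).finitePd_iff.2 (h (i + 1))
    rwa [add_sub_cancel_right] at this

/-- With one arrow leaving each vertex, a cycle is the orbit of a periodic point, indexed modulo its
minimal period. -/
theorem forall_isCycle_iff {V : Type*} (Q : Digraph V) (g : V → V)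
    (hQ : ∀ s t, Q.Adj s t ↔ g s = t) (B : V → Prop) :
    (∀ (m : ℕ) (c : ZMod m → V), IsCycle Q m c → ∀ i, B (c i)) ↔
      ∀ s, (∃ m : ℕ, 0 < m ∧ g^[m] s = s) → B s := by
  constructor
  · rintro h s ⟨m, hm, hs⟩
    have hpos : 0 < Function.minimalPeriod g s :=
      Function.IsPeriodicPt.minimalPeriod_pos hm hs
    have : NeZero (Function.minimalPeriod g s) := ⟨hpos.ne'⟩
    have h0 := h (Function.minimalPeriod g s) (fun i => g^[i.val] s) ⟨hpos, ?_, ?_⟩ 0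
    · simpa using h0
    · intro i j hij
      apply ZMod.val_injective
      exact (Function.iterate_eq_iterate_iff_of_lt_minimalPeriod (ZMod.val_lt i)
        (ZMod.val_lt j)).1 hij
    · intro i
      rw [hQ, ← Function.iterate_succ_apply' g, ← Function.iterate_mod_minimalPeriod_eq (n := i.val.succ),
        ← ZMod.val_natCast]
      simp
  · rintro h m c ⟨hm, -, hc⟩ i
    refine h _ ⟨m, hm, ?_⟩
    have hiter : ∀ k : ℕ, g^[k] (c i) = c (i + k) := by
      intro k
      induction k with
      | zero => simp
      | succ k ih =>
        rw [Function.iterate_succ_apply', ih, (hQ _ _).1 (hc _)]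
        push_cast
        rw [add_assoc]
    rw [hiter, ZMod.natCast_self, add_zero]

theorem tfae_isGorenstein : List.TFAE
    [IsGorenstein R A,
     ∀ s : SimpleClass A, IsGammaCyclic R s → IsGammaBlack s,
     ∀ s : SimpleClass A, IsPsiCyclic R s → IsPsiBlack s,
     {s : SimpleClass A | IsGammaCyclic R s} = {s : SimpleClass A | IsPsiCyclic R s},
     ∀ (m : ℕ) (c : ZMod m → SimpleClass A), IsCycle (resolutionQuiver R A) m c →
       ∀ i, IsGammaBlack (c i)] := by
  have h := (kupischPair A).tfae (exists_not_syzygyTerminates A)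
  have h2 : (∀ s : SimpleClass A, IsGammaCyclic R s → IsGammaBlack s) ↔
      ∀ c, IsCyclicMod (period A) (coverEnd A) c → coverEnd A c ≠ coverEnd A (c + 1) := by
    simp only [label_surjective.forall, isGammaCyclic_label_iff, isGammaBlack_label_iff]
  have h3 : (∀ s : SimpleClass A, IsPsiCyclic R s → IsPsiBlack s) ↔
      ∀ c, IsCyclicMod (period A) (fun j => hullStart A (j + 1) - 1) c →
        hullStart A c ≠ hullStart A (c + 1) := by
    simp only [label_surjective.forall, isPsiCyclic_label_iff, isPsiBlack_label_iff]
  have h4 : {s : SimpleClass A | IsGammaCyclic R s} = {s : SimpleClass A | IsPsiCyclic R s} ↔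
      ∀ j, IsCyclicMod (period A) (coverEnd A) j ↔
        IsCyclicMod (period A) (fun j => hullStart A (j + 1) - 1) j := by
    simp only [Set.ext_iff, Set.mem_ofPred_eq, label_surjective.forall, isGammaCyclic_label_iff,
      isPsiCyclic_label_iff]
  have h5 := forall_isCycle_iff (resolutionQuiver R A) (gamma R) (fun _ _ => Iff.rfl) IsGammaBlack
  rw [← isGorenstein_iff R, ← h2, ← h3, ← h4] at h
  tfae_have 1 ↔ 2 := h.out 0 1
  tfae_have 1 ↔ 3 := h.out 0 2
  tfae_have 1 ↔ 4 := h.out 0 3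
  tfae_have 2 ↔ 5 := h5.symm
  tfae_finish

end Translate

/-! ### Nakayama algebras are serial artinian. -/

section NakayamaAlgebra

variable {A : Type u} [Ring A]

/-- Over an artinian ring, each simple module is a quotient of an indecomposable direct summand of
the ring. -/
theorem exists_isIndecomposable_summand [IsArtinianRing A] (s : SimpleClass A) :
    ∃ Q : Submodule A A, Module.Projective A Q ∧ IsIndecomposable A Q ∧
      ∃ p : Q →ₗ[A] s.rep, Function.Surjective p := by
  have : Nontrivial s.rep := IsSimpleModule.nontrivial A _
  obtain ⟨y, hy⟩ := exists_ne (0 : s.rep)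
  let g : A →ₗ[A] s.rep := LinearMap.toSpanSingleton A _ y
  -- A minimal summand of the ring on which `g` is nonzero is indecomposable: `g` is nonzero on one
  -- piece of any splitting, and minimality kills the other.
  obtain ⟨Q, ⟨⟨π, hπ⟩, x, hxQ, hx⟩, hmin⟩ := IsArtinian.set_has_minimal
    {Q : Submodule A A | (∃ π : A →ₗ[A] Q, ∀ x : Q, π x = x) ∧ ∃ x ∈ Q, g x ≠ 0}
    ⟨⊤, ⟨Submodule.topEquiv.symm.toLinearMap, fun _ => rfl⟩, 1, Submodule.mem_top, by
      simpa [g] using hy⟩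
  have hsplit : ∀ N₁ N₂ : Submodule A Q, IsCompl N₁ N₂ → (∃ n ∈ N₁, g (n : A) ≠ 0) → N₂ = ⊥ := by
    rintro N₁ N₂ h ⟨n, hn, hgn⟩
    have hmem : N₁.map Q.subtype ∈
        {Q : Submodule A A | (∃ π : A →ₗ[A] Q, ∀ x : Q, π x = x) ∧ ∃ x ∈ Q, g x ≠ 0} := by
      refine ⟨⟨(Q.equivSubtypeMap N₁).toLinearMap ∘ₗ N₁.projectionOnto N₂ h ∘ₗ π, ?_⟩,
        n, ⟨n, hn, rfl⟩, hgn⟩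
      rintro ⟨_, z, hz, rfl⟩
      have h1 : π (Q.subtype z) = z := hπ z
      have h2 : N₁.projectionOnto N₂ h z = ⟨z, hz⟩ :=
        Submodule.projectionOnto_apply_left h ⟨z, hz⟩
      simp only [LinearMap.comp_apply, h1, h2]
      rfl
    have htop : N₁ = ⊤ := by
      by_contra hne
      refine hmin _ hmem (lt_of_le_of_ne (Submodule.map_subtype_le Q N₁) fun he => hne ?_)
      refine Submodule.map_injective_of_injective Q.injective_subtype (he.trans ?_)
      rw [Submodule.map_top, Submodule.range_subtype]
    rw [htop] at h
    exact top_disjoint.1 h.disjoint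
  refine ⟨Q, Module.Projective.of_split Q.subtype π (LinearMap.ext hπ),
    ⟨⟨⟨x, hxQ⟩, 0, fun h0 => hx ?_⟩, fun N₁ N₂ h => ?_⟩, g ∘ₗ Q.subtype,
    LinearMap.surjective_of_ne_zero fun h0 => hx (LinearMap.congr_fun h0 ⟨x, hxQ⟩)⟩
  · rw [show x = 0 from congrArg Subtype.val h0, map_zero]
  · obtain ⟨n₁, hn₁, n₂, hn₂, hadd⟩ := Submodule.mem_sup.1
      (h.sup_eq_top ▸ Submodule.mem_top : (⟨x, hxQ⟩ : Q) ∈ N₁ ⊔ N₂)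
    by_cases h1 : g (n₁ : A) = 0
    · refine Or.inl (hsplit N₂ N₁ h.symm ⟨n₂, hn₂, fun h2 => hx ?_⟩)
      rw [show x = n₁ + n₂ from congrArg Subtype.val hadd.symm, map_add, h1, h2, add_zero]
    · exact Or.inr (hsplit N₁ N₂ h ⟨n₁, hn₁, h1⟩)

/-- Injective envelopes of simple modules are indecomposable. -/
theorem IsInjectiveEnvelope.isIndecomposable {M I : Type u} [AddCommGroup M] [Module A M]
    [AddCommGroup I] [Module A I] [IsSimpleModule A M] {i : M →ₗ[A] I}
    (hi : IsInjectiveEnvelope i) : IsIndecomposable A I := by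
  have : Nontrivial M := IsSimpleModule.nontrivial A M
  have hle : ∀ N : Submodule A I, N ≠ ⊥ → LinearMap.range i ≤ N := by
    intro N hN
    have h : Submodule.comap i N ≠ ⊥ := fun h => hN (hi.essential N (by
      rw [inf_comm, ← Submodule.map_comap_eq, h, Submodule.map_bot]))
    rw [LinearMap.range_eq_map, Submodule.map_le_iff_le_comap]
    exact ((eq_bot_or_eq_top _).resolve_left h).ge
  refine ⟨hi.mono.nontrivial, fun N₁ N₂ h => ?_⟩
  by_contra! hne
  obtain ⟨y, hy⟩ := exists_ne (0 : M)
  have := Submodule.disjoint_def.1 h.disjoint (i y) (hle N₁ hne.1 ⟨y, rfl⟩) (hle N₂ hne.2 ⟨y, rfl⟩)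
  exact hy (hi.mono (by rw [this, map_zero]))

/-- Nakayama algebras are serial. -/
theorem IsNakayama.isSerialArtinian (R : Type u) [CommRing R] [IsArtinianRing R] [Algebra R A]
    [Module.Finite R A] (h : IsNakayama A) : IsSerialArtinian A := by
  have hart : IsArtinianRing A := IsArtinianRing.of_finite R A
  refine ⟨hart, fun s => ?_, fun s => ?_⟩
  · obtain ⟨Q, hproj, hind, p, hp⟩ := exists_isIndecomposable_summand s
    have hfl : IsFiniteLength A Q :=
      isFiniteLength_iff_isNoetherian_isArtinian.2 ⟨inferInstance, inferInstance⟩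
    have huni := h (ModuleCat.of A Q) inferInstance hind (Or.inl hproj)
    have := hind.1
    obtain ⟨t, ℓ, hℓ, hQ⟩ := exists_isChainModule huni hfl
    obtain rfl := hQ.top_unique hp
    exact ⟨ModuleCat.of A Q, ℓ, hℓ, hproj, hQ⟩
  · obtain ⟨I, i, hi⟩ := exists_injectiveEnvelope A s.rep
    obtain ⟨j, hj⟩ := exists_injective_dual_self R s
    -- Embedding the envelope in the dual of the ring makes it finitely generated, as the Nakayama
    -- condition requires.
    obtain ⟨f, hf, -⟩ := exists_injective_of_hull hi (injective_dual_self R A) hj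
    have : Module.Finite A (Dual R A) := Dual.finite
    have h1 := isNoetherian_of_injective f hf
    have h2 : IsArtinian A I := isArtinian_of_injective f hf
    exact ⟨I, i, hi, isFiniteLength_iff_isNoetherian_isArtinian.2 ⟨h1, h2⟩,
      h I inferInstance hi.isIndecomposable (Or.inr hi.injective)⟩

end NakayamaAlgebra

end Nakayama

theorem mainTheorem2 {R A : Type u} [CommRing R] [IsArtinianRing R] [Ring A] [Algebra R A]
    [Module.Finite R A] (hNak : Nakayama.IsNakayama A) (hconn : Nakayama.IsConnected A)
    (hgl : Nakayama.globalDimension A = ⊤) :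
    List.TFAE
      [Nakayama.IsGorenstein R A,
       ∀ s : Nakayama.SimpleClass A, Nakayama.IsGammaCyclic R s → Nakayama.IsGammaBlack s,
       ∀ s : Nakayama.SimpleClass A, Nakayama.IsPsiCyclic R s → Nakayama.IsPsiBlack s,
       {s : Nakayama.SimpleClass A | Nakayama.IsGammaCyclic R s} =
         {s : Nakayama.SimpleClass A | Nakayama.IsPsiCyclic R s},
       ∀ (m : ℕ) (c : ZMod m → Nakayama.SimpleClass A),
         Nakayama.IsCycle (Nakayama.resolutionQuiver R A) m c →
           ∀ i, Nakayama.IsGammaBlack (c i)] := by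
  have := hNak.isSerialArtinian R
  have : Nakayama.IsCyclicSerial A := ⟨hconn, hgl⟩
  exact Nakayama.tfae_isGorenstein R
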